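/- Let $\dot H^{1/2}_h$ be the Hilbert space of tempered distributions $f$ on $\mathbb{R}^2$ whose Fourier transform is a function and for which $|\partial_x|^{1/4}|\partial_y|^{1/4}f\in L^2(\mathbb{R}^2)$, with norm $\|f\|_{\dot H^{1/2}_h}=\||\partial_x|^{1/4}|\partial_y|^{1/4}f\|_{L^2}$. Let $e^{it\partial_x\partial_y}$ be the propagator of $i\partial_t u+\partial_x\partial_y u=0$. For $x_0,y_0\in\mathbb{R}$ and $\lambda_1,\lambda_2\in(0,\infty)$ let $g=g(x_0,y_0,\lambda_1,\lambda_2)$ be the operator with $$(g^{-1}f)(x,y)=(\lambda_1\lambda_2)^{1/4}f(\lambda_1x+x_0,\lambda_2y+y_0),\qquad (gf)(x,y)=(\lambda_1\lambda_2)^{-1/4}f\Big(\frac{x-x_0}{\lambda_1},\frac{y-y_0}{\lambda_2}\Big).$$ **Proposition.** Let $(u_n)$ be a sequence in $\dot H^{1/2}_h$ with $\|u_n\|_{\dot H^{1/2}_h}\le A$ for all $n$. Then, after passing to a subsequence, there exist for every $1\le j<\infty$ a profile $\phi^j\in\dot H^{1/2}_h$, parameters $(t_n^j,x_n^j,y_n^j)\in\mathbb{R}^3$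 and $\lambda_{n,1}^j,\lambda_{n,2}^j\in(0,\infty)$, and for every $J$ remainders $w_n^J\in\dot H^{1/2}_h$ such that, with $g_n^j=g(x_n^j,y_n^j,\lambda_{n,1}^j,\lambda_{n,2}^j)$, the following holds. 1. For all $J$ and $n$, $\;u_n=\sum_{j=1}^J g_n^je^{it_n^j\partial_x\partial_y}\phi^j+w_n^J$. 2. $\lim_{J\to\infty}\limsup_{n\to\infty}\|e^{it\partial_x\partial_y}w_n^J\|_{L^8_{x,y,t}(\mathbb{R}^2\times\mathbb{R})}=0$. 3. For all $1\le j\le J$, $\;e^{-it_n^j\partial_x\partial_y}(g_n^j)^{-1}w_n^J\rightharpoonup0$ weakly in $\dot H^{1/2}_h$ as $n\to\infty$. 4. For all $J$, $\;\lim_{n\to\infty}\Big(\|u_n\|_{\dot H^{1/2}_h}^2-\sum_{j=1}^J\|\phi^j\|_{\dot H^{1/2}_h}^2-\|w_n^J\|_{\dot H^{1/2}_h}^2\Big)=0$. 5. For all $j\ne k$, $$\limsup_{n\to\infty}\left[\left|\ln\frac{\lambda_{n,1}^j}{\lambda_{n,1}^k}\right|+\left|\ln\frac{\lambda_{n,2}^j}{\lambda_{n,2}^k}\right|+\frac{|x_n^j-x_n^k|}{(\lambda_{n,1}^j\lambda_{n,1}^k)^{1/2}}+\frac{|y_n^j-y_n^k|}{(\lambda_{n,2}^j\lambda_{n,2}^k)^{1/2}}+\frac{|t_n^j\lambda_{n,1}^j\lambda_{n,2}^j-t_n^k\lambda_{n,1}^k\lambda_{n,2}^k|}{(\lambda_{n,1}^j\lambda_{n,2}^j\lambda_{n,1}^k\lambda_{n,2}^k)^{1/2}}\right]=\infty.$$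 -/

import Mathlib

open MeasureTheory Filter Topology FourierTransform
open scoped SchwartzMap ENNReal

namespace HypNLS

noncomputable section

/-- The plane `ℝ²`; the coordinates of `z` are `x = z 0` and `y = z 1`. -/
abbrev Plane : Type := EuclideanSpace ℝ (Fin 2)

/-- The tempered distribution `F` is given by integration against the function `h`. -/
def Represents (F : 𝓢'(Plane, ℂ)) (h : Plane → ℂ) : Prop :=
  ∀ φ : 𝓢(Plane, ℂ), Integrable (fun z => φ z • h z) ∧ F φ = ∫ z, φ z • h z

/-- The Fourier symbol of `|∂_x|^{1/4} |∂_y|^{1/4}`. Mathlib's Fourier transform is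
`f̂(ξ) = ∫ e^{-2πi⟨z,ξ⟩} f(z) dz`, so that `∂_x` has the symbol `2πi ξ₀`. -/
def symbol (ξ : Plane) : ℝ :=
  |2 * Real.pi * ξ 0| ^ (1 / 4 : ℝ) * |2 * Real.pi * ξ 1| ^ (1 / 4 : ℝ)

/-- `v = |∂_x|^{1/4} |∂_y|^{1/4} f` with `v ∈ L²(ℝ²)`: the Fourier transform of the tempered
distribution `f` is a function `h`, and `v̂ = symbol · h` almost everywhere. -/
def IsFracDeriv (f : 𝓢'(Plane, ℂ)) (v : Lp ℂ 2 (volume : Measure Plane)) : Prop :=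
  ∃ h : Plane → ℂ, Represents (𝓕 f) h ∧
    ((𝓕 v : Lp ℂ 2 (volume : Measure Plane)) : Plane → ℂ) =ᵐ[volume]
      fun ξ => (symbol ξ : ℂ) * h ξ

/-- Membership in the space `Ḣ^{1/2}_h`: the tempered distributions `f` whose Fourier transform is
a function and for which `|∂_x|^{1/4} |∂_y|^{1/4} f` lies in `L²(ℝ²)`. -/
def MemHh (f : 𝓢'(Plane, ℂ)) : Prop :=
  ∃ v, IsFracDeriv f v

open Classical in
/-- `|∂_x|^{1/4} |∂_y|^{1/4} f ∈ L²(ℝ²)` for `f ∈ Ḣ^{1/2}_h` (and `0` for other `f`). -/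
def fracDeriv (f : 𝓢'(Plane, ℂ)) : Lp ℂ 2 (volume : Measure Plane) :=
  if hf : MemHh f then hf.choose else 0

/-- The norm `‖ |∂_x|^{1/4} |∂_y|^{1/4} f ‖_{L²}` of `Ḣ^{1/2}_h`. -/
def hhNorm (f : 𝓢'(Plane, ℂ)) : ℝ := ‖fracDeriv f‖

/-- The inner product of the Hilbert space `Ḣ^{1/2}_h`. -/
def hhInner (f g : 𝓢'(Plane, ℂ)) : ℂ := inner ℂ (fracDeriv f) (fracDeriv g)

/-- Weak convergence to `0` in the Hilbert space `Ḣ^{1/2}_h`. -/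
def WeaklyNull (f : ℕ → 𝓢'(Plane, ℂ)) : Prop :=
  (∀ n, MemHh (f n)) ∧
    ∀ ψ : 𝓢'(Plane, ℂ), MemHh ψ → Tendsto (fun n => hhInner ψ (f n)) atTop (𝓝 0)

theorem exp_mul_I_hasTemperateGrowth :
    (fun s : ℝ => Complex.exp ((s : ℂ) * Complex.I)).HasTemperateGrowth := by
  have hd : ∀ (n : ℕ) (s : ℝ), iteratedDeriv n (fun s : ℝ => Complex.exp ((s : ℂ) * Complex.I)) s
      = Complex.I ^ n * Complex.exp ((s : ℂ) * Complex.I) := by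
    intro n
    induction n with
    | zero => simp
    | succ n ih =>
      intro s
      rw [iteratedDeriv_succ, funext ih]
      have h : HasDerivAt (fun s : ℝ => Complex.I ^ n * Complex.exp ((s : ℂ) * Complex.I))
          (Complex.I ^ n * (Complex.exp ((s : ℂ) * Complex.I) * (1 * Complex.I))) s :=
        (((Complex.ofRealCLM.hasDerivAt (x := s)).mul_const Complex.I).cexp).const_mul _
      rw [h.deriv]
      ring
  refine ⟨(Complex.ofRealCLM.contDiff.mul contDiff_const).cexp, fun n => ⟨0, 1, fun s => ?_⟩⟩
  rw [norm_iteratedFDeriv_eq_norm_iteratedDeriv, hd]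
  simp [Complex.norm_exp_ofReal_mul_I]

/-- The symbol of the propagator is an admissible multiplier on tempered distributions. -/
theorem propagator_symbol_hasTemperateGrowth (t : ℝ) :
    (fun ξ : Plane => Complex.exp
      (((-(4 * Real.pi ^ 2 * t * (ξ 0 * ξ 1)) : ℝ) : ℂ) * Complex.I)).HasTemperateGrowth := by
  have h (i : Fin 2) : (fun z : Plane => z i).HasTemperateGrowth :=
    (EuclideanSpace.proj i : Plane →L[ℝ] ℝ).hasTemperateGrowth
  have h0 := h 0
  have h1 := h 1
  exact exp_mul_I_hasTemperateGrowth.comp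
    (f := fun ξ : Plane => -(4 * Real.pi ^ 2 * t * (ξ 0 * ξ 1))) (by fun_prop)

/-- The propagator `e^{it∂_x∂_y}`, the Fourier multiplier with the symbol
`exp(it (2πi ξ₀)(2πi ξ₁)) = exp(-4π² i t ξ₀ ξ₁)`. -/
def propagator (t : ℝ) : 𝓢'(Plane, ℂ) →L[ℂ] 𝓢'(Plane, ℂ) :=
  TemperedDistribution.fourierMultiplierCLM ℂ
    (fun ξ : Plane => Complex.exp (((-(4 * Real.pi ^ 2 * t * (ξ 0 * ξ 1)) : ℝ) : ℂ) * Complex.I))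

/-- The norm `‖e^{it∂_x∂_y} f‖_{L^8_{x,y,t}}`, with value `∞` if `(t, z) ↦ (e^{it∂_x∂_y} f)(z)` is
not a function in `L^8(ℝ × ℝ²)`. The functions `U` over which the infimum runs agree almost
everywhere. -/
def strichartzNorm (f : 𝓢'(Plane, ℂ)) : ℝ≥0∞ :=
  ⨅ (U : ℝ × Plane → ℂ) (_ : AEStronglyMeasurable U volume)
    (_ : ∀ᵐ t : ℝ, Represents (propagator t f) (fun z => U (t, z))), eLpNorm U 8 volume

/-- The affine map `(x, y) ↦ (a x + c, b y + d)`. -/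
def affineMap (a b c d : ℝ) (z : Plane) : Plane := !₂[a * z 0 + c, b * z 1 + d]

theorem affineMap_hasTemperateGrowth (a b c d : ℝ) :
    (affineMap a b c d).HasTemperateGrowth := by
  have h (i : Fin 2) : (fun z : Plane => z i).HasTemperateGrowth :=
    (EuclideanSpace.proj i : Plane →L[ℝ] ℝ).hasTemperateGrowth
  have h0 := h 0
  have h1 := h 1
  have key : affineMap a b c d = fun z : Plane =>
      (a * z 0 + c) • EuclideanSpace.single (0 : Fin 2) (1 : ℝ)
        + (b * z 1 + d) • EuclideanSpace.single (1 : Fin 2) (1 : ℝ) := by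
    ext z i
    fin_cases i <;> simp [affineMap]
  rw [key]
  fun_prop

theorem affineMap_antilipschitz {a b : ℝ} (ha : 0 < a) (hb : 0 < b) (c d : ℝ) :
    AntilipschitzWith (max a⁻¹ b⁻¹).toNNReal (affineMap a b c d) := by
  apply AntilipschitzWith.of_le_mul_dist
  intro z w
  have hM : 0 ≤ max a⁻¹ b⁻¹ := le_max_of_le_left (inv_nonneg.2 ha.le)
  rw [Real.coe_toNNReal _ hM, EuclideanSpace.dist_eq, EuclideanSpace.dist_eq]
  apply Real.sqrt_le_iff.2 ⟨by positivity, ?_⟩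
  rw [mul_pow, Real.sq_sqrt (by positivity)]
  have e (r p q s : ℝ) (hr : 0 < r) (hs : r⁻¹ ≤ max a⁻¹ b⁻¹) :
      dist p q ^ 2 ≤ (max a⁻¹ b⁻¹) ^ 2 * dist (r * p + s) (r * q + s) ^ 2 := by
    have h1 : dist p q = r⁻¹ * dist (r * p + s) (r * q + s) := by
      rw [Real.dist_eq, Real.dist_eq, add_sub_add_right_eq_sub, ← mul_sub, abs_mul, abs_of_pos hr,
        inv_mul_cancel_left₀ hr.ne']
    rw [h1, mul_pow]
    gcongr
  have e0 := e a (z 0) (w 0) c ha (le_max_left _ _)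
  have e1 := e b (z 1) (w 1) d hb (le_max_right _ _)
  simp only [Fin.sum_univ_two, affineMap, Matrix.cons_val_zero, Matrix.cons_val_one]
  linarith

/-- The map `φ(x, y) ↦ φ(a x + c, b y + d)` on Schwartz functions. -/
def compAffine {a b : ℝ} (ha : 0 < a) (hb : 0 < b) (c d : ℝ) :
    𝓢(Plane, ℂ) →L[ℂ] 𝓢(Plane, ℂ) :=
  SchwartzMap.compCLMOfAntilipschitz ℂ (affineMap_hasTemperateGrowth a b c d)
    (affineMap_antilipschitz ha hb c d)

/-- The parameters `(x₀, y₀) ∈ ℝ²`, `λ₁, λ₂ ∈ (0, ∞)` of a symmetry. -/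
structure Sym where
  x₀ : ℝ
  y₀ : ℝ
  lam₁ : ℝ
  lam₂ : ℝ
  lam₁_pos : 0 < lam₁
  lam₂_pos : 0 < lam₂

/-- `(g⁻¹ f)(x, y) = (λ₁λ₂)^{1/4} f(λ₁ x + x₀, λ₂ y + y₀)`, for tempered distributions: by duality
`⟨g⁻¹ f, φ⟩ = (λ₁λ₂)^{1/4} (λ₁λ₂)^{-1} ⟨f, φ((x - x₀)/λ₁, (y - y₀)/λ₂)⟩`. -/
def Sym.actInv (g : Sym) (f : 𝓢'(Plane, ℂ)) : 𝓢'(Plane, ℂ) :=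
  (((g.lam₁ * g.lam₂) ^ (1 / 4 : ℝ) * (g.lam₁ * g.lam₂)⁻¹ : ℝ) : ℂ) •
    PointwiseConvergenceCLM.precomp ℂ
      (compAffine (inv_pos.2 g.lam₁_pos) (inv_pos.2 g.lam₂_pos)
        (-(g.x₀ / g.lam₁)) (-(g.y₀ / g.lam₂))) f

/-- `(g f)(x, y) = (λ₁λ₂)^{-1/4} f((x - x₀)/λ₁, (y - y₀)/λ₂)`, for tempered distributions: by
duality `⟨g f, φ⟩ = (λ₁λ₂)^{-1/4} λ₁λ₂ ⟨f, φ(λ₁ x + x₀, λ₂ y + y₀)⟩`. -/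
def Sym.act (g : Sym) (f : 𝓢'(Plane, ℂ)) : 𝓢'(Plane, ℂ) :=
  (((g.lam₁ * g.lam₂) ^ (-(1 / 4) : ℝ) * (g.lam₁ * g.lam₂) : ℝ) : ℂ) •
    PointwiseConvergenceCLM.precomp ℂ (compAffine g.lam₁_pos g.lam₂_pos g.x₀ g.y₀) f

/-- The quantity measuring the separation of the parameters `(g, t)` and `(g', t')`. -/
def separation (g : Sym) (t : ℝ) (g' : Sym) (t' : ℝ) : ℝ :=
  |Real.log (g.lam₁ / g'.lam₁)| + |Real.log (g.lam₂ / g'.lam₂)|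
    + |g.x₀ - g'.x₀| / (g.lam₁ * g'.lam₁) ^ (1 / 2 : ℝ)
    + |g.y₀ - g'.y₀| / (g.lam₂ * g'.lam₂) ^ (1 / 2 : ℝ)
    + |t * (g.lam₁ * g.lam₂) - t' * (g'.lam₁ * g'.lam₂)|
        / (g.lam₁ * g.lam₂ * g'.lam₁ * g'.lam₂) ^ (1 / 2 : ℝ)

end

end HypNLS

/-! The proof runs on the Fourier side. The map f ↦ `symbol` · 𝓕 f identifies Ḣ^{1/2}_h
isometrically with L² of the frequency plane (`ofFreq`, `MemHh.exists_ofFreq`, `hhNorm_ofFreq`).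
There, translations, dilations and the propagator become unitary operators: a unimodular phase times
an L²-normalised dilation (`Par.op`). The statement then splits into an abstract Hilbert space
argument and one analytic inequality.

Abstract part (`Dislocations`). Suppose that separated parameters make matrix coefficients vanish,
and that non-separated ones give relative operators that converge strongly along the ultrafilter.
Profiles are extracted greedily: at each stage one takes a weak limit of the remainder, in a frame
separated from the earlier ones, whose norm is at least half of the best possible. Each extraction
splits the norm by Pythagoras, so the squared norms of the profiles are summable and later weak
limits are small. Working along a fixed ultrafilter makes every bounded sequence weakly convergent,
so no diagonal subsequences are needed; one subsequence is chosen at the end, when only countably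
many limits have to be realised.

Analytic part (`exists_le_inner_bump`). A bounded function with large Strichartz norm must correlate
with some transform of one fixed profile, `bump`. This follows from the refined estimate
`exists_refined_strichartz`. Frequencies are cut into products of dyadic shells. The value at a
space-time point of the wave localised to one box is, up to a power of the scale, a matrix
coefficient of `bump`, so it is enough to bound L⁸ by the supremum of these values times a power of
the L² norm. On one box this comes from an L⁶ bound and the supremum. Two boxes at different scales
in either direction interact weakly, by a bilinear L² bound. Expanding the eighth power as the
square of a fourfold sum and averaging the bounds over all pairings and both directions gives
summable decay.

Both the L⁶ and the bilinear bound express a power or product of waves as the Fourier extension of a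
tensor product along a sum of points of the surface τ = -2πξ₀ξ₁. By `lintegral_extension_sq_le` only
a density bound for that sum is needed. The same L⁶ bound also shows that waves with continuous
compactly supported profile decay at infinity, which gives the asymptotic orthogonality of
translations. -/

namespace HypNLS

/-! ### Weak limits along filters and ultrafilters -/

section WeakLimits

variable {H : Type*} [NormedAddCommGroup H] [InnerProductSpace ℂ H]

/-- Weak convergence of the sequence `x` to `φ` along the filter `l`. -/
def WeakLim (l : Filter ℕ) (x : ℕ → H) (φ : H) : Prop :=
  ∀ ψ : H, Tendsto (fun n => inner ℂ ψ (x n)) l (𝓝 (inner ℂ ψ φ))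

theorem WeakLim.sub {l : Filter ℕ} {x y : ℕ → H} {φ ψ : H} (hx : WeakLim l x φ)
    (hy : WeakLim l y ψ) : WeakLim l (fun n => x n - y n) (φ - ψ) := fun χ => by
  simpa only [inner_sub_right] using (hx χ).sub (hy χ)

theorem WeakLim.norm_le {l : Filter ℕ} [NeBot l] {x : ℕ → H} {φ : H} (hx : WeakLim l x φ) {C : ℝ}
    (hC : ∀ n, ‖x n‖ ≤ C) : ‖φ‖ ≤ C := by
  have h : ‖inner ℂ φ φ‖ ≤ ‖φ‖ * C := by
    refine le_of_tendsto (hx φ).norm (Eventually.of_forall fun n => ?_)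
    exact (norm_inner_le_norm _ _).trans (mul_le_mul_of_nonneg_left (hC n) (norm_nonneg _))
  rw [inner_self_eq_norm_sq_to_K, norm_pow, RCLike.norm_ofReal, abs_norm, sq] at h
  rcases eq_or_lt_of_le (norm_nonneg φ) with h0 | h0
  · rw [← h0]
    exact (norm_nonneg _).trans (hC 0)
  · exact le_of_mul_le_mul_left h h0

/-- Bounded sequences converge weakly along ultrafilters. -/
theorem exists_weakLim [CompleteSpace H] (ω : Ultrafilter ℕ) {x : ℕ → H} {C : ℝ}
    (hC : ∀ n, ‖x n‖ ≤ C) : ∃ φ, WeakLim ω x φ := by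
  let f : ℕ → WeakDual ℂ H := fun n => StrongDual.toWeakDual (InnerProductSpace.toDual ℂ H (x n))
  have hcomp := WeakDual.isCompact_closedBall (𝕜 := ℂ) (E := H) 0 C
  obtain ⟨ℓ, -, hℓ⟩ := hcomp.ultrafilter_le_nhds (ω.map f) (by
    rw [le_principal_iff, Ultrafilter.coe_map, mem_map]
    refine Filter.univ_mem' fun n => ?_
    change InnerProductSpace.toDual ℂ H (x n) ∈ Metric.closedBall 0 C
    simpa using hC n)
  have ht : Tendsto f ω (𝓝 ℓ) := hℓ
  refine ⟨(InnerProductSpace.toDual ℂ H).symm (WeakDual.toStrongDual ℓ), fun ψ => ?_⟩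
  have h1 : Tendsto (fun n => f n ψ) ω (𝓝 (ℓ ψ)) :=
    (WeakDual.eval_continuous ψ).continuousAt.tendsto.comp ht
  -- Riesz duality places the sequence in the conjugate-linear slot; conjugation moves it to the
  -- other one.
  have h2 := (Complex.continuous_conj.tendsto _).comp h1
  have e1 : ∀ n, (starRingEnd ℂ) (f n ψ) = inner ℂ ψ (x n) := fun n => by
    rw [← inner_conj_symm]; rfl
  have e2 : (starRingEnd ℂ) (ℓ ψ)
      = inner ℂ ψ ((InnerProductSpace.toDual ℂ H).symm (WeakDual.toStrongDual ℓ)) := by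
    rw [← inner_conj_symm, InnerProductSpace.toDual_symm_apply]; rfl
  rw [← e2]
  refine h2.congr fun n => ?_
  exact e1 n

/-- For bounded sequences a countable dense set of test vectors suffices. This turns weak
convergence into countably many conditions, which a single subsequence can satisfy. -/
theorem weakLim_zero_of_dense {x : ℕ → H} {C : ℝ} {l : Filter ℕ} (hC : ∀ n, ‖x n‖ ≤ C) {d : ℕ → H}
    (hd : DenseRange d) (h : ∀ i, Tendsto (fun n => inner ℂ (d i) (x n)) l (𝓝 0)) :
    WeakLim l x 0 := by
  intro ψ
  rw [inner_zero_right, Metric.tendsto_nhds]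
  intro ε hε
  have hC0 : 0 ≤ C := (norm_nonneg _).trans (hC 0)
  obtain ⟨i, hi⟩ := hd.exists_dist_lt ψ (ε := ε / (2 * (C + 1))) (by positivity)
  filter_upwards [Metric.tendsto_nhds.1 (h i) (ε / 2) (by positivity)] with n hn
  rw [dist_zero_right] at hn ⊢
  have e : inner ℂ ψ (x n) = inner ℂ (ψ - d i) (x n) + inner ℂ (d i) (x n) := by
    rw [inner_sub_left]; ring
  have h1 : ‖inner ℂ (ψ - d i) (x n)‖ ≤ ε / (2 * (C + 1)) * C := by
    refine (norm_inner_le_norm _ _).trans ?_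
    rw [← dist_eq_norm]
    exact mul_le_mul hi.le (hC n) (norm_nonneg _) (by positivity)
  have h2 : ε / (2 * (C + 1)) * C ≤ ε / 2 := by
    rw [div_mul_eq_mul_div, div_le_div_iff₀ (by positivity) (by positivity)]
    nlinarith
  rw [e]
  exact (norm_add_le _ _).trans_lt (by linarith)

theorem WeakLim.tendsto_inner_of_tendsto {l : Filter ℕ} {x y : ℕ → H} {φ ψ : H}
    (hx : WeakLim l x φ) {C : ℝ} (hC : ∀ n, ‖x n‖ ≤ C) (hy : Tendsto y l (𝓝 ψ)) :
    Tendsto (fun n => inner ℂ (y n) (x n)) l (𝓝 (inner ℂ ψ φ)) := by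
  have h1 : Tendsto (fun n => inner ℂ (y n - ψ) (x n)) l (𝓝 0) := by
    have h2 : Tendsto (fun n => ‖y n - ψ‖ * C) l (𝓝 0) := by
      simpa using ((tendsto_iff_norm_sub_tendsto_zero.1 hy).mul_const C)
    refine squeeze_zero_norm (fun n => ?_) h2
    exact (norm_inner_le_norm _ _).trans (mul_le_mul_of_nonneg_left (hC n) (norm_nonneg _))
  have h3 := h1.add (hx ψ)
  rw [zero_add] at h3
  refine h3.congr fun n => ?_
  rw [inner_sub_left]; ring

/-- A countable family of statements that hold along an ultrafilter finer than `atTop` holds along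
a subsequence. -/
theorem exists_strictMono_tendsto {ι : Type*} [Countable ι] (ω : Ultrafilter ℕ)
    (hω : (ω : Filter ℕ) ≤ atTop) (l : ι → Filter ℕ) [∀ i, (l i).IsCountablyGenerated]
    (hl : ∀ i, (ω : Filter ℕ) ≤ l i) :
    ∃ σ : ℕ → ℕ, StrictMono σ ∧ ∀ i, Tendsto σ atTop (l i) := by
  have hle : (ω : Filter ℕ) ≤ atTop ⊓ ⨅ i, l i := le_inf hω (le_iInf hl)
  -- The ultrafilter serves only to show that the required conditions are jointly consistent. Their
  -- infimum is countably generated, hence is reached by a sequence.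
  have : NeBot (atTop ⊓ ⨅ i, l i) := NeBot.mono ω.neBot hle
  obtain ⟨x, hx⟩ := exists_seq_tendsto (atTop ⊓ ⨅ i, l i)
  have hx1 : Tendsto x atTop atTop := hx.mono_right inf_le_left
  obtain ⟨φ, hφ, hφ'⟩ := strictMono_subseq_of_tendsto_atTop hx1
  refine ⟨x ∘ φ, hφ', fun i => ?_⟩
  exact (hx.mono_right (inf_le_right.trans (iInf_le _ i))).comp hφ.tendsto_atTop

/-- Dependent choice in which each step sees the whole history; the greedy extraction needs all
earlier profiles. -/
theorem exists_seq_of_forall_list {α : Type*} {R : List α → α → Prop} (hR : ∀ l, ∃ y, R l y) :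
    ∃ f : ℕ → α, ∀ J, R ((List.range J).map f) (f J) := by
  choose step hstep using hR
  let hist : ℕ → List α := fun J => Nat.rec [] (fun _ l => l ++ [step l]) J
  have hs : ∀ J, hist (J + 1) = hist J ++ [step (hist J)] := fun J => rfl
  have key : ∀ J, (List.range J).map (fun j => step (hist j)) = hist J := by
    intro J
    induction J with
    | zero => rfl
    | succ J ih => rw [List.range_succ, List.map_append, ih, hs]; rfl
  exact ⟨fun J => step (hist J), fun J => by rw [key]; exact hstep _⟩

end WeakLimits

/-! ### Abstract profile decomposition -/

/-- A family of unitary operators with a notion of separation of its parameters: separated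
parameters give asymptotically orthogonal operators, and non-separated ones give operators which
are comparable up to a strongly convergent sequence. -/
structure Dislocations (H P : Type*) [NormedAddCommGroup H] [InnerProductSpace ℂ H] where
  /-- The operators. -/
  D : P → H ≃ₗᵢ[ℂ] H
  /-- The separation of two parameters. -/
  sep : P → P → ℝ
  tendsto_inner : ∀ (ω : Ultrafilter ℕ) (p q : ℕ → P),
    Tendsto (fun n => sep (p n) (q n)) ω atTop →
      ∀ φ ψ, Tendsto (fun n => inner ℂ (D (p n) φ) (D (q n) ψ)) ω (𝓝 0)
  exists_tendsto : ∀ (ω : Ultrafilter ℕ) (p q : ℕ → P),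
    ¬ Tendsto (fun n => sep (p n) (q n)) ω atTop →
      ∀ ψ, ∃ ψ', Tendsto (fun n => (D (q n)).symm (D (p n) ψ)) ω (𝓝 ψ')
  exists_sep : ∀ (s : List P) (R : ℝ), ∃ p, ∀ q ∈ s, R ≤ sep p q

namespace Dislocations

variable {H P : Type*} [NormedAddCommGroup H] [InnerProductSpace ℂ H] (𝒟 : Dislocations H P)

/-- The remainder after the removal of the profiles in the list `l`. -/
def resid (u : ℕ → H) (l : List (H × (ℕ → P))) (n : ℕ) : H :=
  u n - (l.map fun x => 𝒟.D (x.2 n) x.1).sum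

theorem norm_resid_le {u : ℕ → H} {A : ℝ} (hA : ∀ n, ‖u n‖ ≤ A) (l : List (H × (ℕ → P))) (n : ℕ) :
    ‖𝒟.resid u l n‖ ≤ A + (l.map fun x => ‖x.1‖).sum := by
  refine (norm_sub_le _ _).trans (add_le_add (hA n) ?_)
  induction l with
  | nil => simp
  | cons x l ih =>
    simp only [List.map_cons, List.sum_cons]
    exact (norm_add_le _ _).trans (add_le_add (by simp) ih)

/-- `φ` is a weak limit of the remainder in a frame which is separated from the previous ones. -/
def Admissible (ω : Ultrafilter ℕ) (u : ℕ → H) (l : List (H × (ℕ → P))) (φ : H) (p : ℕ → P) :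
    Prop :=
  (∀ x ∈ l, Tendsto (fun n => 𝒟.sep (p n) (x.2 n)) ω atTop) ∧
    WeakLim ω (fun n => (𝒟.D (p n)).symm (𝒟.resid u l n)) φ

/-- Admissible limits exist because `exists_sep` supplies frames far from the previous ones, and
their norms are bounded by that of the remainder. The supremum of these norms need not be attained,
so one settles for more than half of it; this is the factor 2. If the supremum is 0, any admissible
limit will do. -/
theorem exists_extraction [CompleteSpace H] (ω : Ultrafilter ℕ) (hω : (ω : Filter ℕ) ≤ atTop) {u : ℕ → H} {A : ℝ}
    (hA : ∀ n, ‖u n‖ ≤ A) (l : List (H × (ℕ → P))) :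
    ∃ x : H × (ℕ → P), 𝒟.Admissible ω u l x.1 x.2 ∧
      ∀ φ p, 𝒟.Admissible ω u l φ p → ‖φ‖ ≤ 2 * ‖x.1‖ := by
  set C := A + (l.map fun x => ‖x.1‖).sum with hCdef
  have hC : ∀ (p : ℕ → P) n, ‖(𝒟.D (p n)).symm (𝒟.resid u l n)‖ ≤ C := fun p n => by
    rw [LinearIsometryEquiv.norm_map]; exact 𝒟.norm_resid_le hA l n
  have hne : ∃ φ p, 𝒟.Admissible ω u l φ p := by
    choose p hp using fun n : ℕ => 𝒟.exists_sep (l.map fun x => x.2 n) n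
    obtain ⟨φ, hφ⟩ := exists_weakLim ω (hC p)
    refine ⟨φ, p, fun x hx => ?_, hφ⟩
    refine tendsto_atTop_mono (fun n => hp n _ (List.mem_map.2 ⟨x, hx, rfl⟩)) ?_
    exact tendsto_natCast_atTop_atTop.mono_left hω
  let S : Set ℝ := {r | ∃ φ p, 𝒟.Admissible ω u l φ p ∧ ‖φ‖ = r}
  have hbdd : BddAbove S := by
    refine ⟨C, ?_⟩
    rintro _ ⟨φ, p, h, rfl⟩
    exact h.2.norm_le (hC p)
  have hSne : S.Nonempty := by
    obtain ⟨φ, p, h⟩ := hne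
    exact ⟨_, φ, p, h, rfl⟩
  by_cases h0 : 0 < sSup S
  · obtain ⟨_, ⟨φ, p, h, rfl⟩, hlt⟩ := exists_lt_of_lt_csSup hSne (half_lt_self h0)
    refine ⟨(φ, p), h, fun φ' p' h' => ?_⟩
    have := le_csSup hbdd ⟨φ', p', h', rfl⟩
    simp only
    linarith
  · obtain ⟨φ, p, h⟩ := hne
    refine ⟨(φ, p), h, fun φ' p' h' => ?_⟩
    have h1 := le_csSup hbdd ⟨φ', p', h', rfl⟩
    have h2 := norm_nonneg φ
    simp only
    linarith

theorem resid_range_succ (u : ℕ → H) (x : ℕ → H × (ℕ → P)) (J n : ℕ) :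
    𝒟.resid u ((List.range (J + 1)).map x) n
      = 𝒟.resid u ((List.range J).map x) n - 𝒟.D ((x J).2 n) (x J).1 := by
  simp only [resid, List.range_succ, List.map_append, List.sum_append, List.map_cons, List.map_nil,
    List.sum_cons, List.sum_nil, add_zero, sub_sub]

theorem resid_range (u : ℕ → H) (x : ℕ → H × (ℕ → P)) (J n : ℕ) :
    𝒟.resid u ((List.range J).map x) n
      = u n - ∑ j ∈ Finset.range J, 𝒟.D ((x j).2 n) (x j).1 := by
  induction J with
  | zero => simp [resid]
  | succ J ih => rw [resid_range_succ, ih, Finset.sum_range_succ, sub_sub]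

/-- By unitarity ⟨ψ, D(p)⁻¹w⟩ = ⟨D(q)⁻¹D(p)ψ, D(q)⁻¹w⟩, and the left entry on the right-hand side
converges strongly. So a frame that is not separated from an exhausted frame sees nothing new. -/
theorem weakLim_of_not_separated (ω : Ultrafilter ℕ) {p q : ℕ → P} {w : ℕ → H} {C : ℝ}
    (hC : ∀ n, ‖w n‖ ≤ C) (hpq : ¬ Tendsto (fun n => 𝒟.sep (p n) (q n)) ω atTop)
    (hw : WeakLim ω (fun n => (𝒟.D (q n)).symm (w n)) 0) :
    WeakLim ω (fun n => (𝒟.D (p n)).symm (w n)) 0 := by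
  intro ψ
  obtain ⟨ψ', hψ'⟩ := 𝒟.exists_tendsto ω p q hpq ψ
  have h := hw.tendsto_inner_of_tendsto (C := C)
    (fun n => by rw [LinearIsometryEquiv.norm_map]; exact hC n) hψ'
  rw [inner_zero_right] at h ⊢
  refine h.congr fun n => ?_
  rw [LinearIsometryEquiv.inner_map_map, ← LinearIsometryEquiv.inner_map_map (𝒟.D (p n)) ψ,
    LinearIsometryEquiv.apply_symm_apply]

/-- Profile decomposition along an ultrafilter. -/
theorem exists_profiles [CompleteSpace H] (ω : Ultrafilter ℕ) (hω : (ω : Filter ℕ) ≤ atTop) {u : ℕ → H} {A : ℝ}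
    (hA : ∀ n, ‖u n‖ ≤ A) (Z : H → ℝ≥0∞) (ψ₀ : H)
    (hZ : ∀ A : ℝ, ∀ ε : ℝ≥0∞, 0 < ε → ∃ δ : ℝ, 0 < δ ∧ ∀ F, ‖F‖ ≤ A → ε < Z F →
      ∃ p, δ ≤ ‖inner ℂ (𝒟.D p ψ₀) F‖) :
    ∃ (φ : ℕ → H) (p : ℕ → ℕ → P) (w : ℕ → ℕ → H),
      (∀ J n, u n = ∑ j ∈ Finset.range J, 𝒟.D (p j n) (φ j) + w J n) ∧
      (∀ ε : ℝ≥0∞, 0 < ε → ∃ J₀, ∀ J ≥ J₀, ∀ᶠ n in (ω : Filter ℕ), Z (w J n) ≤ ε) ∧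
      (∀ J j, j < J → WeakLim ω (fun n => (𝒟.D (p j n)).symm (w J n)) 0) ∧
      (∀ J, Tendsto (fun n => ‖u n‖ ^ 2 - ∑ j ∈ Finset.range J, ‖φ j‖ ^ 2 - ‖w J n‖ ^ 2)
        ω (𝓝 0)) ∧
      (∀ j k, j < k → Tendsto (fun n => 𝒟.sep (p k n) (p j n)) ω atTop) ∧
      (∀ J, ∃ C, ∀ n, ‖w J n‖ ≤ C) := by
  obtain ⟨x, hx⟩ := exists_seq_of_forall_list (𝒟.exists_extraction ω hω hA)
  set w : ℕ → ℕ → H := fun J n => 𝒟.resid u ((List.range J).map x) n with hwdef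
  have hwsucc : ∀ J n, w (J + 1) n = w J n - 𝒟.D ((x J).2 n) (x J).1 :=
    fun J n => 𝒟.resid_range_succ u x J n
  have hsep : ∀ j k, j < k → Tendsto (fun n => 𝒟.sep ((x k).2 n) ((x j).2 n)) ω atTop := by
    intro j k hjk
    exact (hx k).1.1 (x j) (List.mem_map.2 ⟨j, List.mem_range.2 hjk, rfl⟩)
  have hbound : ∀ J, ∃ C, ∀ n, ‖w J n‖ ≤ C := fun J => ⟨_, fun n => 𝒟.norm_resid_le hA _ n⟩
  have hweak : ∀ J, WeakLim ω (fun n => (𝒟.D ((x J).2 n)).symm (w J n)) (x J).1 :=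
    fun J => (hx J).1.2
  -- Removing the profile of index J leaves the limits in the older frames unchanged, since
  -- separation makes that profile weakly null there; in its own frame it cancels exactly the weak
  -- limit.
  have hnull : ∀ J j, j < J → WeakLim ω (fun n => (𝒟.D ((x j).2 n)).symm (w J n)) 0 := by
    intro J
    induction J with
    | zero => intro j hj; exact absurd hj (Nat.not_lt_zero _)
    | succ J ih =>
      intro j hj
      simp only [hwsucc, map_sub]
      rcases Nat.lt_succ_iff_lt_or_eq.1 hj with h | rfl
      · have h2 : WeakLim ω (fun n => (𝒟.D ((x j).2 n)).symm (𝒟.D ((x J).2 n) (x J).1)) 0 := by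
          intro ψ
          have h3 := 𝒟.tendsto_inner ω _ _ (hsep j J h) (x J).1 ψ
          have h4 := (Complex.continuous_conj.tendsto _).comp h3
          rw [inner_zero_right]
          rw [map_zero] at h4
          refine h4.congr fun n => ?_
          simp only [Function.comp_apply]
          rw [inner_conj_symm, ← LinearIsometryEquiv.inner_map_map (𝒟.D ((x j).2 n)) ψ,
            LinearIsometryEquiv.apply_symm_apply]
        simpa using (ih j h).sub h2
      · have h2 : WeakLim ω (fun n => (𝒟.D ((x j).2 n)).symm (𝒟.D ((x j).2 n) (x j).1)) (x j).1 := by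
          intro ψ
          simp
        simpa using (hweak j).sub h2
  -- Asymptotic Pythagoras: in the expansion of ‖w - Dφ‖² the cross term tends to -2‖φ‖² because φ
  -- is the weak limit of D⁻¹w.
  have hdec : ∀ J, Tendsto (fun n => ‖u n‖ ^ 2 - ∑ j ∈ Finset.range J, ‖(x j).1‖ ^ 2
      - ‖w J n‖ ^ 2) ω (𝓝 0) := by
    intro J
    induction J with
    | zero => simp [hwdef, resid]
    | succ J ih =>
      have h1 := hweak J (x J).1
      have h2 := (Complex.continuous_re.tendsto _).comp h1
      have h3 := ih.add ((h2.const_mul 2).sub_const (2 * ‖(x J).1‖ ^ 2))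
      have e : (inner ℂ (x J).1 (x J).1 : ℂ).re = ‖(x J).1‖ ^ 2 :=
        inner_self_eq_norm_sq (𝕜 := ℂ) (x J).1
      rw [e, sub_self, add_zero] at h3
      refine h3.congr fun n => ?_
      have e2 := norm_sub_sq (𝕜 := ℂ) (w J n) (𝒟.D ((x J).2 n) (x J).1)
      have e3 : (inner ℂ (x J).1 ((𝒟.D ((x J).2 n)).symm (w J n)) : ℂ).re
          = RCLike.re (inner ℂ (w J n) (𝒟.D ((x J).2 n) (x J).1) : ℂ) := by
        rw [← LinearIsometryEquiv.inner_map_map (𝒟.D ((x J).2 n)),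
          LinearIsometryEquiv.apply_symm_apply]
        exact inner_re_symm (𝕜 := ℂ) _ _
      rw [Finset.sum_range_succ, hwsucc, e2, LinearIsometryEquiv.norm_map, Function.comp_apply, e3]
      ring
  have hA0 : 0 ≤ A := (norm_nonneg _).trans (hA 0)
  have hsum : ∀ J, ∑ j ∈ Finset.range J, ‖(x j).1‖ ^ 2 ≤ A ^ 2 := by
    intro J
    refine le_of_sub_nonneg (le_of_tendsto' (hdec J) fun n => ?_)
    have h1 : ‖u n‖ ^ 2 ≤ A ^ 2 := pow_le_pow_left₀ (norm_nonneg _) (hA n) 2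
    have h2 := sq_nonneg ‖w J n‖
    linarith
  have hzero : Tendsto (fun J => ‖(x J).1‖) atTop (𝓝 0) := by
    have h1 := (summable_of_sum_range_le (fun n => sq_nonneg ‖(x n).1‖) hsum).tendsto_atTop_zero
    have h2 := (Real.continuous_sqrt.tendsto 0).comp h1
    rw [Real.sqrt_zero] at h2
    exact h2.congr fun n => Real.sqrt_sq (norm_nonneg _)
  -- Unlike `hbound`, this bound does not depend on J, so the threshold δ below can be fixed before
  -- J.
  have hsmall : ∀ J, ∀ᶠ n in (ω : Filter ℕ), ‖w J n‖ ≤ A + 1 := by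
    intro J
    filter_upwards [(hdec J).eventually (lt_mem_nhds (show (-1 : ℝ) < 0 by norm_num))] with n hn
    have h1 : ‖u n‖ ^ 2 ≤ A ^ 2 := pow_le_pow_left₀ (norm_nonneg _) (hA n) 2
    have h2 : 0 ≤ ∑ j ∈ Finset.range J, ‖(x j).1‖ ^ 2 := Finset.sum_nonneg fun _ _ => sq_nonneg _
    refine le_of_sq_le_sq ?_ (by positivity)
    nlinarith
  refine ⟨fun j => (x j).1, fun j => (x j).2, w, fun J n => ?_, fun ε hε => ?_, hnull, hdec, hsep,
    hbound⟩
  · simp only [hwdef, resid_range]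
    abel
  · obtain ⟨δ, hδ, hδZ⟩ := hZ (A + 1) ε hε
    have hev : ∀ᶠ J in atTop, ‖ψ₀‖ * (2 * ‖(x J).1‖) < δ := by
      have h1 := (hzero.const_mul 2).const_mul ‖ψ₀‖
      rw [mul_zero, mul_zero] at h1
      exact h1.eventually (gt_mem_nhds hδ)
    obtain ⟨J₀, hJ₀⟩ := eventually_atTop.1 hev
    refine ⟨J₀, fun J hJ => ?_⟩
    -- If Z exceeded ε along the ultrafilter, the correlating frames would produce a weak limit φ
    -- with |⟨ψ₀, φ⟩| ≥ δ. These frames are separated from the old ones, since otherwise φ would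
    -- vanish against ψ₀. Hence φ competed in the extraction at stage J, and ‖φ‖ ≤ 2‖φ_J‖
    -- contradicts the choice of J₀.
    by_contra hcon
    rw [← Ultrafilter.eventually_not] at hcon
    obtain ⟨C, hC⟩ := hbound J
    have hex : ∀ᶠ n in (ω : Filter ℕ), ∃ q, δ ≤ ‖inner ℂ (𝒟.D q ψ₀) (w J n)‖ := by
      filter_upwards [hcon, hsmall J] with n h1 h2
      exact hδZ _ h2 (not_le.1 h1)
    obtain ⟨q, hq⟩ : ∃ q : ℕ → P, ∀ᶠ n in (ω : Filter ℕ),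
        δ ≤ ‖inner ℂ (𝒟.D (q n) ψ₀) (w J n)‖ := by
      classical
      obtain ⟨q₀, -⟩ := 𝒟.exists_sep [] 0
      refine ⟨fun n => if h : ∃ q, δ ≤ ‖inner ℂ (𝒟.D q ψ₀) (w J n)‖ then h.choose else q₀, ?_⟩
      filter_upwards [hex] with n hn
      rw [dif_pos hn]
      exact hn.choose_spec
    have hCq : ∀ n, ‖(𝒟.D (q n)).symm (w J n)‖ ≤ C := fun n => by
      rw [LinearIsometryEquiv.norm_map]; exact hC n
    obtain ⟨φ, hφ⟩ := exists_weakLim ω hCq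
    have hge : δ ≤ ‖inner ℂ ψ₀ φ‖ := by
      refine ge_of_tendsto (hφ ψ₀).norm ?_
      filter_upwards [hq] with n hn
      rwa [← LinearIsometryEquiv.inner_map_map (𝒟.D (q n)),
        LinearIsometryEquiv.apply_symm_apply]
    have hadm : 𝒟.Admissible ω u ((List.range J).map x) φ q := by
      refine ⟨fun y hy => ?_, hφ⟩
      obtain ⟨j, hj, rfl⟩ := List.mem_map.1 hy
      by_contra hns
      have h0 := 𝒟.weakLim_of_not_separated ω hC hns (hnull J j (List.mem_range.1 hj)) ψ₀
      have h1 := tendsto_nhds_unique h0 (hφ ψ₀)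
      rw [← h1, inner_zero_right, norm_zero] at hge
      linarith
    have h2 := (hx J).2 φ q hadm
    have h3 := norm_inner_le_norm (𝕜 := ℂ) ψ₀ φ
    have h4 := hJ₀ J hJ
    have h5 := mul_le_mul_of_nonneg_left h2 (norm_nonneg ψ₀)
    linarith

/-- Profile decomposition of bounded sequences. -/
theorem exists_profile_decomposition [CompleteSpace H] [TopologicalSpace.SeparableSpace H]
    {u : ℕ → H} {A : ℝ} (hA : ∀ n, ‖u n‖ ≤ A) (Z : H → ℝ≥0∞) (ψ₀ : H)
    (hZ : ∀ A : ℝ, ∀ ε : ℝ≥0∞, 0 < ε → ∃ δ : ℝ, 0 < δ ∧ ∀ F, ‖F‖ ≤ A → ε < Z F →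
      ∃ p, δ ≤ ‖inner ℂ (𝒟.D p ψ₀) F‖) :
    ∃ σ : ℕ → ℕ, StrictMono σ ∧ ∃ (φ : ℕ → H) (p : ℕ → ℕ → P) (w : ℕ → ℕ → H),
      (∀ J n, u (σ n) = ∑ j ∈ Finset.range J, 𝒟.D (p j n) (φ j) + w J n) ∧
      Tendsto (fun J => limsup (fun n => Z (w J n)) atTop) atTop (𝓝 0) ∧
      (∀ J j, j < J → WeakLim atTop (fun n => (𝒟.D (p j n)).symm (w J n)) 0) ∧
      (∀ J, Tendsto (fun n => ‖u (σ n)‖ ^ 2 - ∑ j ∈ Finset.range J, ‖φ j‖ ^ 2 - ‖w J n‖ ^ 2)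
        atTop (𝓝 0)) ∧
      (∀ j k, j < k → Tendsto (fun n => 𝒟.sep (p k n) (p j n)) atTop atTop) := by
  set ω : Ultrafilter ℕ := hyperfilter ℕ
  have hω : (ω : Filter ℕ) ≤ atTop := by
    rw [← Nat.cofinite_eq_atTop]; exact hyperfilter_le_cofinite
  obtain ⟨φ, p, w, h1, h2, h3, h4, h5, h6⟩ := 𝒟.exists_profiles ω hω hA Z ψ₀ hZ
  choose C hC using h6
  let d := TopologicalSpace.denseSeq H
  have hd : DenseRange d := TopologicalSpace.denseRange_denseSeq H
  have hε : ∀ i : ℕ, (0 : ℝ≥0∞) < ((i : ℝ≥0∞) + 1)⁻¹ := fun i => by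
    simp [ENNReal.add_eq_top]
  choose J₀ hJ₀ using fun i : ℕ => h2 _ (hε i)
  -- The countably many requirements, in order: smallness of Z, weak nullity against a dense
  -- sequence, decoupling of norms, separation. Index pairs outside the relevant range get a vacuous
  -- condition.
  let l : (ℕ × ℕ) ⊕ (ℕ × ℕ × ℕ) ⊕ ℕ ⊕ (ℕ × ℕ) → Filter ℕ
    | .inl (i, J) => 𝓟 {n | J₀ i ≤ J → Z (w J n) ≤ ((i : ℝ≥0∞) + 1)⁻¹}
    | .inr (.inl (J, j, i)) =>
      if j < J then comap (fun n => inner ℂ (d i) ((𝒟.D (p j n)).symm (w J n))) (𝓝 0) else ⊤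
    | .inr (.inr (.inl J)) =>
      comap (fun n => ‖u n‖ ^ 2 - ∑ j ∈ Finset.range J, ‖φ j‖ ^ 2 - ‖w J n‖ ^ 2) (𝓝 0)
    | .inr (.inr (.inr (j, k))) =>
      if j < k then comap (fun n => 𝒟.sep (p k n) (p j n)) atTop else ⊤
  have hcg : ∀ i, (l i).IsCountablyGenerated := by
    rintro (⟨i, J⟩ | ⟨J, j, i⟩ | J | ⟨j, k⟩)
    · exact inferInstanceAs (IsCountablyGenerated (𝓟 _))
    · change IsCountablyGenerated (if j < J then _ else _)
      split_ifs <;> infer_instance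
    · exact inferInstanceAs (IsCountablyGenerated (comap _ _))
    · change IsCountablyGenerated (if j < k then _ else _)
      split_ifs <;> infer_instance
  have hle : ∀ i, (ω : Filter ℕ) ≤ l i := by
    rintro (⟨i, J⟩ | ⟨J, j, i⟩ | J | ⟨j, k⟩)
    · refine le_principal_iff.2 ?_
      by_cases hJ : J₀ i ≤ J
      · filter_upwards [hJ₀ i J hJ] with n hn _ using hn
      · exact univ_mem' fun n h => absurd h hJ
    · change (ω : Filter ℕ) ≤ if j < J then _ else _
      split_ifs with h
      · have := h3 J j h (d i)
        rw [inner_zero_right] at this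
        exact tendsto_iff_comap.1 this
      · exact le_top
    · exact tendsto_iff_comap.1 (h4 J)
    · change (ω : Filter ℕ) ≤ if j < k then _ else _
      split_ifs with h
      · exact tendsto_iff_comap.1 (h5 j k h)
      · exact le_top
  obtain ⟨σ, hσ, hlim⟩ := exists_strictMono_tendsto ω hω l hle
  refine ⟨σ, hσ, φ, fun j n => p j (σ n), fun J n => w J (σ n), fun J n => h1 J _, ?_, ?_, ?_, ?_⟩
  · rw [ENNReal.tendsto_nhds_zero]
    intro ε hε0
    obtain ⟨i, hi⟩ := ENNReal.exists_inv_nat_lt hε0.ne'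
    filter_upwards [eventually_ge_atTop (J₀ i)] with J hJ
    refine le_trans (limsup_le_of_le (by isBoundedDefault) ?_) hi.le
    have := tendsto_principal.1 (hlim (.inl (i, J)))
    filter_upwards [this] with n hn
    exact (hn hJ).trans (ENNReal.inv_le_inv.2 le_self_add)
  · intro J j hj
    refine weakLim_zero_of_dense (C := C J)
      (fun n => by rw [LinearIsometryEquiv.norm_map]; exact hC J _) hd fun i => ?_
    have := hlim (.inr (.inl (J, j, i)))
    simp only [l, if_pos hj] at this
    have h := tendsto_comap_iff.1 this
    exact h
  · intro J
    exact tendsto_comap_iff.1 (hlim (.inr (.inr (.inl J))))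
  · intro j k hjk
    have := hlim (.inr (.inr (.inr (j, k))))
    simp only [l, if_pos hjk] at this
    exact tendsto_comap_iff.1 this

end Dislocations

/-! ### Fourier extension from a measure with bounded image density -/

section Extension

/-- The Cauchy–Schwarz inequality for lower integrals. -/
theorem lintegral_mul_sq_le {Ω : Type*} [MeasurableSpace Ω] (μ : Measure Ω) {f g : Ω → ℝ≥0∞}
    (hf : AEMeasurable f μ) (hg : AEMeasurable g μ) :
    (∫⁻ ω, f ω * g ω ∂μ) ^ 2 ≤ (∫⁻ ω, f ω ^ 2 ∂μ) * ∫⁻ ω, g ω ^ 2 ∂μ := by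
  have h := ENNReal.lintegral_mul_le_Lp_mul_Lq μ (p := 2) (q := 2)
    (Real.HolderConjugate.two_two) hf hg
  simp only [Pi.mul_apply, ENNReal.rpow_ofNat] at h
  calc (∫⁻ ω, f ω * g ω ∂μ) ^ 2
      ≤ ((∫⁻ ω, f ω ^ 2 ∂μ) ^ (1 / 2 : ℝ) * (∫⁻ ω, g ω ^ 2 ∂μ) ^ (1 / 2 : ℝ)) ^ 2 := by gcongr
    _ = (∫⁻ ω, f ω ^ 2 ∂μ) * ∫⁻ ω, g ω ^ 2 ∂μ := by
      rw [mul_pow, ← ENNReal.rpow_natCast, ← ENNReal.rpow_mul, ← ENNReal.rpow_natCast,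
        ← ENNReal.rpow_mul]
      norm_num

variable {E : Type*} [NormedAddCommGroup E] [InnerProductSpace ℝ E] [FiniteDimensional ℝ E]
  [MeasurableSpace E] [BorelSpace E]

/-- The Fourier transform on `L²` is given by the Fourier integral on `L¹ ∩ L²`. -/
theorem fourier_toLp_ae_eq {f : E → ℂ} (h1 : Integrable f) (h2 : MemLp f 2) :
    ((𝓕 (h2.toLp f) : Lp ℂ 2 (volume : Measure E)) : E → ℂ) =ᵐ[volume] 𝓕 f := by
  have hcont : Continuous (𝓕 f) := VectorFourier.fourierIntegral_continuous (L := innerₗ E)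
    Real.continuous_fourierChar continuous_inner h1
  refine ae_eq_of_integral_contDiff_smul_eq
    ((Lp.memLp _).locallyIntegrable (by norm_num)) hcont.locallyIntegrable ?_
  intro g g_smooth g_cpt
  have hg₁ : HasCompactSupport (Complex.ofRealCLM ∘ g) := g_cpt.comp_left rfl
  have hg₂ : ContDiff ℝ (⊤ : ℕ∞) (Complex.ofRealCLM ∘ g) := by fun_prop
  set G : 𝓢(E, ℂ) := hg₁.toSchwartzMap hg₂
  have h3 := congrArg (fun T : 𝓢'(E, ℂ) => T G)
    (Lp.fourier_toTemperedDistribution_eq (h2.toLp f))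
  simp only [TemperedDistribution.fourier_apply, Lp.toTemperedDistribution_apply] at h3
  have h4 : ∫ x, (𝓕 G) x • (h2.toLp f) x = ∫ x, (𝓕 (G : E → ℂ)) x • f x := by
    refine integral_congr_ae ?_
    filter_upwards [h2.coeFn_toLp] with x hx
    rw [hx, SchwartzMap.fourier_coe]
  have h5 : ∫ x, (𝓕 (G : E → ℂ)) x • f x = ∫ x, G x • (𝓕 f) x := by
    simpa using! VectorFourier.integral_fourierIntegral_smul_eq_flip (L := innerₗ E)
      Real.continuous_fourierChar continuous_inner G.integrable h1
  rw [h4, h5] at h3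
  exact h3.symm

theorem lintegral_fourier_sq {f : E → ℂ} (h1 : Integrable f) (h2 : MemLp f 2) :
    ∫⁻ x, ‖𝓕 f x‖ₑ ^ 2 = ∫⁻ x, ‖f x‖ₑ ^ 2 := by
  have h3 := Lp.norm_fourier_eq (h2.toLp f)
  have h4 : ‖𝓕 (h2.toLp f)‖ₑ = ‖h2.toLp f‖ₑ := by
    rw [← ofReal_norm, h3, ofReal_norm]
  rw [Lp.enorm_def, Lp.enorm_def, eLpNorm_congr_ae (fourier_toLp_ae_eq h1 h2),
    eLpNorm_congr_ae h2.coeFn_toLp] at h4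
  have e : ∀ g : E → ℂ, ∫⁻ x, ‖g x‖ₑ ^ 2 = eLpNorm g 2 volume ^ 2 := fun g => by
    have := eLpNorm_nnreal_pow_eq_lintegral (f := g) (μ := volume) (p := 2) (by norm_num)
    simpa using this.symm
  rw [e, e, h4]

/-- If the image of `μ` under `θ` has a density bounded by `M`, then the Fourier extension operator
`Ψ ↦ ∫ e^{-2πi⟨p, θ⟩} Ψ dμ` maps `L²(μ)` into `L²` with norm at most `M^{1/2}`. -/
theorem lintegral_extension_neg_sq_le {Ω : Type*} [MeasurableSpace Ω] {μ : Measure Ω} [SFinite μ]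
    {θ : Ω → E} (hθ : Measurable θ) {M : ℝ≥0∞}
    (hM : ∀ h : E → ℝ≥0∞, Measurable h → ∫⁻ ω, h (θ ω) ∂μ ≤ M * ∫⁻ x, h x)
    {Ψ : Ω → ℂ} (hΨ : Integrable Ψ μ) :
    ∫⁻ p, ‖∫ ω, Complex.exp (((-2 * Real.pi * inner ℝ p (θ ω) : ℝ) : ℂ) * Complex.I) * Ψ ω ∂μ‖ₑ ^ 2
      ≤ M * ∫⁻ ω, ‖Ψ ω‖ₑ ^ 2 ∂μ := by
  set v : E → ℂ := fun p =>
    ∫ ω, Complex.exp (((-2 * Real.pi * inner ℝ p (θ ω) : ℝ) : ℂ) * Complex.I) * Ψ ω ∂μ with hv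
  have hnorm : ∀ (p : E) ω, ‖Complex.exp (((-2 * Real.pi * inner ℝ p (θ ω) : ℝ) : ℂ) * Complex.I)
      * Ψ ω‖ = ‖Ψ ω‖ := fun p ω => by
    rw [norm_mul, Complex.norm_exp_ofReal_mul_I, one_mul]
  have hvc : Continuous v := by
    refine continuous_of_dominated (bound := fun ω => ‖Ψ ω‖) (fun p => ?_)
      (fun p => Eventually.of_forall fun ω => (hnorm p ω).le) hΨ.norm
      (Eventually.of_forall fun ω => by fun_prop)
    exact (Measurable.aestronglyMeasurable (by fun_prop)).mul hΨ.1
  set B := ∫ ω, ‖Ψ ω‖ ∂μ with hB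
  have hvb : ∀ p, ‖v p‖ ≤ B := fun p =>
    (norm_integral_le_integral_norm _).trans (le_of_eq (integral_congr_ae
      (Eventually.of_forall (hnorm p))))
  -- Duality argument on a ball: with χ the truncated conjugate of v, the pairing gives R ≤ ‖𝓕χ ∘
  -- θ‖‖Ψ‖, and the density bound with Plancherel gives R² ≤ R · M‖Ψ‖². The truncation makes R
  -- finite, so that it can be cancelled.
  have key : ∀ r : ℕ, ∫⁻ p in Metric.closedBall (0 : E) r, ‖v p‖ₑ ^ 2
      ≤ M * ∫⁻ ω, ‖Ψ ω‖ₑ ^ 2 ∂μ := by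
    intro r
    set s := Metric.closedBall (0 : E) r
    have hs : MeasurableSet s := Metric.isClosed_closedBall.measurableSet
    have hsv : volume s < ⊤ := measure_closedBall_lt_top
    set χ : E → ℂ := s.indicator fun p => (starRingEnd ℂ) (v p) with hχ
    have hcc : Continuous fun p => (starRingEnd ℂ) (v p) := Complex.continuous_conj.comp hvc
    have hmem : ∀ q : ℝ≥0∞, MemLp χ q := fun q => by
      rw [hχ, memLp_indicator_iff_restrict hs]
      have : IsFiniteMeasure (volume.restrict s) := ⟨by simpa using hsv⟩
      exact MemLp.of_bound hcc.aestronglyMeasurable B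
        (Eventually.of_forall fun p => by simpa using hvb p)
    have hχ1 : Integrable χ := memLp_one_iff_integrable.1 (hmem 1)
    have hR : ∫⁻ p, ‖χ p‖ₑ ^ 2 = ∫⁻ p in s, ‖v p‖ₑ ^ 2 := by
      rw [← lintegral_indicator hs]
      congr 1 with p
      by_cases hp : p ∈ s <;> simp [hχ, hp]
    set R := ∫⁻ p in s, ‖v p‖ₑ ^ 2 with hRdef
    have hRtop : R ≠ ⊤ := by
      have hl : R ≤ ∫⁻ p in s, ENNReal.ofReal B ^ 2 := by
        refine lintegral_mono fun p => ?_
        gcongr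
        rw [← ofReal_norm]
        exact ENNReal.ofReal_le_ofReal (hvb p)
      refine ne_top_of_le_ne_top ?_ hl
      rw [lintegral_const]
      exact ENNReal.mul_ne_top (by simp) (by simpa using hsv.ne)
    have hpair : ∫ p, χ p * v p = ∫ ω, (𝓕 χ) (θ ω) * Ψ ω ∂μ := by
      have hi : Integrable (Function.uncurry fun p ω => χ p *
          (Complex.exp (((-2 * Real.pi * inner ℝ p (θ ω) : ℝ) : ℂ) * Complex.I) * Ψ ω))
          (volume.prod μ) := by
        have h1 := hχ1.mul_prod hΨ
        have h2 : AEStronglyMeasurable (fun z : E × Ω =>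
            Complex.exp (((-2 * Real.pi * inner ℝ z.1 (θ z.2) : ℝ) : ℂ) * Complex.I))
            (volume.prod μ) := Measurable.aestronglyMeasurable (by fun_prop)
        refine (h1.bdd_mul (c := 1) h2 (Eventually.of_forall fun z => ?_)).congr
          (Eventually.of_forall fun z => ?_)
        · rw [Complex.norm_exp_ofReal_mul_I]
        · simp only [Function.uncurry]; ring
      calc ∫ p, χ p * v p = ∫ p, ∫ ω, χ p *
          (Complex.exp (((-2 * Real.pi * inner ℝ p (θ ω) : ℝ) : ℂ) * Complex.I) * Ψ ω) ∂μ := by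
            simp only [hv, integral_const_mul]
        _ = ∫ ω, (∫ p, χ p *
          (Complex.exp (((-2 * Real.pi * inner ℝ p (θ ω) : ℝ) : ℂ) * Complex.I) * Ψ ω)) ∂μ :=
            integral_integral_swap hi
        _ = _ := by
          congr 1 with ω
          rw [Real.fourier_eq', ← integral_mul_const]
          congr 1 with p
          simp only [smul_eq_mul]
          ring
    have hRe : R = ‖∫ p, χ p * v p‖ₑ := by
      have h1 : ∫ p, χ p * v p = ((∫ p in s, ‖v p‖ ^ 2 : ℝ) : ℂ) := by
        rw [← integral_indicator hs, ← integral_complex_ofReal]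
        congr 1 with p
        by_cases hp : p ∈ s
        · simp [hχ, hp, Complex.conj_mul']
        · simp [hχ, hp]
      rw [h1, ← ofReal_norm, Complex.norm_real, Real.norm_of_nonneg (by positivity),
        ofReal_integral_eq_lintegral_ofReal]
      · refine lintegral_congr fun p => ?_
        rw [ENNReal.ofReal_pow (norm_nonneg _), ofReal_norm]
      · exact (hvc.norm.pow 2).continuousOn.integrableOn_compact (isCompact_closedBall _ _)
      · exact Eventually.of_forall fun p => by positivity
    have hle : R ≤ ∫⁻ ω, ‖(𝓕 χ) (θ ω)‖ₑ * ‖Ψ ω‖ₑ ∂μ := by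
      rw [hRe, hpair]
      refine (enorm_integral_le_lintegral_enorm _).trans (le_of_eq ?_)
      simp only [enorm_mul]
    have hFc : Continuous (𝓕 χ) := VectorFourier.fourierIntegral_continuous (L := innerₗ E)
      Real.continuous_fourierChar continuous_inner hχ1
    have hfin : R * R ≤ R * (M * ∫⁻ ω, ‖Ψ ω‖ₑ ^ 2 ∂μ) := by
      calc R * R = R ^ 2 := (sq R).symm
        _ ≤ (∫⁻ ω, ‖(𝓕 χ) (θ ω)‖ₑ * ‖Ψ ω‖ₑ ∂μ) ^ 2 := by gcongr
        _ ≤ (∫⁻ ω, ‖(𝓕 χ) (θ ω)‖ₑ ^ 2 ∂μ) * ∫⁻ ω, ‖Ψ ω‖ₑ ^ 2 ∂μ :=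
          lintegral_mul_sq_le μ ((hFc.measurable.comp hθ).enorm.aemeasurable) hΨ.1.enorm
        _ ≤ (M * ∫⁻ x, ‖𝓕 χ x‖ₑ ^ 2) * ∫⁻ ω, ‖Ψ ω‖ₑ ^ 2 ∂μ := by
          gcongr
          exact hM (fun x => ‖𝓕 χ x‖ₑ ^ 2) (hFc.measurable.enorm.pow_const 2)
        _ = R * (M * ∫⁻ ω, ‖Ψ ω‖ₑ ^ 2 ∂μ) := by
          rw [lintegral_fourier_sq hχ1 (hmem 2), hR]; ring
    rcases eq_or_ne R 0 with h0 | h0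
    · rw [h0]; exact zero_le
    · exact (ENNReal.mul_le_mul_iff_right h0 hRtop).1 hfin
  have hmono : Monotone fun r : ℕ => Metric.closedBall (0 : E) r := fun a b hab =>
    Metric.closedBall_subset_closedBall (by exact_mod_cast hab)
  have hU : (⋃ r : ℕ, Metric.closedBall (0 : E) r) = Set.univ :=
    Metric.iUnion_closedBall_nat 0
  rw [← setLIntegral_univ, ← hU, setLIntegral_iUnion_of_directed _ (directed_of_isDirected_le hmono)]
  exact iSup_le key

theorem lintegral_extension_sq_le {Ω : Type*} [MeasurableSpace Ω] {μ : Measure Ω} [SFinite μ]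
    {θ : Ω → E} (hθ : Measurable θ) {M : ℝ≥0∞}
    (hM : ∀ h : E → ℝ≥0∞, Measurable h → ∫⁻ ω, h (θ ω) ∂μ ≤ M * ∫⁻ x, h x)
    {Ψ : Ω → ℂ} (hΨ : Integrable Ψ μ) :
    ∫⁻ p, ‖∫ ω, Complex.exp (((2 * Real.pi * inner ℝ p (θ ω) : ℝ) : ℂ) * Complex.I) * Ψ ω ∂μ‖ₑ ^ 2
      ≤ M * ∫⁻ ω, ‖Ψ ω‖ₑ ^ 2 ∂μ := by
  have h := lintegral_extension_neg_sq_le (θ := fun ω => -θ ω) hθ.neg (M := M) (fun h hh => by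
    refine (hM (fun x => h (-x)) (hh.comp measurable_neg)).trans (le_of_eq ?_)
    rw [lintegral_neg_eq_self]) hΨ
  simpa only [inner_neg_right, mul_neg, neg_mul, neg_neg] using h

end Extension

/-! ### Density of sums of two or three points of the surface -/

section Pushforward

theorem lintegral_plane {h : Plane → ℝ≥0∞} (hh : Measurable h) :
    ∫⁻ z, h z = ∫⁻ x, ∫⁻ y, h !₂[x, y] := by
  have e1 := (PiLp.volume_preserving_toLp (Fin 2)).lintegral_comp hh
  rw [← e1]
  have h2 : Measurable fun f : Fin 2 → ℝ => h (WithLp.toLp 2 f) :=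
    hh.comp (PiLp.volume_preserving_toLp (Fin 2)).measurable
  have e2 := ((volume_preserving_finTwoArrow ℝ).symm _).lintegral_comp h2
  rw [← e2]
  have h3 : Measurable fun p : ℝ × ℝ =>
      h (WithLp.toLp 2 ((MeasurableEquiv.finTwoArrow (α := ℝ)).symm p)) :=
    h2.comp (MeasurableEquiv.measurable _)
  rw [Measure.volume_eq_prod, lintegral_prod _ h3.aemeasurable]
  rfl

/-- Space-time as a Euclidean space. -/
abbrev SpaceTime : Type := WithLp 2 (ℝ × Plane)

theorem lintegral_spaceTime {h : SpaceTime → ℝ≥0∞} (hh : Measurable h) :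
    ∫⁻ p, h p = ∫⁻ q : ℝ × Plane, h (WithLp.toLp 2 q) :=
  ((WithLp.volume_preserving_toLp ℝ Plane).lintegral_comp hh).symm

theorem measurable_mk_plane : Measurable fun p : ℝ × ℝ => (!₂[p.1, p.2] : Plane) := by
  refine (PiLp.volume_preserving_toLp (Fin 2)).measurable.comp ?_
  exact (MeasurableEquiv.finTwoArrow (α := ℝ)).symm.measurable

theorem lintegral_comp_affine {f : ℝ → ℝ≥0∞} (hf : Measurable f) {k : ℝ} (hk : k ≠ 0) (c : ℝ) :
    ∫⁻ x, f (k * x + c) = ENNReal.ofReal |k⁻¹| * ∫⁻ x, f x := by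
  have h1 : ∫⁻ x, f (k * x + c) = ∫⁻ x, f (x + c) ∂(Measure.map (k * ·) volume) := by
    rw [lintegral_map (by fun_prop) (by fun_prop)]
  rw [h1, Real.map_volume_mul_left hk, lintegral_smul_measure, lintegral_add_right_eq_self]
  rfl

/-- The change of variables `(y₁, y₂) ↦ (y₁ + y₂ + β, -2π(x₁ y₁ + x₂ y₂) + γ)`. -/
theorem lintegral_pair {H : ℝ → ℝ → ℝ≥0∞} (hH : Measurable (Function.uncurry H)) {x₁ x₂ : ℝ}
    (hx : x₁ ≠ x₂) (β γ : ℝ) :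
    ∫⁻ y₁, ∫⁻ y₂, H (y₁ + y₂ + β) (-(2 * Real.pi * (x₁ * y₁ + x₂ * y₂)) + γ)
      = ENNReal.ofReal ((2 * Real.pi * |x₁ - x₂|)⁻¹) * ∫⁻ y, ∫⁻ τ, H y τ := by
  have e1 : ∀ y₁, ∫⁻ y₂, H (y₁ + y₂ + β) (-(2 * Real.pi * (x₁ * y₁ + x₂ * y₂)) + γ)
      = ∫⁻ b, H b (-(2 * Real.pi * (x₁ * y₁ + x₂ * (b - y₁ - β))) + γ) := by
    intro y₁
    rw [← lintegral_add_right_eq_self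
      (fun b => H b (-(2 * Real.pi * (x₁ * y₁ + x₂ * (b - y₁ - β))) + γ)) (y₁ + β)]
    refine lintegral_congr fun y₂ => ?_
    congr 1 <;> ring
  simp_rw [e1]
  have hm : Measurable fun p : ℝ × ℝ =>
      H p.2 (-(2 * Real.pi * (x₁ * p.1 + x₂ * (p.2 - p.1 - β))) + γ) :=
    hH.comp (f := fun p : ℝ × ℝ =>
      (p.2, -(2 * Real.pi * (x₁ * p.1 + x₂ * (p.2 - p.1 - β))) + γ)) (by fun_prop)
  have hm' : Measurable fun y => ∫⁻ τ, H y τ := hH.lintegral_prod_right'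
  rw [lintegral_lintegral_swap hm.aemeasurable, ← lintegral_const_mul _ hm']
  refine lintegral_congr fun b => ?_
  have hk : -(2 * Real.pi * (x₁ - x₂)) ≠ 0 := by
    have := sub_ne_zero.2 hx
    have := Real.pi_ne_zero
    simp [*]
  have hb : Measurable (H b) := hH.comp (f := fun y => (b, y)) (by fun_prop)
  have e2 := lintegral_comp_affine hb hk (-(2 * Real.pi * (x₂ * (b - β))) + γ)
  have e3 : |(-(2 * Real.pi * (x₁ - x₂)))⁻¹| = (2 * Real.pi * |x₁ - x₂|)⁻¹ := by
    rw [abs_inv, abs_neg, abs_mul, abs_of_pos Real.two_pi_pos]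
  rw [e3] at e2
  change _ = _ * ∫⁻ τ, H b τ
  rw [← e2]
  refine lintegral_congr fun y => ?_
  congr 1; ring

/-- Bilinear bound. -/
theorem lintegral_bilinear_le {H : ℝ → ℝ → ℝ → ℝ≥0∞}
    (hH : Measurable fun p : ℝ × ℝ × ℝ => H p.1 p.2.1 p.2.2)
    {A B : Set ℝ} (hA : MeasurableSet A) (hB : MeasurableSet B) {d : ℝ} (hd : 0 < d)
    (hAB : ∀ a ∈ A, ∀ b ∈ B, d ≤ |a - b|) :
    ∫⁻ x₁ in A, ∫⁻ x₂ in B, ∫⁻ y₁, ∫⁻ y₂,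
        H (x₁ + x₂) (y₁ + y₂) (-(2 * Real.pi * (x₁ * y₁ + x₂ * y₂)))
      ≤ ENNReal.ofReal ((2 * Real.pi * d)⁻¹) * volume B * ∫⁻ x, ∫⁻ y, ∫⁻ τ, H x y τ := by
  set G : ℝ → ℝ≥0∞ := fun x => ∫⁻ y, ∫⁻ τ, H x y τ with hG
  have hHx : ∀ x, Measurable (Function.uncurry (H x)) := fun x =>
    hH.comp (f := fun p : ℝ × ℝ => (x, p.1, p.2)) (by fun_prop)
  have hGm : Measurable G := by
    have h1 : Measurable fun p : ℝ × ℝ => ∫⁻ τ, H p.1 p.2 τ :=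
      Measurable.lintegral_prod_right' (f := fun q : (ℝ × ℝ) × ℝ => H q.1.1 q.1.2 q.2)
        (hH.comp (f := fun q : (ℝ × ℝ) × ℝ => (q.1.1, q.1.2, q.2)) (by fun_prop))
    exact h1.lintegral_prod_right'
  have h1 : ∀ x₁ ∈ A, ∀ x₂ ∈ B, ∫⁻ y₁, ∫⁻ y₂,
        H (x₁ + x₂) (y₁ + y₂) (-(2 * Real.pi * (x₁ * y₁ + x₂ * y₂)))
      ≤ ENNReal.ofReal ((2 * Real.pi * d)⁻¹) * G (x₁ + x₂) := by
    intro x₁ h₁ x₂ h₂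
    have hd' := hAB x₁ h₁ x₂ h₂
    have hne : x₁ ≠ x₂ := fun h => by
      rw [h, sub_self, abs_zero] at hd'
      linarith
    have := lintegral_pair (hHx (x₁ + x₂)) hne 0 0
    simp only [add_zero] at this
    rw [this]
    gcongr
  have hm : Measurable fun p : ℝ × ℝ => ENNReal.ofReal ((2 * Real.pi * d)⁻¹) * G (p.1 + p.2) := by
    fun_prop
  -- Once the y-variables are exchanged for (y, τ) with Jacobian 2π|x₁ - x₂| ≥ 2πd, only x₁ + x₂ is
  -- left. Translating x₁ over all of ℝ costs just the volume of B.
  calc _ ≤ ∫⁻ x₁ in A, ∫⁻ x₂ in B, ENNReal.ofReal ((2 * Real.pi * d)⁻¹) * G (x₁ + x₂) :=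
        setLIntegral_mono' hA fun x₁ h₁ => setLIntegral_mono' hB fun x₂ h₂ => h1 x₁ h₁ x₂ h₂
    _ ≤ ∫⁻ x₁, ∫⁻ x₂ in B, ENNReal.ofReal ((2 * Real.pi * d)⁻¹) * G (x₁ + x₂) :=
        setLIntegral_le_lintegral _ _
    _ = ∫⁻ x₂ in B, ∫⁻ x₁, ENNReal.ofReal ((2 * Real.pi * d)⁻¹) * G (x₁ + x₂) :=
        lintegral_lintegral_swap hm.aemeasurable
    _ = ∫⁻ x₂ in B, ENNReal.ofReal ((2 * Real.pi * d)⁻¹) * ∫⁻ x, G x := by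
        refine lintegral_congr fun x₂ => ?_
        rw [lintegral_const_mul _ (by fun_prop), lintegral_add_right_eq_self]
    _ = _ := by
        rw [lintegral_const, Measure.restrict_apply_univ]
        ring

theorem lintegral_abs_rpow (a : ℝ) (ha : 0 ≤ a) :
    ∫⁻ x in Set.Icc (-a) a, ENNReal.ofReal (|x| ^ (-(1 / 2) : ℝ))
      = ENNReal.ofReal (4 * a ^ (1 / 2 : ℝ)) := by
  have hInt : IntegrableOn (fun x : ℝ => x ^ (-(1 / 2) : ℝ)) (Set.Ioc 0 a) := by
    rw [← intervalIntegrable_iff_integrableOn_Ioc_of_le ha]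
    exact intervalIntegral.intervalIntegrable_rpow' (by norm_num)
  have hpos : ∫⁻ x in Set.Ioc 0 a, ENNReal.ofReal (|x| ^ (-(1 / 2) : ℝ))
      = ENNReal.ofReal (2 * a ^ (1 / 2 : ℝ)) := by
    have h1 : ∫ x in Set.Ioc 0 a, x ^ (-(1 / 2) : ℝ) = 2 * a ^ (1 / 2 : ℝ) := by
      rw [← intervalIntegral.integral_of_le ha, integral_rpow (Or.inl (by norm_num)),
        Real.zero_rpow (by norm_num)]
      norm_num
      ring
    rw [← h1, ofReal_integral_eq_lintegral_ofReal hInt]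
    · refine setLIntegral_congr_fun measurableSet_Ioc fun x hx => ?_
      simp only [abs_of_pos hx.1]
    · filter_upwards [ae_restrict_mem measurableSet_Ioc] with x hx
      exact Real.rpow_nonneg hx.1.le _
  have hneg : ∫⁻ x in Set.Ico (-a) 0, ENNReal.ofReal (|x| ^ (-(1 / 2) : ℝ))
      = ENNReal.ofReal (2 * a ^ (1 / 2 : ℝ)) := by
    rw [← hpos, ← lintegral_indicator measurableSet_Ico, ← lintegral_indicator measurableSet_Ioc,
      ← lintegral_neg_eq_self]
    refine lintegral_congr fun x => ?_
    simp only [Set.indicator, Set.mem_Ico, Set.mem_Ioc, abs_neg]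
    congr 1
    simp only [eq_iff_iff]
    constructor <;> rintro ⟨h1, h2⟩ <;> constructor <;> linarith
  have hsplit : (Set.Icc (-a) a : Set ℝ) =ᵐ[volume] (Set.Ico (-a) 0 ∪ Set.Ioc 0 a : Set ℝ) := by
    have h0 : ∀ᵐ x : ℝ, x ≠ 0 := by simp [ae_iff]
    filter_upwards [h0] with x hx
    refine propext ?_
    change (-a ≤ x ∧ x ≤ a) ↔ ((-a ≤ x ∧ x < 0) ∨ (0 < x ∧ x ≤ a))
    constructor
    · rintro ⟨h1, h2⟩
      rcases lt_or_gt_of_ne hx with h | h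
      · exact Or.inl ⟨h1, h⟩
      · exact Or.inr ⟨h, h2⟩
    · rintro (⟨h1, h2⟩ | ⟨h1, h2⟩) <;> constructor <;> linarith
  rw [setLIntegral_congr hsplit, lintegral_union measurableSet_Ioc, hpos, hneg,
    ← ENNReal.ofReal_add (by positivity) (by positivity)]
  · congr 1; ring
  · rw [Set.disjoint_left]
    rintro x ⟨_, h1⟩ ⟨h2, _⟩
    linarith

/-- Trilinear bound. -/
theorem lintegral_trilinear_le {H : ℝ → ℝ → ℝ → ℝ≥0∞}
    (hH : Measurable fun p : ℝ × ℝ × ℝ => H p.1 p.2.1 p.2.2)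
    {A B : Set ℝ} (hA : MeasurableSet A) {m : ℝ} (hm : 0 ≤ m)
    (hAm : ∀ a ∈ A, |a| ≤ m) :
    ∫⁻ x₁ in A, ∫⁻ x₂ in A, ∫⁻ x₃ in A, ∫⁻ y₁ in B, ∫⁻ y₂ in B, ∫⁻ y₃ in B,
        H (x₁ + x₂ + x₃) (y₁ + y₂ + y₃) (-(2 * Real.pi * (x₁ * y₁ + x₂ * y₂ + x₃ * y₃)))
      ≤ ENNReal.ofReal (32 * m) * volume B * ∫⁻ x, ∫⁻ y, ∫⁻ τ, H x y τ := by
  set G : ℝ → ℝ≥0∞ := fun x => ∫⁻ y, ∫⁻ τ, H x y τ with hG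
  have hHx : ∀ x, Measurable (Function.uncurry (H x)) := fun x =>
    hH.comp (f := fun p : ℝ × ℝ => (x, p.1, p.2)) (by fun_prop)
  have hGm : Measurable G := by
    have h1 : Measurable fun p : ℝ × ℝ => ∫⁻ τ, H p.1 p.2 τ :=
      Measurable.lintegral_prod_right' (f := fun q : (ℝ × ℝ) × ℝ => H q.1.1 q.1.2 q.2)
        (hH.comp (f := fun q : (ℝ × ℝ) × ℝ => (q.1.1, q.1.2, q.2)) (by fun_prop))
    exact h1.lintegral_prod_right'
  -- The Jacobian can be taken in (y₁, y₂) or in (y₁, y₃), giving the smaller of 1/|x₁ - x₂| and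
  -- 1/|x₁ - x₃|. Neither is integrable, but the minimum is at most their geometric mean, a product
  -- of two integrable kernels. Differences of points of A lie in [-2m, 2m].
  set r : ℝ → ℝ≥0∞ := (Set.Icc (-(2 * m)) (2 * m)).indicator
    fun x => ENNReal.ofReal (|x| ^ (-(1 / 2) : ℝ)) with hr
  have hrm : Measurable r := Measurable.indicator (by fun_prop) measurableSet_Icc
  have hrint : ∫⁻ x, r x = ENNReal.ofReal (4 * (2 * m) ^ (1 / 2 : ℝ)) := by
    rw [hr, lintegral_indicator measurableSet_Icc, lintegral_abs_rpow _ (by positivity)]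
  have hinner : ∀ x₁ x₂ x₃ : ℝ, x₁ ≠ x₂ → ∫⁻ y₁ in B, ∫⁻ y₂ in B, ∫⁻ y₃ in B,
      H (x₁ + x₂ + x₃) (y₁ + y₂ + y₃) (-(2 * Real.pi * (x₁ * y₁ + x₂ * y₂ + x₃ * y₃)))
      ≤ ENNReal.ofReal (|x₁ - x₂|⁻¹) * (volume B * G (x₁ + x₂ + x₃)) := by
    intro x₁ x₂ x₃ hne
    have hK : Measurable fun p : ℝ × ℝ × ℝ => H (x₁ + x₂ + x₃) (p.1 + p.2.1 + p.2.2)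
        (-(2 * Real.pi * (x₁ * p.1 + x₂ * p.2.1 + x₃ * p.2.2))) :=
      (hHx (x₁ + x₂ + x₃)).comp (f := fun p : ℝ × ℝ × ℝ => (p.1 + p.2.1 + p.2.2,
        -(2 * Real.pi * (x₁ * p.1 + x₂ * p.2.1 + x₃ * p.2.2)))) (by fun_prop)
    set K : ℝ → ℝ → ℝ → ℝ≥0∞ := fun y₁ y₂ y₃ => H (x₁ + x₂ + x₃) (y₁ + y₂ + y₃)
        (-(2 * Real.pi * (x₁ * y₁ + x₂ * y₂ + x₃ * y₃))) with hKdef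
    have hK2 : Measurable fun p : ℝ × ℝ => ∫⁻ y₂, K p.1 y₂ p.2 :=
      Measurable.lintegral_prod_right' (f := fun q : (ℝ × ℝ) × ℝ => K q.1.1 q.2 q.1.2)
        (hK.comp (f := fun q : (ℝ × ℝ) × ℝ => (q.1.1, q.2, q.1.2)) (by fun_prop))
    calc _ ≤ ∫⁻ y₁, ∫⁻ y₂, ∫⁻ y₃ in B, K y₁ y₂ y₃ :=
          (setLIntegral_le_lintegral _ _).trans
            (lintegral_mono fun y₁ => setLIntegral_le_lintegral _ _)
      _ = ∫⁻ y₁, ∫⁻ y₃ in B, ∫⁻ y₂, K y₁ y₂ y₃ := by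
          refine lintegral_congr fun y₁ => lintegral_lintegral_swap ?_
          exact (hK.comp (f := fun q : ℝ × ℝ => (y₁, q)) (by fun_prop)).aemeasurable
      _ = ∫⁻ y₃ in B, ∫⁻ y₁, ∫⁻ y₂, K y₁ y₂ y₃ := lintegral_lintegral_swap hK2.aemeasurable
      _ = ∫⁻ y₃ in B, ENNReal.ofReal ((2 * Real.pi * |x₁ - x₂|)⁻¹) * G (x₁ + x₂ + x₃) := by
          refine lintegral_congr fun y₃ => ?_
          rw [← lintegral_pair (hHx (x₁ + x₂ + x₃)) hne y₃ (-(2 * Real.pi * (x₃ * y₃)))]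
          refine lintegral_congr fun y₁ => lintegral_congr fun y₂ => ?_
          simp only [hKdef]
          congr 1; ring
      _ ≤ ∫⁻ y₃ in B, ENNReal.ofReal (|x₁ - x₂|⁻¹) * G (x₁ + x₂ + x₃) := by
          gcongr
          have h0 : 0 < |x₁ - x₂| := abs_pos.2 (sub_ne_zero.2 hne)
          have h1 : 1 ≤ 2 * Real.pi := by linarith [Real.pi_gt_three]
          nlinarith
      _ = _ := by
          rw [lintegral_const, Measure.restrict_apply_univ]
          ring
  have hinner' : ∀ x₁ x₂ x₃ : ℝ, x₁ ≠ x₃ → ∫⁻ y₁ in B, ∫⁻ y₂ in B, ∫⁻ y₃ in B,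
      H (x₁ + x₂ + x₃) (y₁ + y₂ + y₃) (-(2 * Real.pi * (x₁ * y₁ + x₂ * y₂ + x₃ * y₃)))
      ≤ ENNReal.ofReal (|x₁ - x₃|⁻¹) * (volume B * G (x₁ + x₂ + x₃)) := by
    intro x₁ x₂ x₃ hne
    refine le_trans (le_of_eq ?_) ((hinner x₁ x₃ x₂ hne).trans (le_of_eq ?_))
    · refine lintegral_congr fun y₁ => ?_
      rw [lintegral_lintegral_swap]
      · refine lintegral_congr fun y₂ => lintegral_congr fun y₃ => ?_
        congr 1 <;> ring
      · exact Measurable.aemeasurable ((hHx (x₁ + x₂ + x₃)).comp (f := fun p : ℝ × ℝ =>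
          (y₁ + p.1 + p.2, -(2 * Real.pi * (x₁ * y₁ + x₂ * p.1 + x₃ * p.2)))) (by fun_prop))
    · rw [add_right_comm]
  have hpt : ∀ x₁ ∈ A, ∀ x₂ ∈ A, ∀ x₃ ∈ A, x₁ ≠ x₂ → x₁ ≠ x₃ →
      ∫⁻ y₁ in B, ∫⁻ y₂ in B, ∫⁻ y₃ in B,
      H (x₁ + x₂ + x₃) (y₁ + y₂ + y₃) (-(2 * Real.pi * (x₁ * y₁ + x₂ * y₂ + x₃ * y₃)))
      ≤ volume B * (r (x₁ - x₂) * (r (x₁ - x₃) * G (x₁ + x₂ + x₃))) := by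
    intro x₁ h₁ x₂ h₂ x₃ h₃ h12 h13
    have hmem : ∀ x ∈ A, x₁ - x ∈ Set.Icc (-(2 * m)) (2 * m) := fun x hx => by
      have e1 := abs_le.1 (hAm x₁ h₁)
      have e2 := abs_le.1 (hAm x hx)
      constructor <;> linarith [e1.1, e1.2, e2.1, e2.2]
    rw [hr, Set.indicator_of_mem (hmem x₂ h₂), Set.indicator_of_mem (hmem x₃ h₃)]
    have p0 : 0 < |x₁ - x₂| := abs_pos.2 (sub_ne_zero.2 h12)
    have q0 : 0 < |x₁ - x₃| := abs_pos.2 (sub_ne_zero.2 h13)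
    have hmin : min (|x₁ - x₂|⁻¹) (|x₁ - x₃|⁻¹)
        ≤ |x₁ - x₂| ^ (-(1 / 2) : ℝ) * |x₁ - x₃| ^ (-(1 / 2) : ℝ) := by
      rw [← Real.mul_rpow p0.le q0.le]
      have hsq : ∀ s t : ℝ, 0 < s → s ≤ t → t⁻¹ ≤ (s * t) ^ (-(1 / 2) : ℝ) := fun s t hs hst => by
        have ht : 0 < t := hs.trans_le hst
        have e : t⁻¹ = (t * t) ^ (-(1 / 2) : ℝ) := by
          rw [← sq, ← Real.rpow_natCast, ← Real.rpow_mul ht.le, ← Real.rpow_neg_one]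
          norm_num
        rw [e]
        exact Real.rpow_le_rpow_of_nonpos (by positivity) (by gcongr) (by norm_num)
      rcases le_total |x₁ - x₂| |x₁ - x₃| with h | h
      · exact (min_le_right _ _).trans (hsq _ _ p0 h)
      · exact (min_le_left _ _).trans (mul_comm |x₁ - x₂| _ ▸ hsq _ _ q0 h)
    calc _ ≤ ENNReal.ofReal (min (|x₁ - x₂|⁻¹) (|x₁ - x₃|⁻¹)) * (volume B * G (x₁ + x₂ + x₃)) := by
          rcases min_choice (|x₁ - x₂|⁻¹) (|x₁ - x₃|⁻¹) with h | h <;> rw [h]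
          · exact hinner x₁ x₂ x₃ h12
          · exact hinner' x₁ x₂ x₃ h13
      _ ≤ ENNReal.ofReal (|x₁ - x₂| ^ (-(1 / 2) : ℝ) * |x₁ - x₃| ^ (-(1 / 2) : ℝ))
          * (volume B * G (x₁ + x₂ + x₃)) := by gcongr
      _ = _ := by
          rw [ENNReal.ofReal_mul (by positivity)]
          ring
  have hne : ∀ x : ℝ, ∀ᵐ y : ℝ, x ≠ y := fun x => by
    have : ∀ᵐ y : ℝ, y ≠ x := by simp [ae_iff]
    filter_upwards [this] with y hy using hy.symm
  calc _ ≤ ∫⁻ x₁ in A, ∫⁻ x₂ in A, ∫⁻ x₃ in A,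
        volume B * (r (x₁ - x₂) * (r (x₁ - x₃) * G (x₁ + x₂ + x₃))) := by
        refine setLIntegral_mono' hA fun x₁ h₁ => ?_
        refine lintegral_mono_ae ?_
        filter_upwards [ae_restrict_mem hA, ae_restrict_of_ae (hne x₁)] with x₂ h₂ h12
        refine lintegral_mono_ae ?_
        filter_upwards [ae_restrict_mem hA, ae_restrict_of_ae (hne x₁)] with x₃ h₃ h13
        exact hpt x₁ h₁ x₂ h₂ x₃ h₃ h12 h13
    _ ≤ ∫⁻ x₁, ∫⁻ x₂, ∫⁻ x₃, volume B * (r (x₁ - x₂) * (r (x₁ - x₃) * G (x₁ + x₂ + x₃))) :=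
        (setLIntegral_le_lintegral _ _).trans (lintegral_mono fun x₁ =>
          (setLIntegral_le_lintegral _ _).trans (lintegral_mono fun x₂ =>
            setLIntegral_le_lintegral _ _))
    -- Substitution p = x₁ - x₂, q = x₁ - x₃. The later integration in x₁ gains a factor 1/3, which
    -- is then discarded.
    _ = ∫⁻ x₁, ∫⁻ p, ∫⁻ q, volume B * (r p * (r q * G (3 * x₁ + (-p - q)))) := by
        refine lintegral_congr fun x₁ => ?_
        rw [← lintegral_sub_left_eq_self _ x₁]
        refine lintegral_congr fun p => ?_
        rw [← lintegral_sub_left_eq_self _ x₁]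
        refine lintegral_congr fun q => ?_
        congr 4 <;> ring_nf
    _ = ∫⁻ p, ∫⁻ q, ∫⁻ x₁, volume B * (r p * (r q * G (3 * x₁ + (-p - q)))) := by
        rw [lintegral_lintegral_swap]
        · refine lintegral_congr fun p => lintegral_lintegral_swap ?_
          exact Measurable.aemeasurable (by fun_prop)
        · refine Measurable.aemeasurable ?_
          exact Measurable.lintegral_prod_right' (f := fun z : (ℝ × ℝ) × ℝ =>
            volume B * (r z.1.2 * (r z.2 * G (3 * z.1.1 + (-z.1.2 - z.2))))) (by fun_prop)
    _ = ∫⁻ p, ∫⁻ q, volume B * (r p * (r q * (ENNReal.ofReal |(3 : ℝ)⁻¹| * ∫⁻ x, G x))) := by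
        refine lintegral_congr fun p => lintegral_congr fun q => ?_
        rw [lintegral_const_mul _ (by fun_prop), lintegral_const_mul _ (by fun_prop),
          lintegral_const_mul _ (by fun_prop), lintegral_comp_affine hGm (by norm_num)]
    _ = volume B * ((∫⁻ p, r p) * ((∫⁻ q, r q) * (ENNReal.ofReal |(3 : ℝ)⁻¹| * ∫⁻ x, G x))) := by
        have h1 : ∀ p, ∫⁻ q, volume B * (r p * (r q * (ENNReal.ofReal |(3 : ℝ)⁻¹| * ∫⁻ x, G x)))
            = volume B * (r p * ((∫⁻ q, r q) * (ENNReal.ofReal |(3 : ℝ)⁻¹| * ∫⁻ x, G x))) :=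
          fun p => by
            rw [lintegral_const_mul _ (by fun_prop), lintegral_const_mul _ (by fun_prop),
              lintegral_mul_const _ hrm]
        simp_rw [h1]
        rw [lintegral_const_mul _ (by fun_prop), lintegral_mul_const _ hrm]
    _ ≤ volume B * ((∫⁻ p, r p) * ((∫⁻ q, r q) * (1 * ∫⁻ x, G x))) := by
        gcongr
        rw [← ENNReal.ofReal_one]
        exact ENNReal.ofReal_le_ofReal (by norm_num [abs_of_pos])
    _ = _ := by
        -- The two kernels contribute 4√(2m) each; this is the source of the constant 32m.
        have h2 : (4 * (2 * m) ^ (1 / 2 : ℝ)) * (4 * (2 * m) ^ (1 / 2 : ℝ)) = 32 * m := by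
          have : (2 * m) ^ (1 / 2 : ℝ) * (2 * m) ^ (1 / 2 : ℝ) = 2 * m := by
            rw [← Real.sqrt_eq_rpow, Real.mul_self_sqrt (by positivity)]
          linear_combination 16 * this
        rw [hrint, ← h2, ENNReal.ofReal_mul (p := 4 * (2 * m) ^ (1 / 2 : ℝ)) (by positivity)]
        ring

end Pushforward

/-! ### Waves and coordinates on space-time -/

section Waves

/-- The point of the characteristic surface above the frequency `ξ`. -/
noncomputable def lift (ξ : Plane) : SpaceTime := WithLp.toLp 2 (-(2 * Real.pi * (ξ 0 * ξ 1)), ξ)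

theorem measurable_lift : Measurable lift := by
  refine (WithLp.volume_preserving_toLp ℝ Plane).measurable.comp ?_
  fun_prop

/-- The solution with frequency profile `f`, as a function on space-time. -/
noncomputable def wave (f : Plane → ℂ) (q : ℝ × Plane) : ℂ :=
  ∫ ξ, Complex.exp (((2 * Real.pi * inner ℝ (WithLp.toLp 2 q : SpaceTime) (lift ξ) : ℝ) : ℂ)
    * Complex.I) * f ξ

/-- The point of the plane with `i`-th coordinate `a` and other coordinate `b`. -/
def coordMk (i : Fin 2) (a b : ℝ) : Plane := if i = 0 then !₂[a, b] else !₂[b, a]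

theorem coordMk_self (i : Fin 2) (a b : ℝ) : coordMk i a b i = a := by
  fin_cases i <;> simp [coordMk]

theorem coordMk_other (i : Fin 2) (a b : ℝ) : coordMk i a b (1 - i) = b := by
  fin_cases i <;> simp [coordMk]

theorem coordMk_mul (i : Fin 2) (a b : ℝ) : coordMk i a b 0 * coordMk i a b 1 = a * b := by
  fin_cases i <;> simp [coordMk, mul_comm]

theorem coordMk_add (i : Fin 2) (a b a' b' : ℝ) :
    coordMk i a b + coordMk i a' b' = coordMk i (a + a') (b + b') := by
  ext j
  fin_cases i <;> fin_cases j <;> simp [coordMk]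

theorem measurable_coordMk (i : Fin 2) : Measurable fun p : ℝ × ℝ => coordMk i p.1 p.2 := by
  fin_cases i
  · exact measurable_mk_plane
  · exact measurable_mk_plane.comp measurable_swap

theorem lintegral_coordMk (i : Fin 2) {h : Plane → ℝ≥0∞} (hh : Measurable h) :
    ∫⁻ z, h z = ∫⁻ a, ∫⁻ b, h (coordMk i a b) := by
  fin_cases i
  · exact lintegral_plane hh
  · rw [lintegral_plane hh]
    exact lintegral_lintegral_swap (f := fun x y => h !₂[x, y])
      (hh.comp measurable_mk_plane).aemeasurable

theorem lintegral_spaceTime_coordMk (i : Fin 2) {h : SpaceTime → ℝ≥0∞} (hh : Measurable h) :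
    ∫⁻ p, h p = ∫⁻ a, ∫⁻ b, ∫⁻ t, h (WithLp.toLp 2 (t, coordMk i a b)) := by
  have h1 : Measurable fun q : ℝ × Plane => h (WithLp.toLp 2 q) :=
    hh.comp (WithLp.volume_preserving_toLp ℝ Plane).measurable
  rw [lintegral_spaceTime hh, Measure.volume_eq_prod, lintegral_prod_symm _ h1.aemeasurable,
    lintegral_coordMk i]
  exact h1.lintegral_prod_left'

theorem setLIntegral_rect (i : Fin 2) {A B : Set ℝ} (hA : MeasurableSet A) (hB : MeasurableSet B)
    {h : Plane → ℝ≥0∞} (hh : Measurable h) :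
    ∫⁻ z in {z : Plane | z i ∈ A ∧ z (1 - i) ∈ B}, h z
      = ∫⁻ a in A, ∫⁻ b in B, h (coordMk i a b) := by
  have hS : MeasurableSet {z : Plane | z i ∈ A ∧ z (1 - i) ∈ B} :=
    MeasurableSet.inter (hA.preimage (f := fun z : Plane => z i) (by fun_prop))
      (hB.preimage (f := fun z : Plane => z (1 - i)) (by fun_prop))
  rw [← lintegral_indicator hS, lintegral_coordMk i (hh.indicator hS), ← lintegral_indicator hA]
  refine lintegral_congr fun a => ?_
  by_cases ha : a ∈ A
  · rw [Set.indicator_of_mem ha, ← lintegral_indicator hB]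
    refine lintegral_congr fun b => ?_
    by_cases hb : b ∈ B
    · rw [Set.indicator_of_mem hb, Set.indicator_of_mem]
      exact ⟨by rwa [coordMk_self], by rwa [coordMk_other]⟩
    · rw [Set.indicator_of_notMem hb, Set.indicator_of_notMem]
      rintro ⟨-, h2⟩
      exact hb (by rwa [coordMk_other] at h2)
  · rw [Set.indicator_of_notMem ha, ← lintegral_zero (μ := (volume : Measure ℝ))]
    refine lintegral_congr fun b => Set.indicator_of_notMem ?_ _
    rintro ⟨h1, -⟩
    exact ha (by rwa [coordMk_self] at h1)

theorem lift_coordMk_add (i : Fin 2) (a b a' b' : ℝ) :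
    lift (coordMk i a b) + lift (coordMk i a' b')
      = WithLp.toLp 2 (-(2 * Real.pi * (a * b + a' * b')), coordMk i (a + a') (b + b')) := by
  rw [lift, lift, ← WithLp.toLp_add, Prod.mk_add_mk, coordMk_mul, coordMk_mul, coordMk_add]
  congr 2
  ring

theorem measurable_coordMk_spaceTime (i : Fin 2) {h : SpaceTime → ℝ≥0∞} (hh : Measurable h) :
    Measurable fun p : ℝ × ℝ × ℝ => h (WithLp.toLp 2 (p.2.2, coordMk i p.1 p.2.1)) := by
  refine hh.comp ((WithLp.volume_preserving_toLp ℝ Plane).measurable.comp ?_)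
  refine Measurable.prodMk (by fun_prop) ?_
  exact (measurable_coordMk i).comp (f := fun p : ℝ × ℝ × ℝ => (p.1, p.2.1)) (by fun_prop)

/-- The density hypothesis of `lintegral_extension_sq_le` for products of two waves. The surface is
symmetric in its two frequencies, so separation in either coordinate i may be used; the other
coordinate is unrestricted. -/
theorem bilinear_pushforward (i : Fin 2) {A B : Set ℝ} (hA : MeasurableSet A)
    (hB : MeasurableSet B) {d : ℝ} (hd : 0 < d) (hAB : ∀ a ∈ A, ∀ b ∈ B, d ≤ |a - b|)
    {h : SpaceTime → ℝ≥0∞} (hh : Measurable h) :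
    ∫⁻ ω : Plane × Plane, h (lift ω.1 + lift ω.2)
      ∂((volume.restrict {z : Plane | z i ∈ A ∧ z (1 - i) ∈ Set.univ}).prod
        (volume.restrict {z : Plane | z i ∈ B ∧ z (1 - i) ∈ Set.univ}))
      ≤ ENNReal.ofReal ((2 * Real.pi * d)⁻¹) * volume B * ∫⁻ p, h p := by
  have hm : Measurable fun ω : Plane × Plane => h (lift ω.1 + lift ω.2) := by
    have := measurable_lift
    fun_prop
  have hc := measurable_coordMk i
  rw [lintegral_prod _ hm.aemeasurable, setLIntegral_rect i hA .univ hm.lintegral_prod_right',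
    lintegral_spaceTime_coordMk i hh]
  refine le_trans (le_of_eq ?_)
    (lintegral_bilinear_le (measurable_coordMk_spaceTime i hh) hA hB hd hAB)
  refine lintegral_congr fun a => ?_
  simp only [Measure.restrict_univ]
  have h1 : ∀ b, ∫⁻ z in {z : Plane | z i ∈ B ∧ z (1 - i) ∈ Set.univ},
      h (lift (coordMk i a b) + lift z) = ∫⁻ a' in B, ∫⁻ b', h (WithLp.toLp 2
        (-(2 * Real.pi * (a * b + a' * b')), coordMk i (a + a') (b + b'))) := fun b => by
    refine (setLIntegral_rect i hB .univ
      (hm.comp (f := fun z => (coordMk i a b, z)) (by fun_prop))).trans ?_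
    simp only [Function.comp_apply]
    simp only [Measure.restrict_univ, lift_coordMk_add]
  simp only [h1]
  rw [lintegral_lintegral_swap]
  refine Measurable.aemeasurable ?_
  refine Measurable.lintegral_prod_right' (f := fun q : (ℝ × ℝ) × ℝ => h (WithLp.toLp 2
        (-(2 * Real.pi * (a * q.1.1 + q.1.2 * q.2)), coordMk i (a + q.1.2) (q.1.1 + q.2)))) ?_
  exact (measurable_coordMk_spaceTime i hh).comp (f := fun q : (ℝ × ℝ) × ℝ =>
    (a + q.1.2, q.1.1 + q.2, -(2 * Real.pi * (a * q.1.1 + q.1.2 * q.2)))) (by fun_prop)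

/-- The density hypothesis for cubes of waves. No separation is needed: the Jacobian singularity is
integrated out in `lintegral_trilinear_le`. -/
theorem trilinear_pushforward {A B : Set ℝ} (hA : MeasurableSet A)
    (hB : MeasurableSet B) {m : ℝ} (hm : 0 ≤ m) (hAm : ∀ a ∈ A, |a| ≤ m)
    {h : SpaceTime → ℝ≥0∞} (hh : Measurable h) :
    ∫⁻ ω : Plane × Plane × Plane, h (lift ω.1 + (lift ω.2.1 + lift ω.2.2))
      ∂((volume.restrict {z : Plane | z 0 ∈ A ∧ z (1 - 0) ∈ B}).prod
        ((volume.restrict {z : Plane | z 0 ∈ A ∧ z (1 - 0) ∈ B}).prod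
          (volume.restrict {z : Plane | z 0 ∈ A ∧ z (1 - 0) ∈ B})))
      ≤ ENNReal.ofReal (32 * m) * volume B * ∫⁻ p, h p := by
  have hmeas : Measurable fun ω : Plane × Plane × Plane =>
      h (lift ω.1 + (lift ω.2.1 + lift ω.2.2)) := by
    have := measurable_lift
    fun_prop
  have hc := measurable_coordMk 0
  set k : ℝ → ℝ → ℝ → ℝ → ℝ → ℝ → ℝ≥0∞ := fun x₁ y₁ x₂ y₂ x₃ y₃ => h (WithLp.toLp 2
    (-(2 * Real.pi * (x₁ * y₁ + x₂ * y₂ + x₃ * y₃)), coordMk 0 (x₁ + x₂ + x₃) (y₁ + y₂ + y₃)))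
    with hk
  have hlift : ∀ x₁ y₁ x₂ y₂ x₃ y₃, h (lift (coordMk 0 x₁ y₁) + (lift (coordMk 0 x₂ y₂)
      + lift (coordMk 0 x₃ y₃))) = k x₁ y₁ x₂ y₂ x₃ y₃ := by
    intro x₁ y₁ x₂ y₂ x₃ y₃
    rw [lift_coordMk_add, lift, ← WithLp.toLp_add, Prod.mk_add_mk, coordMk_mul, coordMk_add]
    simp only [hk]
    congr 3 <;> ring_nf
  have hkm : ∀ {X : Type} [MeasurableSpace X] {f₁ g₁ f₂ g₂ f₃ g₃ : X → ℝ}, Measurable f₁ →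
      Measurable g₁ → Measurable f₂ → Measurable g₂ → Measurable f₃ → Measurable g₃ →
      Measurable fun x => k (f₁ x) (g₁ x) (f₂ x) (g₂ x) (f₃ x) (g₃ x) := by
    intro X _ f₁ g₁ f₂ g₂ f₃ g₃ h1 h2 h3 h4 h5 h6
    exact (measurable_coordMk_spaceTime 0 hh).comp (f := fun x =>
      (f₁ x + f₂ x + f₃ x, g₁ x + g₂ x + g₃ x,
        -(2 * Real.pi * (f₁ x * g₁ x + f₂ x * g₂ x + f₃ x * g₃ x)))) (by fun_prop)
  rw [lintegral_prod _ hmeas.aemeasurable, setLIntegral_rect 0 hA hB hmeas.lintegral_prod_right',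
    lintegral_spaceTime_coordMk 0 hh]
  refine le_trans (le_of_eq ?_)
    (lintegral_trilinear_le (B := B) (measurable_coordMk_spaceTime 0 hh) hA hm hAm)
  refine lintegral_congr fun x₁ => ?_
  have h1 : ∀ y₁, ∫⁻ ω : Plane × Plane, h (lift (coordMk 0 x₁ y₁) + (lift ω.1 + lift ω.2))
      ∂((volume.restrict {z : Plane | z 0 ∈ A ∧ z (1 - 0) ∈ B}).prod
          (volume.restrict {z : Plane | z 0 ∈ A ∧ z (1 - 0) ∈ B}))
      = ∫⁻ x₂ in A, ∫⁻ x₃ in A, ∫⁻ y₂ in B, ∫⁻ y₃ in B, k x₁ y₁ x₂ y₂ x₃ y₃ := by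
    intro y₁
    have hm1 : Measurable fun ω : Plane × Plane =>
        h (lift (coordMk 0 x₁ y₁) + (lift ω.1 + lift ω.2)) :=
      hmeas.comp (f := fun ω => (coordMk 0 x₁ y₁, ω)) (by fun_prop)
    rw [lintegral_prod _ hm1.aemeasurable, setLIntegral_rect 0 hA hB hm1.lintegral_prod_right']
    refine lintegral_congr fun x₂ => ?_
    have h2 : ∀ y₂, ∫⁻ z in {z : Plane | z 0 ∈ A ∧ z (1 - 0) ∈ B},
        h (lift (coordMk 0 x₁ y₁) + (lift (coordMk 0 x₂ y₂) + lift z))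
        = ∫⁻ x₃ in A, ∫⁻ y₃ in B, k x₁ y₁ x₂ y₂ x₃ y₃ := fun y₂ => by
      refine (setLIntegral_rect 0 hA hB
        (hm1.comp (f := fun z => (coordMk 0 x₂ y₂, z)) (by fun_prop))).trans ?_
      simp only [Function.comp_apply, hlift]
    simp only [h2]
    rw [lintegral_lintegral_swap]
    exact (Measurable.lintegral_prod_right' (f := fun q : (ℝ × ℝ) × ℝ =>
      k x₁ y₁ x₂ q.1.1 q.1.2 q.2) (hkm (by fun_prop) (by fun_prop) (by fun_prop) (by fun_prop)
        (by fun_prop) (by fun_prop))).aemeasurable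
  simp only [h1]
  have hm4 : Measurable fun p : (ℝ × ℝ) × ℝ => ∫⁻ y₂ in B, ∫⁻ y₃ in B,
      k x₁ p.1.1 p.1.2 y₂ p.2 y₃ := by
    refine Measurable.lintegral_prod_right' (f := fun q : ((ℝ × ℝ) × ℝ) × ℝ =>
      ∫⁻ y₃ in B, k x₁ q.1.1.1 q.1.1.2 q.2 q.1.2 y₃) ?_
    exact Measurable.lintegral_prod_right' (f := fun q : (((ℝ × ℝ) × ℝ) × ℝ) × ℝ =>
      k x₁ q.1.1.1.1 q.1.1.1.2 q.1.2 q.1.1.2 q.2) (hkm (by fun_prop) (by fun_prop) (by fun_prop)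
        (by fun_prop) (by fun_prop) (by fun_prop))
  rw [lintegral_lintegral_swap hm4.lintegral_prod_right'.aemeasurable]
  refine lintegral_congr fun x₂ => ?_
  rw [lintegral_lintegral_swap]
  exact (hm4.comp (f := fun q : ℝ × ℝ => ((q.1, x₂), q.2)) (by fun_prop)).aemeasurable

end Waves

/-! ### Bilinear L² and linear L⁶ estimates for waves -/

section WaveEstimates

theorem norm_wave_integrand (p : SpaceTime) (f : Plane → ℂ) (ξ : Plane) :
    ‖Complex.exp (((2 * Real.pi * inner ℝ p (lift ξ) : ℝ) : ℂ) * Complex.I) * f ξ‖ = ‖f ξ‖ := by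
  rw [norm_mul, Complex.norm_exp_ofReal_mul_I, one_mul]

theorem enorm_wave_le (f : Plane → ℂ) (q : ℝ × Plane) : ‖wave f q‖ₑ ≤ ∫⁻ ξ, ‖f ξ‖ₑ := by
  refine (enorm_integral_le_lintegral_enorm _).trans (lintegral_mono fun ξ => ?_)
  rw [← ofReal_norm, ← ofReal_norm, norm_wave_integrand]

theorem integrable_wave_integrand {μ : Measure Plane} {f : Plane → ℂ} (hf : Integrable f μ)
    (p : SpaceTime) : Integrable (fun ξ =>
      Complex.exp (((2 * Real.pi * inner ℝ p (lift ξ) : ℝ) : ℂ) * Complex.I) * f ξ) μ := by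
  have hl := measurable_lift
  refine hf.bdd_mul (c := 1) (Measurable.aestronglyMeasurable (by fun_prop))
    (Eventually.of_forall fun ξ => ?_)
  rw [Complex.norm_exp_ofReal_mul_I]

theorem continuous_wave {f : Plane → ℂ} (hf : Integrable f) : Continuous (wave f) := by
  have hc : Continuous fun q : ℝ × Plane => (WithLp.toLp 2 q : SpaceTime) :=
    WithLp.prod_continuous_toLp 2 ℝ Plane
  refine continuous_of_dominated (bound := fun ξ => ‖f ξ‖)
    (fun q => (integrable_wave_integrand hf _).1)
    (fun q => Eventually.of_forall fun ξ => (norm_wave_integrand _ f ξ).le) hf.norm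
    (Eventually.of_forall fun ξ => by fun_prop)

/-- The product of two waves is the extension of f ⊗ g along ω ↦ `lift ω.1 + lift ω.2`, because
exponentials multiply. -/
theorem lintegral_wave_mul_sq_le (i : Fin 2) {A B : Set ℝ} (hA : MeasurableSet A)
    (hB : MeasurableSet B) {d : ℝ} (hd : 0 < d) (hAB : ∀ a ∈ A, ∀ b ∈ B, d ≤ |a - b|)
    {f g : Plane → ℂ} (hf : Integrable f) (hg : Integrable g)
    (hfA : ∀ z, z i ∉ A → f z = 0) (hgB : ∀ z, z i ∉ B → g z = 0) :
    ∫⁻ q, (‖wave f q‖ₑ * ‖wave g q‖ₑ) ^ 2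
      ≤ ENNReal.ofReal ((2 * Real.pi * d)⁻¹) * volume B
        * ((∫⁻ ξ, ‖f ξ‖ₑ ^ 2) * ∫⁻ ξ, ‖g ξ‖ₑ ^ 2) := by
  set S₁ := {z : Plane | z i ∈ A ∧ z (1 - i) ∈ Set.univ}
  set S₂ := {z : Plane | z i ∈ B ∧ z (1 - i) ∈ Set.univ}
  have hl := measurable_lift
  have hΨ : Integrable (fun ω : Plane × Plane => f ω.1 * g ω.2)
      ((volume.restrict S₁).prod (volume.restrict S₂)) := hf.restrict.mul_prod hg.restrict
  have hM : ∀ h : SpaceTime → ℝ≥0∞, Measurable h → ∫⁻ ω : Plane × Plane, h (lift ω.1 + lift ω.2)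
      ∂((volume.restrict S₁).prod (volume.restrict S₂))
      ≤ ENNReal.ofReal ((2 * Real.pi * d)⁻¹) * volume B * ∫⁻ p, h p :=
    fun h hh => bilinear_pushforward i hA hB hd hAB hh
  have h := lintegral_extension_sq_le (θ := fun ω : Plane × Plane => lift ω.1 + lift ω.2)
    (by fun_prop) hM hΨ
  have e1 : ∀ p : SpaceTime, ∫ ω : Plane × Plane,
      Complex.exp (((2 * Real.pi * inner ℝ p (lift ω.1 + lift ω.2) : ℝ) : ℂ) * Complex.I)
        * (f ω.1 * g ω.2) ∂((volume.restrict S₁).prod (volume.restrict S₂))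
      = wave f (WithLp.ofLp p) * wave g (WithLp.ofLp p) := by
    intro p
    have e2 : wave f (WithLp.ofLp p) = ∫ ξ in S₁,
        Complex.exp (((2 * Real.pi * inner ℝ p (lift ξ) : ℝ) : ℂ) * Complex.I) * f ξ := by
      refine (setIntegral_eq_integral_of_forall_compl_eq_zero fun z hz => ?_).symm
      rw [hfA z fun hz' => hz ⟨hz', trivial⟩, mul_zero]
    have e3 : wave g (WithLp.ofLp p) = ∫ ξ in S₂,
        Complex.exp (((2 * Real.pi * inner ℝ p (lift ξ) : ℝ) : ℂ) * Complex.I) * g ξ := by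
      refine (setIntegral_eq_integral_of_forall_compl_eq_zero fun z hz => ?_).symm
      rw [hgB z fun hz' => hz ⟨hz', trivial⟩, mul_zero]
    rw [e2, e3, ← integral_prod_mul]
    congr 1 with ω
    rw [inner_add_right, mul_add, Complex.ofReal_add, add_mul, Complex.exp_add]
    ring
  simp only [e1] at h
  have hcont : Measurable fun p : SpaceTime =>
      ‖wave f (WithLp.ofLp p) * wave g (WithLp.ofLp p)‖ₑ ^ 2 := by
    have hc : Continuous fun p : SpaceTime => WithLp.ofLp p := WithLp.prod_continuous_ofLp 2 ℝ Plane
    exact ((((continuous_wave hf).comp hc).mul ((continuous_wave hg).comp hc)).measurable.enorm).pow_const 2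
  rw [lintegral_spaceTime hcont] at h
  simp only [enorm_mul] at h
  refine h.trans ?_
  gcongr
  simp only [mul_pow]
  rw [lintegral_prod_mul (hf.restrict.1.enorm.pow_const 2) (hg.restrict.1.enorm.pow_const 2)]
  exact mul_le_mul' (setLIntegral_le_lintegral _ _) (setLIntegral_le_lintegral _ _)

/-- The sixth power is the square of the cube, and the cube is the extension of f ⊗ f ⊗ f along the
sum of three lifts. -/
theorem lintegral_wave_pow_six_le {A B : Set ℝ} (hA : MeasurableSet A)
    (hB : MeasurableSet B) {m : ℝ} (hm : 0 ≤ m) (hAm : ∀ a ∈ A, |a| ≤ m)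
    {f : Plane → ℂ} (hf : Integrable f) (hfS : ∀ z, ¬ (z 0 ∈ A ∧ z 1 ∈ B) → f z = 0) :
    ∫⁻ q, ‖wave f q‖ₑ ^ 6
      ≤ ENNReal.ofReal (32 * m) * volume B * (∫⁻ ξ, ‖f ξ‖ₑ ^ 2) ^ 3 := by
  set S := {z : Plane | z 0 ∈ A ∧ z (1 - 0) ∈ B} with hS
  set μ := (volume : Measure Plane).restrict S
  have hl := measurable_lift
  have hfμ : Integrable f μ := hf.restrict
  have hΨ : Integrable (fun ω : Plane × Plane × Plane => f ω.1 * (f ω.2.1 * f ω.2.2))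
      (μ.prod (μ.prod μ)) := hfμ.mul_prod (hfμ.mul_prod hfμ)
  have hM : ∀ h : SpaceTime → ℝ≥0∞, Measurable h →
      ∫⁻ ω : Plane × Plane × Plane, h (lift ω.1 + (lift ω.2.1 + lift ω.2.2)) ∂(μ.prod (μ.prod μ))
      ≤ ENNReal.ofReal (32 * m) * volume B * ∫⁻ p, h p :=
    fun h hh => trilinear_pushforward hA hB hm hAm hh
  have h := lintegral_extension_sq_le
    (θ := fun ω : Plane × Plane × Plane => lift ω.1 + (lift ω.2.1 + lift ω.2.2))
    (by fun_prop) hM hΨ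
  have e1 : ∀ p : SpaceTime, ∫ ω : Plane × Plane × Plane,
      Complex.exp (((2 * Real.pi * inner ℝ p (lift ω.1 + (lift ω.2.1 + lift ω.2.2)) : ℝ) : ℂ)
        * Complex.I) * (f ω.1 * (f ω.2.1 * f ω.2.2)) ∂(μ.prod (μ.prod μ))
      = wave f (WithLp.ofLp p) ^ 3 := by
    intro p
    have e2 : wave f (WithLp.ofLp p) = ∫ ξ,
        Complex.exp (((2 * Real.pi * inner ℝ p (lift ξ) : ℝ) : ℂ) * Complex.I) * f ξ ∂μ := by
      refine (setIntegral_eq_integral_of_forall_compl_eq_zero fun z hz => ?_).symm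
      rw [hfS z hz, mul_zero]
    rw [pow_succ', sq, e2, ← integral_prod_mul, ← integral_prod_mul]
    congr 1 with ω
    rw [inner_add_right, inner_add_right, mul_add, mul_add, Complex.ofReal_add, Complex.ofReal_add,
      add_mul, add_mul, Complex.exp_add, Complex.exp_add]
    ring
  simp only [e1] at h
  have hcont : Measurable fun p : SpaceTime => ‖wave f (WithLp.ofLp p) ^ 3‖ₑ ^ 2 := by
    have hc : Continuous fun p : SpaceTime => WithLp.ofLp p := WithLp.prod_continuous_ofLp 2 ℝ Plane
    exact ((((continuous_wave hf).comp hc).pow 3).measurable.enorm).pow_const 2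
  rw [lintegral_spaceTime hcont] at h
  simp only [enorm_pow, ← pow_mul] at h
  refine h.trans ?_
  gcongr
  simp only [enorm_mul, mul_pow]
  have hfe : AEMeasurable (fun ξ => ‖f ξ‖ₑ ^ 2) μ := hfμ.1.enorm.pow_const 2
  have e4 : ∫⁻ ω : Plane × Plane × Plane, ‖f ω.1‖ₑ ^ 2 * (‖f ω.2.1‖ₑ ^ 2 * ‖f ω.2.2‖ₑ ^ 2)
      ∂(μ.prod (μ.prod μ)) = (∫⁻ ξ, ‖f ξ‖ₑ ^ 2 ∂μ) * ((∫⁻ ξ, ‖f ξ‖ₑ ^ 2 ∂μ)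
        * ∫⁻ ξ, ‖f ξ‖ₑ ^ 2 ∂μ) := by
    rw [lintegral_prod_mul (f := fun ξ => ‖f ξ‖ₑ ^ 2)
      (g := fun ω : Plane × Plane => ‖f ω.1‖ₑ ^ 2 * ‖f ω.2‖ₑ ^ 2) hfe
      (hfe.comp_fst.mul hfe.comp_snd), lintegral_prod_mul hfe hfe]
  rw [e4, ← sq, ← pow_succ']
  gcongr
  exact Measure.restrict_le_self

end WaveEstimates

/-! ### Summation of multilinear estimates -/

section Summation

/-- Minkowski's inequality in L²: expand the square and apply Cauchy–Schwarz to each pair. -/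
theorem lintegral_tsum_sq_le {X ι : Type*} [Countable ι] [MeasurableSpace X] {μ : Measure X}
    {f : ι → X → ℝ≥0∞} (hf : ∀ i, Measurable (f i)) {s : ι → ℝ≥0∞}
    (hs : ∀ i, ∫⁻ x, f i x ^ 2 ∂μ ≤ s i ^ 2) :
    ∫⁻ x, (∑' i, f i x) ^ 2 ∂μ ≤ (∑' i, s i) ^ 2 := by
  have h1 : ∀ x, (∑' i, f i x) ^ 2 = ∑' i, ∑' j, f i x * f j x := fun x => by
    rw [sq, ← ENNReal.tsum_mul_right]
    simp_rw [ENNReal.tsum_mul_left]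
  have h2 : (∑' i, s i) ^ 2 = ∑' i, ∑' j, s i * s j := by
    rw [sq, ← ENNReal.tsum_mul_right]
    simp_rw [ENNReal.tsum_mul_left]
  simp_rw [h1, h2]
  have hm : ∀ i j, Measurable fun x => f i x * f j x := fun i j => (hf i).mul (hf j)
  rw [lintegral_tsum fun i => (Measurable.tsum fun j => hm i j).aemeasurable]
  refine ENNReal.tsum_le_tsum fun i => ?_
  rw [lintegral_tsum fun j => (hm i j).aemeasurable]
  refine ENNReal.tsum_le_tsum fun j => ?_
  have h3 := lintegral_mul_sq_le μ (hf i).aemeasurable (hf j).aemeasurable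
  refine (ENNReal.pow_le_pow_left_iff two_ne_zero).1 (h3.trans ?_)
  rw [mul_pow]
  exact mul_le_mul' (hs i) (hs j)

/-- Summation of quadrilinear off-diagonal estimates. -/
theorem lintegral_tsum_pow_eight_le {X ι : Type*} [AddCommGroup ι] [Countable ι] [MeasurableSpace X]
    {μ : Measure X} {p : ι → X → ℝ≥0∞} (hp : ∀ i, Measurable (p i)) {ρ e : ι → ℝ≥0∞} {c : ℝ≥0∞}
    (h : ∀ i a b d, ∫⁻ x, (p i x * p (i + a) x * (p (i + b) x * p (i + d) x)) ^ 2 ∂μ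
      ≤ (c * (ρ a * ρ b * ρ d) * (e i + e (i + a) + (e (i + b) + e (i + d)))) ^ 2) :
    ∫⁻ x, (∑' i, p i x) ^ 8 ∂μ ≤ (4 * c * (∑' a, ρ a) ^ 3 * ∑' i, e i) ^ 2 := by
  have hshift : ∀ (g : ι → ℝ≥0∞) (i : ι), ∑' a, g (i + a) = ∑' a, g a := fun g i =>
    (Equiv.addLeft i).tsum_eq g
  have hshift' : ∀ (g : ι → ℝ≥0∞) (a : ι), ∑' i, g (i + a) = ∑' a, g a := fun g a =>
    (Equiv.addRight a).tsum_eq g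
  -- The fourfold sum is parametrised by one index and three differences, so the decay sums over the
  -- differences and e over the base index.
  have h1 : ∀ x, (∑' i, p i x) ^ 4 = ∑' k : ι × ι × ι × ι,
      p k.1 x * p (k.1 + k.2.1) x * (p (k.1 + k.2.2.1) x * p (k.1 + k.2.2.2) x) := by
    intro x
    simp only [ENNReal.tsum_prod', ENNReal.tsum_mul_left, ENNReal.tsum_mul_right,
      hshift (fun a => p a x)]
    ring
  have h2 := lintegral_tsum_sq_le (μ := μ) (f := fun (k : ι × ι × ι × ι) x =>
      p k.1 x * p (k.1 + k.2.1) x * (p (k.1 + k.2.2.1) x * p (k.1 + k.2.2.2) x))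
      (fun k => ((hp _).mul (hp _)).mul ((hp _).mul (hp _))) (fun k => h k.1 k.2.1 k.2.2.1 k.2.2.2)
  simp_rw [← h1, ← pow_mul] at h2
  refine h2.trans (le_of_eq ?_)
  congr 1
  have hW : ∑' i, ∑' a, ρ a * e (i + a) = (∑' a, ρ a) * ∑' i, e i := by
    rw [ENNReal.tsum_comm]
    simp only [ENNReal.tsum_mul_left, hshift' e, ENNReal.tsum_mul_right]
  have hexp : ∀ i a b d, c * (ρ a * ρ b * ρ d) * (e i + e (i + a) + (e (i + b) + e (i + d)))
      = c * (ρ a * (ρ b * (ρ d * e i))) + c * ((ρ a * e (i + a)) * (ρ b * ρ d))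
        + (c * (ρ a * ((ρ b * e (i + b)) * ρ d)) + c * (ρ a * (ρ b * (ρ d * e (i + d))))) :=
    fun i a b d => by ring
  simp only [ENNReal.tsum_prod', hexp, ENNReal.tsum_add, ENNReal.tsum_mul_left,
    ENNReal.tsum_mul_right, hW]
  ring

end Summation

/-! ### Dyadic boxes and off-diagonal decay -/

section Boxes

/-- The dyadic shell `2^k ≤ |x| < 2^{k+1}`. -/
def dyad (k : ℤ) : Set ℝ := {x | (2 : ℝ) ^ k ≤ |x| ∧ |x| < (2 : ℝ) ^ (k + 1)}

/-- The product of two dyadic shells. -/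
def box (K : ℤ × ℤ) : Set Plane := {z | z 0 ∈ dyad K.1 ∧ z 1 ∈ dyad K.2}

theorem measurableSet_dyad (k : ℤ) : MeasurableSet (dyad k) :=
  (measurableSet_le (f := fun _ : ℝ => (2 : ℝ) ^ k) (g := fun x : ℝ => |x|)
    measurable_const (by fun_prop)).inter
    (measurableSet_lt (f := fun x : ℝ => |x|) (by fun_prop) measurable_const)

theorem measurableSet_box (K : ℤ × ℤ) : MeasurableSet (box K) :=
  ((measurableSet_dyad K.1).preimage (f := fun z : Plane => z 0) (by fun_prop)).inter
    ((measurableSet_dyad K.2).preimage (f := fun z : Plane => z 1) (by fun_prop))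

theorem volume_dyad_le (k : ℤ) : volume (dyad k) ≤ ENNReal.ofReal (2 * (2 : ℝ) ^ k) := by
  have h2 : (2 : ℝ) ^ (k + 1) = 2 * 2 ^ k := by rw [zpow_add₀ two_ne_zero, zpow_one, mul_comm]
  have h0 : (0 : ℝ) < 2 ^ k := by positivity
  have hsub : dyad k ⊆ Set.Ico ((2 : ℝ) ^ k) (2 ^ (k + 1)) ∪ Set.Ioc (-(2 ^ (k + 1))) (-(2 ^ k)) := by
    rintro x ⟨h1, h2⟩
    rcases abs_cases x with ⟨h, _⟩ | ⟨h, _⟩ <;> rw [h] at h1 h2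
    · exact Or.inl ⟨h1, h2⟩
    · exact Or.inr ⟨by linarith, by linarith⟩
  refine (measure_mono hsub).trans ((measure_union_le _ _).trans (le_of_eq ?_))
  rw [Real.volume_Ico, Real.volume_Ioc, ← ENNReal.ofReal_add (by linarith) (by linarith)]
  congr 1
  linarith

/-- The size of the square of the symbol on `box K`. -/
noncomputable def boxScale (K : ℤ × ℤ) : ℝ :=
  ((2 : ℝ) ^ K.1) ^ (1 / 2 : ℝ) * ((2 : ℝ) ^ K.2) ^ (1 / 2 : ℝ)

theorem boxScale_pos (K : ℤ × ℤ) : 0 < boxScale K := by unfold boxScale; positivity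

theorem boxScale_sq (K : ℤ × ℤ) : boxScale K ^ 2 = 2 ^ K.1 * 2 ^ K.2 := by
  have h : ∀ k : ℤ, (((2 : ℝ) ^ k) ^ (1 / 2 : ℝ)) ^ 2 = 2 ^ k := fun k => by
    rw [← Real.sqrt_eq_rpow, Real.sq_sqrt (by positivity)]
  rw [boxScale, mul_pow, h, h]

theorem symbol_nonneg (ξ : Plane) : 0 ≤ symbol ξ := by unfold symbol; positivity

theorem measurable_symbol : Measurable symbol := by unfold symbol; fun_prop

theorem symbol_sq (ξ : Plane) : symbol ξ ^ 2
    = |2 * Real.pi * ξ 0| ^ (1 / 2 : ℝ) * |2 * Real.pi * ξ 1| ^ (1 / 2 : ℝ) := by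
  have h : ∀ x : ℝ, (|x| ^ (1 / 4 : ℝ)) ^ 2 = |x| ^ (1 / 2 : ℝ) := fun x => by
    rw [← Real.rpow_natCast, ← Real.rpow_mul (abs_nonneg x)]
    norm_num
  rw [symbol, mul_pow, h, h]

theorem boxScale_le_symbol_sq {K : ℤ × ℤ} {ξ : Plane} (hξ : ξ ∈ box K) :
    boxScale K ≤ symbol ξ ^ 2 := by
  rw [symbol_sq, boxScale]
  have h : ∀ (k : ℤ) (x : ℝ), x ∈ dyad k → (2 : ℝ) ^ k ≤ |2 * Real.pi * x| := fun k x hx => by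
    rw [abs_mul, abs_of_pos Real.two_pi_pos]
    have h1 : 1 ≤ 2 * Real.pi := by linarith [Real.pi_gt_three]
    have := hx.1
    nlinarith [abs_nonneg x]
  exact mul_le_mul (Real.rpow_le_rpow (by positivity) (h _ _ hξ.1) (by norm_num))
    (Real.rpow_le_rpow (by positivity) (h _ _ hξ.2) (by norm_num)) (by positivity) (by positivity)

theorem volume_box_le (K : ℤ × ℤ) : volume (box K) ≤ ENNReal.ofReal (4 * boxScale K ^ 2) := by
  have h := setLIntegral_rect 0 (measurableSet_dyad K.1) (measurableSet_dyad K.2)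
    (h := fun _ => 1) measurable_const
  simp only [lintegral_const, Measure.restrict_apply_univ, one_mul] at h
  change volume (box K) = _ at h
  rw [h]
  refine (mul_le_mul' (volume_dyad_le K.2) (volume_dyad_le K.1)).trans (le_of_eq ?_)
  rw [← ENNReal.ofReal_mul (by positivity), boxScale_sq]
  congr 1; ring

/-- The part of `F / symbol` with frequencies in `box K`. -/
noncomputable def piece (F : Plane → ℂ) (K : ℤ × ℤ) : Plane → ℂ :=
  (box K).indicator fun ξ => F ξ / (symbol ξ : ℂ)

/-- The mass of `F` in `box K`. -/
noncomputable def mass (F : Plane → ℂ) (K : ℤ × ℤ) : ℝ≥0∞ := ∫⁻ ξ in box K, ‖F ξ‖ₑ ^ 2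

theorem piece_eq_zero {F : Plane → ℂ} {K : ℤ × ℤ} {z : Plane} (hz : z ∉ box K) :
    piece F K z = 0 := Set.indicator_of_notMem hz _

theorem lintegral_piece_sq_le (F : Plane → ℂ) (K : ℤ × ℤ) :
    ∫⁻ ξ, ‖piece F K ξ‖ₑ ^ 2 ≤ ENNReal.ofReal (boxScale K)⁻¹ * mass F K := by
  have hs := boxScale_pos K
  rw [mass, ← lintegral_const_mul' _ _ ENNReal.ofReal_ne_top,
    ← lintegral_indicator (measurableSet_box K)]
  refine lintegral_mono fun ξ => ?_
  by_cases hξ : ξ ∈ box K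
  · rw [piece, Set.indicator_of_mem hξ, Set.indicator_of_mem hξ]
    have h1 := boxScale_le_symbol_sq hξ
    have h2 : ‖F ξ / (symbol ξ : ℂ)‖ ^ 2 ≤ (boxScale K)⁻¹ * ‖F ξ‖ ^ 2 := by
      rw [norm_div, div_pow, Complex.norm_real, Real.norm_of_nonneg (symbol_nonneg ξ),
        div_eq_inv_mul]
      gcongr
    rw [← ofReal_norm, ← ofReal_norm, ← ENNReal.ofReal_pow (norm_nonneg _),
      ← ENNReal.ofReal_pow (norm_nonneg _), ← ENNReal.ofReal_mul (by positivity)]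
    exact ENNReal.ofReal_le_ofReal h2
  · rw [piece_eq_zero hξ]
    simp

theorem aestronglyMeasurable_piece {F : Plane → ℂ} (hF : AEStronglyMeasurable F) (K : ℤ × ℤ) :
    AEStronglyMeasurable (piece F K) := by
  have hs := measurable_symbol
  refine AEStronglyMeasurable.indicator ?_ (measurableSet_box K)
  simp only [div_eq_mul_inv]
  exact hF.mul (Measurable.aestronglyMeasurable (by fun_prop))

theorem sq_lintegral_piece_le {F : Plane → ℂ} (hF : AEStronglyMeasurable F) (K : ℤ × ℤ) :
    (∫⁻ ξ, ‖piece F K ξ‖ₑ) ^ 2 ≤ ENNReal.ofReal (4 * boxScale K) * mass F K := by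
  have hs := boxScale_pos K
  have h1 := lintegral_mul_sq_le volume (f := (box K).indicator fun _ => (1 : ℝ≥0∞))
    (measurable_const.indicator (measurableSet_box K)).aemeasurable
    (aestronglyMeasurable_piece hF K).enorm
  have e1 : ∀ ξ, (box K).indicator (fun _ => (1 : ℝ≥0∞)) ξ * ‖piece F K ξ‖ₑ = ‖piece F K ξ‖ₑ := by
    intro ξ
    by_cases hξ : ξ ∈ box K
    · simp [hξ]
    · simp [piece_eq_zero hξ]
  have e2 : ∫⁻ ξ, (box K).indicator (fun _ => (1 : ℝ≥0∞)) ξ ^ 2 = volume (box K) := by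
    rw [← lintegral_indicator_one (measurableSet_box K)]
    refine lintegral_congr fun ξ => ?_
    by_cases hξ : ξ ∈ box K <;> simp [hξ]
  simp only [e1, e2] at h1
  refine h1.trans ((mul_le_mul' (volume_box_le K) (lintegral_piece_sq_le F K)).trans (le_of_eq ?_))
  rw [← mul_assoc, ← ENNReal.ofReal_mul (by positivity)]
  congr 2
  field_simp

theorem mass_ne_top {F : Plane → ℂ} (hF : MemLp F 2) (K : ℤ × ℤ) : mass F K ≠ ⊤ := by
  refine ne_top_of_le_ne_top ?_ (setLIntegral_le_lintegral _ _)
  have := eLpNorm_nnreal_pow_eq_lintegral (f := F) (μ := volume) (p := 2) (by norm_num)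
  simp only [ENNReal.coe_ofNat, NNReal.coe_ofNat, ENNReal.rpow_ofNat] at this
  rw [← this]
  exact ENNReal.pow_ne_top hF.2.ne

theorem integrable_piece {F : Plane → ℂ} (hF : MemLp F 2) (K : ℤ × ℤ) :
    Integrable (piece F K) := by
  refine ⟨aestronglyMeasurable_piece hF.1 K, ?_⟩
  have h := sq_lintegral_piece_le hF.1 K
  have h2 : (∫⁻ ξ, ‖piece F K ξ‖ₑ) ^ 2 < ⊤ :=
    h.trans_lt (ENNReal.mul_lt_top ENNReal.ofReal_lt_top (mass_ne_top hF K).lt_top)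
  exact (ENNReal.pow_lt_top_iff.1 h2).resolve_right two_ne_zero

/-- The contribution of the frequencies in `box K` to the modulus of the solution. -/
noncomputable def waveAbs (F : Plane → ℂ) (K : ℤ × ℤ) (q : ℝ × Plane) : ℝ≥0∞ :=
  ‖wave (piece F K) q‖ₑ

theorem measurable_waveAbs {F : Plane → ℂ} (hF : MemLp F 2) (K : ℤ × ℤ) :
    Measurable (waveAbs F K) := (continuous_wave (integrable_piece hF K)).measurable.enorm

theorem waveAbs_sq_le {F : Plane → ℂ} (hF : MemLp F 2) (K : ℤ × ℤ) (q : ℝ × Plane) :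
    waveAbs F K q ^ 2 ≤ ENNReal.ofReal (boxScale K) * (4 * mass F K) := by
  refine (pow_le_pow_left₀ zero_le (enorm_wave_le _ _) 2).trans
    ((sq_lintegral_piece_le hF.1 K).trans (le_of_eq ?_))
  rw [ENNReal.ofReal_mul (by norm_num), ENNReal.ofReal_ofNat]
  ring

/-- Scale count: the density bound is of order `boxScale K ^ 2`, while dividing by the symbol costs
`boxScale K` to the power -3 in the cubed L² mass. The constant is 32 · 2 · 2. -/
theorem lintegral_waveAbs_pow_six_le {F : Plane → ℂ} (hF : MemLp F 2) (K : ℤ × ℤ) :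
    ∫⁻ q, waveAbs F K q ^ 6 ≤ 128 * (ENNReal.ofReal (boxScale K)⁻¹ * mass F K ^ 3) := by
  have hs := boxScale_pos K
  have h2 : (2 : ℝ) ^ (K.1 + 1) = 2 * 2 ^ K.1 := by
    rw [zpow_add₀ two_ne_zero, zpow_one, mul_comm]
  have h := lintegral_wave_pow_six_le (measurableSet_dyad K.1) (measurableSet_dyad K.2)
    (m := 2 ^ (K.1 + 1)) (by positivity) (fun a ha => ha.2.le) (integrable_piece hF K)
    (fun z hz => piece_eq_zero hz)
  calc _ ≤ _ := h
    _ ≤ ENNReal.ofReal (32 * 2 ^ (K.1 + 1)) * ENNReal.ofReal (2 * 2 ^ K.2)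
        * (ENNReal.ofReal (boxScale K)⁻¹ * mass F K) ^ 3 := by
      gcongr
      · exact volume_dyad_le _
      · exact lintegral_piece_sq_le F K
    _ = _ := by
      have e : ENNReal.ofReal (32 * 2 ^ (K.1 + 1)) * ENNReal.ofReal (2 * 2 ^ K.2)
          * ENNReal.ofReal (boxScale K)⁻¹ ^ 3 = 128 * ENNReal.ofReal (boxScale K)⁻¹ := by
        have e' : (32 * (2 : ℝ) ^ (K.1 + 1) * (2 * 2 ^ K.2)) = 128 * boxScale K ^ 2 := by
          rw [h2, boxScale_sq]; ring
        rw [← ENNReal.ofReal_pow (by positivity), ← ENNReal.ofReal_mul (by positivity),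
          ← ENNReal.ofReal_mul (by positivity), e', ← ENNReal.ofReal_ofNat (n := 128),
          ← ENNReal.ofReal_mul (by norm_num)]
        congr 1
        field_simp
      rw [mul_pow, ← mul_assoc, e, mul_assoc]

/-- Two of the eight factors are estimated pointwise, the other six by the L⁶ bound. The powers of
`boxScale K` cancel, so the estimate is scale invariant. -/
theorem lintegral_waveAbs_pow_eight_le {F : Plane → ℂ} (hF : MemLp F 2) (K : ℤ × ℤ) {μ : ℝ≥0∞}
    (hμ : ∀ q, waveAbs F K q ^ 2 ≤ ENNReal.ofReal (boxScale K) * μ) :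
    ∫⁻ q, waveAbs F K q ^ 8 ≤ 128 * mass F K ^ 3 * μ := by
  have hs := boxScale_pos K
  calc ∫⁻ q, waveAbs F K q ^ 8
      ≤ ∫⁻ q, ENNReal.ofReal (boxScale K) * μ * waveAbs F K q ^ 6 := by
        refine lintegral_mono fun q => ?_
        rw [show 8 = 2 + 6 from rfl, pow_add]
        gcongr
        exact hμ q
    _ = ENNReal.ofReal (boxScale K) * μ * ∫⁻ q, waveAbs F K q ^ 6 :=
        lintegral_const_mul _ ((measurable_waveAbs hF K).pow_const 6)
    _ ≤ ENNReal.ofReal (boxScale K) * μ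
        * (128 * (ENNReal.ofReal (boxScale K)⁻¹ * mass F K ^ 3)) := by
        gcongr
        exact lintegral_waveAbs_pow_six_le hF K
    _ = ENNReal.ofReal (boxScale K) * ENNReal.ofReal (boxScale K)⁻¹ * (128 * mass F K ^ 3 * μ) := by
        ring
    _ = _ := by
        rw [← ENNReal.ofReal_mul hs.le, mul_inv_cancel₀ hs.ne', ENNReal.ofReal_one, one_mul]

/-- The off-diagonal decay factor. -/
noncomputable def decay (n : ℤ) : ℝ≥0∞ := ENNReal.ofReal ((2 : ℝ) ^ (-|n|))

theorem decay_neg (n : ℤ) : decay (-n) = decay n := by rw [decay, decay, abs_neg]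

/-- The gap between the shells is at least 2^(k-1), since 2^(k'+1) ≤ 2^(k-1), and the smaller shell
has measure at most 2 · 2^k'. The ratio of the two is the decay. -/
theorem lintegral_waveAbs_mul_sq_le_of_separated {F : Plane → ℂ} (hF : MemLp F 2) (i : Fin 2)
    {K K' : ℤ × ℤ} {k k' : ℤ} (hk : ∀ z ∈ box K, z i ∈ dyad k) (hk' : ∀ z ∈ box K', z i ∈ dyad k')
    (hkk : k' + 2 ≤ k) :
    ∫⁻ q, (waveAbs F K q * waveAbs F K' q) ^ 2
      ≤ decay (k - k') * ((ENNReal.ofReal (boxScale K)⁻¹ * mass F K)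
        * (ENNReal.ofReal (boxScale K')⁻¹ * mass F K')) := by
  have hz1 : (2 : ℝ) ^ k = 2 * 2 ^ (k - 1) := by
    rw [← zpow_one_add₀ two_ne_zero]; congr 1; ring
  have hz2 : (2 : ℝ) ^ (k' + 1) ≤ 2 ^ (k - 1) := zpow_le_zpow_right₀ (by norm_num) (by linarith)
  have h0 : (0 : ℝ) < 2 ^ (k - 1) := by positivity
  have h := lintegral_wave_mul_sq_le i (measurableSet_dyad k) (measurableSet_dyad k')
    (d := 2 ^ (k - 1)) h0 (fun a ha b hb => by
      have h1 := ha.1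
      have h2 := hb.2
      have h3 := abs_sub_abs_le_abs_sub a b
      linarith) (integrable_piece hF K) (integrable_piece hF K')
    (fun z hz => piece_eq_zero fun h' => hz (hk z h'))
    (fun z hz => piece_eq_zero fun h' => hz (hk' z h'))
  refine h.trans (mul_le_mul' ?_ (mul_le_mul' (lintegral_piece_sq_le F K)
    (lintegral_piece_sq_le F K')))
  refine (mul_le_mul' le_rfl (volume_dyad_le k')).trans ?_
  rw [← ENNReal.ofReal_mul (by positivity), decay]
  refine ENNReal.ofReal_le_ofReal ?_
  have e : (2 : ℝ) ^ (-|k - k'|) = 2 ^ k' * (2 * 2 ^ (k - 1))⁻¹ := by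
    rw [abs_of_nonneg (by linarith), ← hz1, ← zpow_neg, ← zpow_add₀ two_ne_zero]
    congr 1; ring
  rw [e]
  have hp : (0 : ℝ) < 2 ^ k' := by positivity
  have h1 : 2 * (2 * 2 ^ (k - 1)) ≤ 2 * Real.pi * 2 ^ (k - 1) := by
    nlinarith [Real.pi_gt_three]
  rw [← div_eq_mul_inv, ← div_eq_inv_mul, div_le_div_iff₀ (by positivity) (by positivity)]
  nlinarith

/-- Two powers of the product are bounded pointwise by `waveAbs_sq_le`, which removes the scales;
the other two carry the bilinear decay. -/
theorem lintegral_waveAbs_mul_pow_four_le_of_separated {F : Plane → ℂ} (hF : MemLp F 2) (i : Fin 2)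
    {K K' : ℤ × ℤ} {k k' : ℤ} (hk : ∀ z ∈ box K, z i ∈ dyad k) (hk' : ∀ z ∈ box K', z i ∈ dyad k')
    (hkk : k' + 2 ≤ k) :
    ∫⁻ q, (waveAbs F K q * waveAbs F K' q) ^ 4
      ≤ 16 * decay (k - k') * (mass F K ^ 2 * mass F K' ^ 2) := by
  have hs := boxScale_pos K
  have hs' := boxScale_pos K'
  set S := ENNReal.ofReal (boxScale K)
  set S' := ENNReal.ofReal (boxScale K')
  have hS : S * ENNReal.ofReal (boxScale K)⁻¹ = 1 := by
    rw [← ENNReal.ofReal_mul hs.le, mul_inv_cancel₀ hs.ne', ENNReal.ofReal_one]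
  have hS' : S' * ENNReal.ofReal (boxScale K')⁻¹ = 1 := by
    rw [← ENNReal.ofReal_mul hs'.le, mul_inv_cancel₀ hs'.ne', ENNReal.ofReal_one]
  have hm : Measurable fun q => (waveAbs F K q * waveAbs F K' q) ^ 2 :=
    ((measurable_waveAbs hF K).mul (measurable_waveAbs hF K')).pow_const 2
  calc ∫⁻ q, (waveAbs F K q * waveAbs F K' q) ^ 4
      ≤ ∫⁻ q, (S * (4 * mass F K)) * (S' * (4 * mass F K'))
          * (waveAbs F K q * waveAbs F K' q) ^ 2 := by
        refine lintegral_mono fun q => ?_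
        rw [show 4 = 2 + 2 from rfl, pow_add, mul_pow]
        gcongr
        · exact waveAbs_sq_le hF K q
        · exact waveAbs_sq_le hF K' q
    _ = (S * (4 * mass F K)) * (S' * (4 * mass F K'))
          * ∫⁻ q, (waveAbs F K q * waveAbs F K' q) ^ 2 := lintegral_const_mul _ hm
    _ ≤ (S * (4 * mass F K)) * (S' * (4 * mass F K')) * (decay (k - k')
        * ((ENNReal.ofReal (boxScale K)⁻¹ * mass F K)
          * (ENNReal.ofReal (boxScale K')⁻¹ * mass F K'))) := by
        gcongr
        exact lintegral_waveAbs_mul_sq_le_of_separated hF i hk hk' hkk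
    _ = (S * ENNReal.ofReal (boxScale K)⁻¹) * (S' * ENNReal.ofReal (boxScale K')⁻¹)
        * (16 * decay (k - k') * (mass F K ^ 2 * mass F K' ^ 2)) := by ring
    _ = _ := by rw [hS, hS', one_mul, one_mul]

theorem sq_lintegral_waveAbs_mul_pow_four_le {F : Plane → ℂ} (hF : MemLp F 2) (K K' : ℤ × ℤ) :
    (∫⁻ q, (waveAbs F K q * waveAbs F K' q) ^ 4) ^ 2
      ≤ (∫⁻ q, waveAbs F K q ^ 8) * ∫⁻ q, waveAbs F K' q ^ 8 := by
  have h := lintegral_mul_sq_le volume ((measurable_waveAbs hF K).pow_const 4).aemeasurable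
    ((measurable_waveAbs hF K').pow_const 4).aemeasurable
  simpa only [mul_pow, ← pow_mul] using h

/-- Bilinear estimate with decay in the distance of the boxes in one of the two directions. -/
theorem lintegral_waveAbs_mul_pow_four_le {F : Plane → ℂ} (hF : MemLp F 2) (i : Fin 2)
    {K K' : ℤ × ℤ} {k k' : ℤ} (hk : ∀ z ∈ box K, z i ∈ dyad k)
    (hk' : ∀ z ∈ box K', z i ∈ dyad k') :
    ∫⁻ q, (waveAbs F K q * waveAbs F K' q) ^ 4
      ≤ 1024 * decay (k - k') * (mass F K ^ 2 * mass F K' ^ 2) := by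
  rcases le_or_gt (k' + 2) k with h | h
  · refine (lintegral_waveAbs_mul_pow_four_le_of_separated hF i hk hk' h).trans ?_
    gcongr
    norm_num
  rcases le_or_gt (k + 2) k' with h' | h'
  · have := lintegral_waveAbs_mul_pow_four_le_of_separated hF i hk' hk h'
    simp only [mul_comm (waveAbs F K' _), mul_comm (mass F K' ^ 2)] at this
    rw [← decay_neg, neg_sub] at this
    refine this.trans ?_
    gcongr
    norm_num
  -- For equal or neighbouring shells there is no gain, and none is needed: Cauchy–Schwarz with the
  -- single-box L⁸ bound gives 512, and the decay is at least 1/2.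
  have hd : (1 / 2 : ℝ≥0∞) ≤ decay (k - k') := by
    have h1 : |k - k'| ≤ 1 := abs_le.2 ⟨by linarith, by linarith⟩
    have h2 : (2 : ℝ) ^ (-1 : ℤ) ≤ 2 ^ (-|k - k'|) :=
      zpow_le_zpow_right₀ (by norm_num) (by linarith)
    have h3 := ENNReal.ofReal_le_ofReal h2
    refine le_trans (le_of_eq ?_) h3
    rw [zpow_neg_one, ENNReal.ofReal_inv_of_pos (by norm_num), ENNReal.ofReal_ofNat, one_div]
  have h8 : ∀ K, ∫⁻ q, waveAbs F K q ^ 8 ≤ 512 * mass F K ^ 4 := fun K => by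
    refine (lintegral_waveAbs_pow_eight_le hF K (waveAbs_sq_le hF K)).trans (le_of_eq ?_)
    ring
  have h512 : ∫⁻ q, (waveAbs F K q * waveAbs F K' q) ^ 4 ≤ 512 * (mass F K ^ 2 * mass F K' ^ 2) := by
    refine (ENNReal.pow_le_pow_left_iff two_ne_zero).1
      ((sq_lintegral_waveAbs_mul_pow_four_le hF K K').trans
        ((mul_le_mul' (h8 K) (h8 K')).trans (le_of_eq ?_)))
    ring
  refine h512.trans (mul_le_mul_left ?_ _)
  calc (512 : ℝ≥0∞) = 512 * (2 * 2⁻¹) := by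
        rw [ENNReal.mul_inv_cancel (by norm_num) (by norm_num), mul_one]
    _ = 1024 * (1 / 2) := by
        rw [one_div, ← mul_assoc]
        norm_num
    _ ≤ 1024 * decay (k - k') := by gcongr

/-- The decay factor in the distance of two boxes. -/
noncomputable def boxDecay (d : ℤ × ℤ) : ℝ≥0∞ := (decay d.1 * decay d.2) ^ (1 / 24 : ℝ)

theorem tsum_boxDecay_ne_top : ∑' d, boxDecay d ≠ ⊤ := by
  have h1 : ∀ n : ℤ, decay n ^ (1 / 24 : ℝ) = ENNReal.ofReal (((2 : ℝ) ^ (-(1 / 24) : ℝ)) ^ n.natAbs) := by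
    intro n
    rw [decay, ENNReal.ofReal_rpow_of_nonneg (by positivity) (by norm_num)]
    congr 1
    rw [← Real.rpow_intCast, ← Real.rpow_mul (by norm_num), ← Real.rpow_natCast,
      ← Real.rpow_mul (by norm_num), Nat.cast_natAbs]
    congr 1
    push_cast
    ring
  have hq0 : (0 : ℝ) ≤ (2 : ℝ) ^ (-(1 / 24) : ℝ) := by positivity
  have hq1 : (2 : ℝ) ^ (-(1 / 24) : ℝ) < 1 :=
    Real.rpow_lt_one_of_one_lt_of_neg (by norm_num) (by norm_num)
  have hsum : Summable fun n : ℤ => ((2 : ℝ) ^ (-(1 / 24) : ℝ)) ^ n.natAbs := by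
    have hg := summable_geometric_of_lt_one hq0 hq1
    exact Summable.of_nat_of_neg (by simpa using hg) (by simpa using hg)
  have h2 : ∑' n : ℤ, decay n ^ (1 / 24 : ℝ) ≠ ⊤ := by
    simp_rw [h1]
    exact hsum.tsum_ofReal_ne_top
  have h3 : ∀ d : ℤ × ℤ, boxDecay d = decay d.1 ^ (1 / 24 : ℝ) * decay d.2 ^ (1 / 24 : ℝ) := fun d =>
    ENNReal.mul_rpow_of_nonneg _ _ (by norm_num)
  simp_rw [h3, ENNReal.tsum_prod', ENNReal.tsum_mul_left, ENNReal.tsum_mul_right]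
  exact ENNReal.mul_ne_top h2 h2

end Boxes

/-! ### The refined Strichartz estimate -/

section Refined

theorem eq_of_mem_dyad {k k' : ℤ} {x : ℝ} (h : x ∈ dyad k) (h' : x ∈ dyad k') : k = k' := by
  have h1 : k < k' + 1 := (zpow_lt_zpow_iff_right₀ (one_lt_two (α := ℝ))).1 (h.1.trans_lt h'.2)
  have h2 : k' < k + 1 := (zpow_lt_zpow_iff_right₀ (one_lt_two (α := ℝ))).1 (h'.1.trans_lt h.2)
  omega

theorem eq_of_mem_box {K K' : ℤ × ℤ} {z : Plane} (h : z ∈ box K) (h' : z ∈ box K') : K = K' :=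
  Prod.ext (eq_of_mem_dyad h.1 h'.1) (eq_of_mem_dyad h.2 h'.2)

theorem exists_mem_box {z : Plane} (h0 : z 0 ≠ 0) (h1 : z 1 ≠ 0) : ∃ K, z ∈ box K := by
  obtain ⟨k, hk⟩ := exists_mem_Ico_zpow (abs_pos.2 h0) (one_lt_two (α := ℝ))
  obtain ⟨l, hl⟩ := exists_mem_Ico_zpow (abs_pos.2 h1) (one_lt_two (α := ℝ))
  exact ⟨(k, l), hk, hl⟩

theorem tsum_mass_le (F : Plane → ℂ) : ∑' K, mass F K ≤ ∫⁻ ξ, ‖F ξ‖ₑ ^ 2 := by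
  have hd : Pairwise (Function.onFun Disjoint box) := by
    intro K K' hne
    rw [Function.onFun, Set.disjoint_left]
    intro z hz hz'
    exact hne (eq_of_mem_box hz hz')
  simp only [mass]
  rw [← lintegral_iUnion measurableSet_box hd]
  exact setLIntegral_le_lintegral _ _

/-- The geometric mean of six bounds, written without roots. -/
theorem le_prod_of_forall_le {Q c x₁ x₂ x₃ x₄ x₅ x₆ : ℝ≥0∞} (h₁ : Q ≤ c * x₁) (h₂ : Q ≤ c * x₂)
    (h₃ : Q ≤ c * x₃) (h₄ : Q ≤ c * x₄) (h₅ : Q ≤ c * x₅) (h₆ : Q ≤ c * x₆) :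
    Q ^ 6 ≤ c ^ 6 * ((x₁ * x₂) * (x₃ * x₄) * (x₅ * x₆)) := by
  calc Q ^ 6 = (Q * Q) * (Q * Q) * (Q * Q) := by ring
    _ ≤ ((c * x₁) * (c * x₂)) * ((c * x₃) * (c * x₄)) * ((c * x₅) * (c * x₆)) := by gcongr
    _ = _ := by ring

/-- Of the 42 powers of E, 18 are absorbed in the total mass T and 24 are kept. After the 24th root
this leaves E to the first power, which can be summed over boxes. -/
theorem le_sq_of_pow_le {Q c E T x y z : ℝ≥0∞} (hE : E ≤ T)
    (h : (Q ^ 2) ^ 6 ≤ (c * E ^ 7) ^ 6 * (x ^ 24 * y ^ 24 * z ^ 24)) :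
    Q ≤ (c ^ (1 / 4 : ℝ) * T ^ (3 / 4 : ℝ) * (x * y * z) * E) ^ 2 := by
  have hr : (c ^ (1 / 4 : ℝ)) ^ 24 = c ^ 6 := by
    rw [← ENNReal.rpow_natCast, ← ENNReal.rpow_mul, ← ENNReal.rpow_natCast]
    norm_num
  have hr3 : (T ^ (3 / 4 : ℝ)) ^ 24 = T ^ 18 := by
    rw [← ENNReal.rpow_natCast, ← ENNReal.rpow_mul, ← ENNReal.rpow_natCast]
    norm_num
  refine (ENNReal.pow_le_pow_left_iff (n := 12) (by norm_num)).1 ?_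
  calc Q ^ 12 = (Q ^ 2) ^ 6 := by ring
    _ ≤ _ := h
    _ = c ^ 6 * (E ^ 18 * E ^ 24) * (x ^ 24 * y ^ 24 * z ^ 24) := by ring
    _ ≤ c ^ 6 * (T ^ 18 * E ^ 24) * (x ^ 24 * y ^ 24 * z ^ 24) := by gcongr
    _ = (c ^ (1 / 4 : ℝ)) ^ 24 * ((T ^ (3 / 4 : ℝ)) ^ 24 * E ^ 24)
        * (x ^ 24 * y ^ 24 * z ^ 24) := by rw [hr, hr3]
    _ = _ := by ring

/-- Quadrilinear estimate. -/
theorem lintegral_waveAbs_quad_le {F : Plane → ℂ} (hF : MemLp F 2) {μ : ℝ≥0∞}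
    (hμ : ∀ K q, waveAbs F K q ^ 2 ≤ ENNReal.ofReal (boxScale K) * μ) (i a b d : ℤ × ℤ) :
    ∫⁻ q, (waveAbs F i q * waveAbs F (i + a) q * (waveAbs F (i + b) q * waveAbs F (i + d) q)) ^ 2
      ≤ ((131072 * μ) ^ (1 / 4 : ℝ) * (4 * ∑' K, mass F K) ^ (3 / 4 : ℝ)
        * (boxDecay a * boxDecay b * boxDecay d)
        * (mass F i + mass F (i + a) + (mass F (i + b) + mass F (i + d)))) ^ 2 := by
  set E := mass F i + mass F (i + a) + (mass F (i + b) + mass F (i + d)) with hE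
  set Q := ∫⁻ q, (waveAbs F i q * waveAbs F (i + a) q
    * (waveAbs F (i + b) q * waveAbs F (i + d) q)) ^ 2 with hQ
  have hi : mass F i ≤ E := le_self_add.trans le_self_add
  have ha : mass F (i + a) ≤ E := le_add_self.trans le_self_add
  have hb : mass F (i + b) ≤ E := le_self_add.trans le_add_self
  have hd : mass F (i + d) ≤ E := le_add_self.trans le_add_self
  have hbox0 : ∀ K : ℤ × ℤ, ∀ z ∈ box K, z 0 ∈ dyad K.1 := fun K z hz => hz.1
  have hbox1 : ∀ K : ℤ × ℤ, ∀ z ∈ box K, z 1 ∈ dyad K.2 := fun K z hz => hz.2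
  have N0 : ∀ K K' : ℤ × ℤ, mass F K ≤ E → mass F K' ≤ E →
      ∫⁻ q, (waveAbs F K q * waveAbs F K' q) ^ 4 ≤ 1024 * decay (K.1 - K'.1) * E ^ 4 := by
    intro K K' h h'
    refine (lintegral_waveAbs_mul_pow_four_le hF 0 (hbox0 K) (hbox0 K')).trans ?_
    rw [show E ^ 4 = E ^ 2 * E ^ 2 by ring]
    gcongr
  have N1 : ∀ K K' : ℤ × ℤ, mass F K ≤ E → mass F K' ≤ E →
      ∫⁻ q, (waveAbs F K q * waveAbs F K' q) ^ 4 ≤ 1024 * decay (K.2 - K'.2) * E ^ 4 := by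
    intro K K' h h'
    refine (lintegral_waveAbs_mul_pow_four_le hF 1 (hbox1 K) (hbox1 K')).trans ?_
    rw [show E ^ 4 = E ^ 2 * E ^ 2 by ring]
    gcongr
  have N2 : ∀ K K' : ℤ × ℤ, mass F K ≤ E → mass F K' ≤ E →
      ∫⁻ q, (waveAbs F K q * waveAbs F K' q) ^ 4 ≤ 128 * E ^ 3 * μ := by
    intro K K' h h'
    refine (ENNReal.pow_le_pow_left_iff two_ne_zero).1
      ((sq_lintegral_waveAbs_mul_pow_four_le hF K K').trans
        ((mul_le_mul' (lintegral_waveAbs_pow_eight_le hF K (hμ K))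
          (lintegral_waveAbs_pow_eight_le hF K' (hμ K'))).trans ?_))
    rw [sq]
    gcongr
  have CS : ∀ K₁ K₂ K₃ K₄ : ℤ × ℤ, (∀ q, waveAbs F i q * waveAbs F (i + a) q
      * (waveAbs F (i + b) q * waveAbs F (i + d) q)
      = waveAbs F K₁ q * waveAbs F K₂ q * (waveAbs F K₃ q * waveAbs F K₄ q)) →
      Q ^ 2 ≤ (∫⁻ q, (waveAbs F K₁ q * waveAbs F K₂ q) ^ 4)
        * ∫⁻ q, (waveAbs F K₃ q * waveAbs F K₄ q) ^ 4 := by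
    intro K₁ K₂ K₃ K₄ h
    have hm : ∀ K K', Measurable fun q => (waveAbs F K q * waveAbs F K' q) ^ 2 := fun K K' =>
      ((measurable_waveAbs hF K).mul (measurable_waveAbs hF K')).pow_const 2
    have := lintegral_mul_sq_le volume (hm K₁ K₂).aemeasurable (hm K₃ K₄).aemeasurable
    simp only [← mul_pow, ← h, ← pow_mul] at this
    exact this
  -- Cauchy–Schwarz splits the four waves into two pairs: the first provides the decay x, the second
  -- the smallness μ. The constant is 1024 · 128.
  have hfin : ∀ x : ℝ≥0∞, ∀ K₁ K₂ K₃ K₄ : ℤ × ℤ, (∀ q, waveAbs F i q * waveAbs F (i + a) q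
      * (waveAbs F (i + b) q * waveAbs F (i + d) q)
      = waveAbs F K₁ q * waveAbs F K₂ q * (waveAbs F K₃ q * waveAbs F K₄ q)) →
      mass F K₃ ≤ E → mass F K₄ ≤ E →
      ∫⁻ q, (waveAbs F K₁ q * waveAbs F K₂ q) ^ 4 ≤ 1024 * x * E ^ 4 →
      Q ^ 2 ≤ 131072 * μ * E ^ 7 * x := by
    intro x K₁ K₂ K₃ K₄ h h3 h4 hN
    refine (CS K₁ K₂ K₃ K₄ h).trans ((mul_le_mul' hN (N2 K₃ K₄ h3 h4)).trans (le_of_eq ?_))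
    ring
  have hsub : ∀ x y : ℤ, decay (x - (x + y)) = decay y := fun x y => by
    rw [← decay_neg]; congr 1; ring
  -- Box i is paired in turn with each of the other three, in each of the two directions. Averaging
  -- the six bounds gives decay in all the differences at once; each factor appears with exponent
  -- 1/24, as in `boxDecay`.
  have hprod := le_prod_of_forall_le
    (hfin (decay a.1) i (i + a) (i + b) (i + d) (fun q => rfl) hb hd
      (by simpa only [Prod.fst_add, hsub] using N0 i (i + a) hi ha))
    (hfin (decay a.2) i (i + a) (i + b) (i + d) (fun q => rfl) hb hd
      (by simpa only [Prod.snd_add, hsub] using N1 i (i + a) hi ha))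
    (hfin (decay b.1) i (i + b) (i + a) (i + d) (fun q => by ring) ha hd
      (by simpa only [Prod.fst_add, hsub] using N0 i (i + b) hi hb))
    (hfin (decay b.2) i (i + b) (i + a) (i + d) (fun q => by ring) ha hd
      (by simpa only [Prod.snd_add, hsub] using N1 i (i + b) hi hb))
    (hfin (decay d.1) i (i + d) (i + a) (i + b) (fun q => by ring) ha hb
      (by simpa only [Prod.fst_add, hsub] using N0 i (i + d) hi hd))
    (hfin (decay d.2) i (i + d) (i + a) (i + b) (fun q => by ring) ha hb
      (by simpa only [Prod.snd_add, hsub] using N1 i (i + d) hi hd))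
  have hE4 : E ≤ 4 * ∑' K, mass F K := by
    have h1 : ∀ K, mass F K ≤ ∑' K, mass F K := fun K => ENNReal.le_tsum K
    calc E ≤ (∑' K, mass F K) + (∑' K, mass F K) + ((∑' K, mass F K) + ∑' K, mass F K) := by
          rw [hE]
          gcongr <;> exact h1 _
      _ = _ := by ring
  have hrd : ∀ x : ℤ × ℤ, boxDecay x ^ 24 = decay x.1 * decay x.2 := fun x => by
    rw [boxDecay, ← ENNReal.rpow_natCast, ← ENNReal.rpow_mul]
    norm_num
  refine le_sq_of_pow_le hE4 ?_
  rw [hrd, hrd, hrd]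
  exact hprod

/-- Refined Strichartz estimate. -/
theorem exists_refined_strichartz : ∃ C : ℝ≥0∞, C ≠ ⊤ ∧ ∀ F : Plane → ℂ, MemLp F 2 → ∀ μ : ℝ≥0∞,
    (∀ K q, waveAbs F K q ^ 2 ≤ ENNReal.ofReal (boxScale K) * μ) →
    (∫⁻ q, (∑' K, waveAbs F K q) ^ 8) ^ 2 ≤ C * (μ * (∫⁻ ξ, ‖F ξ‖ₑ ^ 2) ^ 7) := by
  -- Fourth powers of the constants: 256 = 4⁴ from the summation lemma, 131072 · 64 from (131072
  -- μ)^(1/4) and (4 ∑ mass)^(3/4).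
  refine ⟨256 * 131072 * 64 * (∑' d, boxDecay d) ^ 12, ?_, fun F hF μ hμ => ?_⟩
  · exact ENNReal.mul_ne_top (by norm_num) (ENNReal.pow_ne_top tsum_boxDecay_ne_top)
  have h := lintegral_tsum_pow_eight_le (measurable_waveAbs hF) (lintegral_waveAbs_quad_le hF hμ)
  have hr : ∀ x : ℝ≥0∞, (x ^ (1 / 4 : ℝ)) ^ 4 = x := fun x => by
    rw [← ENNReal.rpow_natCast, ← ENNReal.rpow_mul]
    norm_num
  have hr3 : ∀ x : ℝ≥0∞, (x ^ (3 / 4 : ℝ)) ^ 4 = x ^ 3 := fun x => by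
    rw [← ENNReal.rpow_natCast, ← ENNReal.rpow_mul, ← ENNReal.rpow_natCast]
    norm_num
  calc _ ≤ _ := pow_le_pow_left₀ zero_le h 2
    _ = 256 * ((131072 * μ) ^ (1 / 4 : ℝ)) ^ 4 * ((4 * ∑' K, mass F K) ^ (3 / 4 : ℝ)) ^ 4
        * (∑' d, boxDecay d) ^ 12 * (∑' K, mass F K) ^ 4 := by ring
    _ = 256 * 131072 * 64 * (∑' d, boxDecay d) ^ 12 * (μ * (∑' K, mass F K) ^ 7) := by
        rw [hr, hr3]; ring
    _ ≤ _ := by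
        gcongr
        exact tsum_mass_le F

end Refined

/-! ### Anisotropic dilations of the plane -/

section Scaling

/-- The dilation `(x, y) ↦ (a x, b y)`. -/
def scale (a b : ℝ) (z : Plane) : Plane := !₂[a * z 0, b * z 1]

theorem continuous_scale (a b : ℝ) : Continuous (scale a b) := by
  refine (PiLp.continuous_toLp 2 fun _ : Fin 2 => ℝ).comp (continuous_pi fun i => ?_)
  fin_cases i
  · simp only [Fin.zero_eta, Matrix.cons_val_zero]; fun_prop
  · simp only [Fin.mk_one, Matrix.cons_val_one]; fun_prop

@[simp] theorem scale_zero (a b : ℝ) (z : Plane) : scale a b z 0 = a * z 0 := rfl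

@[simp] theorem scale_one (a b : ℝ) (z : Plane) : scale a b z 1 = b * z 1 := rfl

theorem plane_ext {z w : Plane} (h0 : z 0 = w 0) (h1 : z 1 = w 1) : z = w := by
  ext i
  fin_cases i
  · exact h0
  · exact h1

theorem scale_scale (a b a' b' : ℝ) (z : Plane) :
    scale a b (scale a' b' z) = scale (a * a') (b * b') z :=
  plane_ext (by simp [mul_assoc]) (by simp [mul_assoc])

theorem scale_one_one (z : Plane) : scale 1 1 z = z := plane_ext (by simp) (by simp)

/-- The dilation `(x, y) ↦ (a x, b y)` as a measurable equivalence. -/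
noncomputable def scaleEquiv (a b : ℝ) (ha : 0 < a) (hb : 0 < b) : Plane ≃ᵐ Plane where
  toFun := scale a b
  invFun := scale a⁻¹ b⁻¹
  left_inv z := by rw [scale_scale, inv_mul_cancel₀ ha.ne', inv_mul_cancel₀ hb.ne', scale_one_one]
  right_inv z := by rw [scale_scale, mul_inv_cancel₀ ha.ne', mul_inv_cancel₀ hb.ne', scale_one_one]
  measurable_toFun := (continuous_scale a b).measurable
  measurable_invFun := (continuous_scale a⁻¹ b⁻¹).measurable

theorem map_scale {a b : ℝ} (ha : 0 < a) (hb : 0 < b) :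
    Measure.map (scale a b) volume = ENNReal.ofReal (a * b)⁻¹ • (volume : Measure Plane) := by
  have hs := (continuous_scale a b).measurable
  ext s hs'
  rw [← lintegral_indicator_one hs', Measure.smul_apply, ← lintegral_indicator_one hs',
    lintegral_map (measurable_one.indicator hs') hs]
  set h : Plane → ℝ≥0∞ := s.indicator 1
  have hh : Measurable h := measurable_one.indicator hs'
  have hh2 : Measurable fun p : ℝ × ℝ => h !₂[p.1, p.2] := hh.comp measurable_mk_plane
  have e0 := lintegral_plane (h := fun z => h (scale a b z)) (hh.comp hs)
  rw [e0, lintegral_plane hh]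
  have e1 : ∀ x, ∫⁻ y, h (scale a b !₂[x, y]) = ENNReal.ofReal b⁻¹ * ∫⁻ y, h !₂[a * x, y] := by
    intro x
    have := lintegral_comp_affine (f := fun y => h !₂[a * x, y])
      (hh2.comp (f := fun y => (a * x, y)) (by fun_prop)) hb.ne' 0
    rw [abs_of_pos (inv_pos.2 hb)] at this
    rw [← this]
    refine lintegral_congr fun y => ?_
    rw [add_zero]
    rfl
  have hm : Measurable fun x => ∫⁻ y, h !₂[x, y] := hh2.lintegral_prod_right'
  simp only [e1]
  rw [lintegral_const_mul' _ _ ENNReal.ofReal_ne_top]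
  have := lintegral_comp_affine hm ha.ne' 0
  simp only [add_zero] at this
  rw [this, abs_of_pos (inv_pos.2 ha), ← mul_assoc, ← ENNReal.ofReal_mul (by positivity), mul_inv,
    mul_comm a⁻¹]
  rfl

theorem lintegral_scale {a b : ℝ} (ha : 0 < a) (hb : 0 < b) (h : Plane → ℝ≥0∞) :
    ∫⁻ z, h (scale a b z) = ENNReal.ofReal (a * b)⁻¹ * ∫⁻ z, h z := by
  have := lintegral_map_equiv (μ := volume) h (scaleEquiv a b ha hb)
  change ∫⁻ z, h z ∂(Measure.map (scale a b) volume) = ∫⁻ z, h (scale a b z) at this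
  rw [← this, map_scale ha hb, lintegral_smul_measure]
  rfl

theorem integral_scale {a b : ℝ} (ha : 0 < a) (hb : 0 < b) (h : Plane → ℂ) :
    ∫ z, h (scale a b z) = (((a * b)⁻¹ : ℝ) : ℂ) * ∫ z, h z := by
  have := integral_map_equiv (μ := volume) (scaleEquiv a b ha hb) h
  change ∫ z, h z ∂(Measure.map (scale a b) volume) = ∫ z, h (scale a b z) at this
  rw [← this, map_scale ha hb, integral_smul_measure, ENNReal.toReal_ofReal (by positivity)]
  simp

theorem quasiMeasurePreserving_scale {a b : ℝ} (ha : 0 < a) (hb : 0 < b) :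
    Measure.QuasiMeasurePreserving (scale a b) volume volume :=
  ⟨(continuous_scale a b).measurable, by
    rw [map_scale ha hb]; exact Measure.smul_absolutelyContinuous⟩

end Scaling

/-! ### The symmetry group on the Fourier side -/

section Operators

/-- Parameters of a symmetry on the Fourier side: translations in space and time, and scales. -/
@[ext]
structure Par where
  X : ℝ
  Y : ℝ
  S : ℝ
  a : ℝ
  b : ℝ
  a_pos : 0 < a
  b_pos : 0 < b

/-- The exponential factor of a symmetry. -/
noncomputable def Par.phase (p : Par) (ξ : Plane) : ℂ :=
  Complex.exp (((-(2 * Real.pi * (p.X * ξ 0 + p.Y * ξ 1)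
    + 4 * Real.pi ^ 2 * p.S * (ξ 0 * ξ 1)) : ℝ) : ℂ) * Complex.I)

theorem Par.norm_phase (p : Par) (ξ : Plane) : ‖p.phase ξ‖ = 1 :=
  Complex.norm_exp_ofReal_mul_I _

theorem Par.measurable_phase (p : Par) : Measurable p.phase := by unfold Par.phase; fun_prop

/-- The action of a symmetry on functions of the frequency. -/
noncomputable def Par.fn (p : Par) (f : Plane → ℂ) (ξ : Plane) : ℂ :=
  ((Real.sqrt (p.a * p.b) : ℝ) : ℂ) * p.phase ξ * f (scale p.a p.b ξ)

theorem Par.fn_congr (p : Par) {f g : Plane → ℂ} (h : f =ᵐ[volume] g) :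
    p.fn f =ᵐ[volume] p.fn g := by
  filter_upwards [(quasiMeasurePreserving_scale p.a_pos p.b_pos).ae_eq_comp h] with ξ hξ
  simp only [Function.comp_apply] at hξ
  rw [Par.fn, Par.fn, hξ]

theorem Par.norm_fn (p : Par) (f : Plane → ℂ) (ξ : Plane) :
    ‖p.fn f ξ‖ = Real.sqrt (p.a * p.b) * ‖f (scale p.a p.b ξ)‖ := by
  rw [Par.fn, norm_mul, norm_mul, p.norm_phase, mul_one, Complex.norm_real,
    Real.norm_of_nonneg (Real.sqrt_nonneg _)]

theorem lintegral_sq_eq (f : Plane → ℂ) : ∫⁻ x, ‖f x‖ₑ ^ 2 = eLpNorm f 2 volume ^ 2 := by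
  have := eLpNorm_nnreal_pow_eq_lintegral (f := f) (μ := volume) (p := 2) (by norm_num)
  simpa using this.symm

theorem Par.eLpNorm_fn (p : Par) (f : Plane → ℂ) :
    eLpNorm (p.fn f) 2 volume = eLpNorm f 2 volume := by
  have ha := p.a_pos
  have hb := p.b_pos
  refine ENNReal.pow_right_strictMono two_ne_zero |>.injective ?_
  simp only [← lintegral_sq_eq]
  have h1 : ∀ ξ, ‖p.fn f ξ‖ₑ ^ 2
      = ENNReal.ofReal (p.a * p.b) * ‖f (scale p.a p.b ξ)‖ₑ ^ 2 := fun ξ => by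
    rw [← ofReal_norm, p.norm_fn, ENNReal.ofReal_mul (Real.sqrt_nonneg _), mul_pow,
      ← ENNReal.ofReal_pow (Real.sqrt_nonneg _), Real.sq_sqrt (by positivity), ofReal_norm]
  simp only [h1]
  rw [lintegral_const_mul' _ _ ENNReal.ofReal_ne_top,
    lintegral_scale ha hb (fun ξ => ‖f ξ‖ₑ ^ 2), ← mul_assoc, ← ENNReal.ofReal_mul (by positivity),
    mul_inv_cancel₀ (by positivity), ENNReal.ofReal_one, one_mul]

theorem Par.memLp_fn (p : Par) {f : Plane → ℂ} (hf : MemLp f 2) : MemLp (p.fn f) 2 := by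
  refine ⟨?_, by rw [p.eLpNorm_fn]; exact hf.2⟩
  have h1 := p.measurable_phase
  refine AEStronglyMeasurable.mul (Measurable.aestronglyMeasurable (by fun_prop)) ?_
  exact hf.1.comp_quasiMeasurePreserving (quasiMeasurePreserving_scale p.a_pos p.b_pos)

/-- Square-integrable functions of the frequency. -/
abbrev Freq : Type := Lp ℂ 2 (volume : Measure Plane)

/-- The action of a symmetry on `L²`. -/
noncomputable def Par.isom (p : Par) : Freq →ₗᵢ[ℂ] Freq where
  toFun F := (p.memLp_fn (Lp.memLp F)).toLp _
  map_add' F G := by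
    rw [← MemLp.toLp_add]
    refine MemLp.toLp_congr _ _ ?_
    filter_upwards [p.fn_congr (Lp.coeFn_add F G)] with ξ hξ
    rw [hξ]
    simp only [Par.fn, Pi.add_apply]
    ring
  map_smul' c F := by
    rw [RingHom.id_apply, ← MemLp.toLp_const_smul]
    refine MemLp.toLp_congr _ _ ?_
    filter_upwards [p.fn_congr (Lp.coeFn_smul c F)] with ξ hξ
    rw [hξ]
    simp only [Par.fn, Pi.smul_apply, smul_eq_mul]
    ring
  norm_map' F := by
    refine (Lp.norm_toLp _ (p.memLp_fn (Lp.memLp F))).trans ?_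
    rw [p.eLpNorm_fn, Lp.norm_def]

theorem Par.coeFn_isom (p : Par) (F : Freq) : (p.isom F : Plane → ℂ) =ᵐ[volume] p.fn F :=
  MemLp.coeFn_toLp (p.memLp_fn (Lp.memLp F))

/-- Composition of symmetries. -/
def Par.mul (p q : Par) : Par where
  X := p.X + p.a * q.X
  Y := p.Y + p.b * q.Y
  S := p.S + p.a * p.b * q.S
  a := q.a * p.a
  b := q.b * p.b
  a_pos := mul_pos q.a_pos p.a_pos
  b_pos := mul_pos q.b_pos p.b_pos

/-- The inverse of a symmetry. -/
noncomputable def Par.inv (p : Par) : Par where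
  X := -(p.X / p.a)
  Y := -(p.Y / p.b)
  S := -(p.S / (p.a * p.b))
  a := p.a⁻¹
  b := p.b⁻¹
  a_pos := inv_pos.2 p.a_pos
  b_pos := inv_pos.2 p.b_pos

/-- The outer dilation rescales the frequency in the inner phase, which multiplies its X, Y, S by a,
b, ab. This dictates the law `Par.mul`. -/
theorem Par.fn_fn (p q : Par) (f : Plane → ℂ) : p.fn (q.fn f) = (p.mul q).fn f := by
  ext ξ
  have ha := p.a_pos
  have hb := p.b_pos
  have ha' := q.a_pos
  have hb' := q.b_pos
  have h1 : Real.sqrt (q.a * p.a * (q.b * p.b)) = Real.sqrt (p.a * p.b) * Real.sqrt (q.a * q.b) := by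
    rw [← Real.sqrt_mul (by positivity)]
    congr 1; ring
  have h2 : (p.mul q).phase ξ = p.phase ξ * q.phase (scale p.a p.b ξ) := by
    simp only [Par.phase, Par.mul, scale_zero, scale_one]
    rw [← Complex.exp_add]
    congr 1
    push_cast
    ring
  simp only [Par.fn, h2, scale_scale]
  simp only [Par.mul, h1]
  push_cast
  ring

theorem Par.isom_isom (p q : Par) (F : Freq) : p.isom (q.isom F) = (p.mul q).isom F := by
  refine Lp.ext ?_
  filter_upwards [p.coeFn_isom (q.isom F), p.fn_congr (q.coeFn_isom F),
    (p.mul q).coeFn_isom F] with ξ h1 h2 h3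
  rw [h1, h2, h3, p.fn_fn]

theorem Par.mul_inv (p : Par) : p.mul p.inv = ⟨0, 0, 0, 1, 1, one_pos, one_pos⟩ := by
  have ha := p.a_pos.ne'
  have hb := p.b_pos.ne'
  ext <;> simp only [Par.mul, Par.inv] <;> field_simp <;> ring

theorem Par.inv_mul (p : Par) : p.inv.mul p = ⟨0, 0, 0, 1, 1, one_pos, one_pos⟩ := by
  have ha := p.a_pos.ne'
  have hb := p.b_pos.ne'
  ext <;> simp only [Par.mul, Par.inv] <;> field_simp <;> ring

theorem Par.isom_one (F : Freq) : (⟨0, 0, 0, 1, 1, one_pos, one_pos⟩ : Par).isom F = F := by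
  refine Lp.ext ?_
  filter_upwards [Par.coeFn_isom ⟨0, 0, 0, 1, 1, one_pos, one_pos⟩ F] with ξ h
  rw [h]
  simp [Par.fn, Par.phase, scale_one_one]

/-- The action of a symmetry on `L²` as a unitary operator. -/
noncomputable def Par.op (p : Par) : Freq ≃ₗᵢ[ℂ] Freq where
  toLinearEquiv := LinearEquiv.ofLinearMap p.isom.toLinearMap p.inv.isom.toLinearMap
    (by ext1 F; exact (p.isom_isom p.inv F).trans (by rw [p.mul_inv, Par.isom_one]; rfl))
    (by ext1 F; exact (p.inv.isom_isom p F).trans (by rw [p.inv_mul, Par.isom_one]; rfl))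
  norm_map' F := p.isom.norm_map F

theorem Par.op_apply (p : Par) (F : Freq) : p.op F = p.isom F := rfl

theorem Par.op_symm_apply (p : Par) (F : Freq) : p.op.symm F = p.inv.isom F := rfl

/-- Reduces every question about two frames to the size of one relative symmetry. -/
theorem Par.op_symm_op (p q : Par) (F : Freq) : q.op.symm (p.op F) = (q.inv.mul p).isom F :=
  q.inv.isom_isom p F

end Operators

/-! ### Decay of waves at infinity in space-time -/

section Vanishing

/-- If |h| ≥ ε at a point, then |h| ≥ ε/2 on a ball of fixed radius, which costs a fixed amount of
the L⁶ integral. Far out the tail of that integral is smaller. -/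
theorem tendsto_cocompact_of_uniformContinuous {h : ℝ × Plane → ℂ} (hu : UniformContinuous h)
    (hi : ∫⁻ q, ‖h q‖ₑ ^ 6 ≠ ⊤) : Tendsto h (cocompact (ℝ × Plane)) (𝓝 0) := by
  have hH : (volume : Measure (ℝ × Plane)).IsAddHaarMeasure := by
    rw [Measure.volume_eq_prod]; infer_instance
  rw [tendsto_zero_iff_norm_tendsto_zero]
  rw [Metric.tendsto_nhds]
  intro ε hε
  obtain ⟨δ, hδ, hδ'⟩ := Metric.uniformContinuous_iff.1 hu (ε / 2) (half_pos hε)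
  set V := (volume : Measure (ℝ × Plane)) (Metric.ball 0 δ)
  have hV : 0 < V := Metric.measure_ball_pos _ _ hδ
  have hV' : V ≠ ⊤ := measure_ball_lt_top.ne
  set c : ℝ≥0∞ := ENNReal.ofReal (ε / 2) ^ 6 * V
  have hc : 0 < c := by
    refine ENNReal.mul_pos (pow_ne_zero _ ?_) hV.ne'
    simpa using hε
  have hmf : Measurable fun q => ‖h q‖ₑ ^ 6 := by
    have := hu.continuous.measurable
    fun_prop
  have htail : Tendsto (fun n : ℕ => ∫⁻ q in (Metric.ball 0 (n : ℝ))ᶜ, ‖h q‖ₑ ^ 6) atTop (𝓝 0) := by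
    have hfin : IsFiniteMeasure (volume.withDensity fun q => ‖h q‖ₑ ^ 6) :=
      isFiniteMeasure_withDensity hi
    have := tendsto_measure_iInter_atTop (μ := volume.withDensity fun q => ‖h q‖ₑ ^ 6)
      (s := fun n : ℕ => (Metric.ball (0 : ℝ × Plane) (n : ℝ))ᶜ)
      (fun n => Metric.isOpen_ball.measurableSet.compl.nullMeasurableSet)
      (fun m n hmn => Set.compl_subset_compl.2 (Metric.ball_subset_ball (by exact_mod_cast hmn)))
      ⟨0, measure_ne_top _ _⟩
    have he : ⋂ n : ℕ, (Metric.ball (0 : ℝ × Plane) (n : ℝ))ᶜ = ∅ := by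
      rw [← Set.compl_iUnion, Metric.iUnion_ball_nat, Set.compl_univ]
    rw [he, measure_empty] at this
    refine this.congr fun n => ?_
    rw [Function.comp_apply, withDensity_apply _ Metric.isOpen_ball.measurableSet.compl]
  obtain ⟨n, hn⟩ := (htail.eventually_lt_const hc).exists
  filter_upwards [(isCompact_closedBall (0 : ℝ × Plane) (n + δ)).compl_mem_cocompact] with q hq
  by_contra hcon
  refine hn.not_ge ?_
  rw [dist_zero_right, norm_norm, not_lt] at hcon
  have hsub : Metric.ball q δ ⊆ (Metric.ball (0 : ℝ × Plane) (n : ℝ))ᶜ := by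
    intro q' hq' hq''
    apply hq
    rw [Metric.mem_closedBall]
    rw [Metric.mem_ball] at hq' hq''
    have := dist_triangle q q' 0
    rw [dist_comm q q'] at this
    linarith
  calc c = ∫⁻ q' in Metric.ball q δ, ENNReal.ofReal (ε / 2) ^ 6 := by
        rw [setLIntegral_const, Measure.addHaar_ball_center]
    _ ≤ ∫⁻ q' in Metric.ball q δ, ‖h q'‖ₑ ^ 6 := by
        refine setLIntegral_mono hmf fun q' hq' => ?_
        gcongr
        rw [← ofReal_norm]
        apply ENNReal.ofReal_le_ofReal
        have h1 := hδ' (Metric.mem_ball.1 hq')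
        rw [dist_eq_norm] at h1
        have h2 := norm_sub_norm_le (h q) (h q')
        rw [norm_sub_rev] at h2
        linarith
    _ ≤ _ := lintegral_mono_set hsub

theorem exists_coord_le {f : Plane → ℂ} (hf : HasCompactSupport f) :
    ∃ R : ℝ, 0 < R ∧ ∀ z, ¬ (z 0 ∈ Set.Icc (-R) R ∧ z 1 ∈ Set.Icc (-R) R) → f z = 0 := by
  obtain ⟨R, hR, hR'⟩ := hf.isCompact.isBounded.exists_pos_norm_le
  refine ⟨R, hR, fun z hz => ?_⟩
  by_contra hne
  refine hz ?_
  have h1 := hR' z (subset_tsupport _ hne)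
  have h2 : ∀ i, |z i| ≤ R := fun i => (PiLp.norm_apply_le z i).trans h1
  exact ⟨abs_le.1 (h2 0), abs_le.1 (h2 1)⟩

theorem norm_exp_sub_exp_le (x y : ℝ) :
    ‖Complex.exp ((x : ℂ) * Complex.I) - Complex.exp ((y : ℂ) * Complex.I)‖ ≤ |x - y| := by
  have h : Complex.exp ((x : ℂ) * Complex.I) - Complex.exp ((y : ℂ) * Complex.I)
      = Complex.exp ((y : ℂ) * Complex.I) * (Complex.exp (Complex.I * ((x - y : ℝ) : ℂ)) - 1) := by
    rw [mul_sub, ← Complex.exp_add, mul_one]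
    congr 2
    push_cast; ring
  rw [h, norm_mul, Complex.norm_exp_ofReal_mul_I, one_mul]
  exact Real.norm_exp_I_mul_ofReal_sub_one_le

theorem continuous_lift : Continuous lift := by
  refine (WithLp.prod_continuous_toLp 2 ℝ Plane).comp ?_
  fun_prop

/-- The wave is even Lipschitz, since compact support makes the first moment of the lifted frequency
finite. -/
theorem uniformContinuous_wave {f : Plane → ℂ} (hf : Continuous f) (hfc : HasCompactSupport f) :
    UniformContinuous (wave f) := by
  have hfi : Integrable f := hf.integrable_of_hasCompactSupport hfc
  have hm : Integrable fun ξ => ‖lift ξ‖ * ‖f ξ‖ :=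
    (continuous_lift.norm.mul hf.norm).integrable_of_hasCompactSupport hfc.norm.mul_left
  set L := 2 * Real.pi * ∫ ξ, ‖lift ξ‖ * ‖f ξ‖
  have hlip : ∀ p p' : SpaceTime, ‖wave f p.ofLp - wave f p'.ofLp‖ ≤ L * ‖p - p'‖ := by
    intro p p'
    rw [wave, wave, ← integral_sub (integrable_wave_integrand hfi _)
      (integrable_wave_integrand hfi _)]
    have : L * ‖p - p'‖ = ∫ ξ, 2 * Real.pi * ‖p - p'‖ * (‖lift ξ‖ * ‖f ξ‖) := by
      rw [integral_const_mul]; ring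
    rw [this]
    refine norm_integral_le_of_norm_le (hm.const_mul _) (Eventually.of_forall fun ξ => ?_)
    rw [← sub_mul, norm_mul, ← mul_assoc]
    gcongr
    refine (norm_exp_sub_exp_le _ _).trans ?_
    change |2 * Real.pi * inner ℝ p (lift ξ) - 2 * Real.pi * inner ℝ p' (lift ξ)| ≤ _
    have e : (inner ℝ p (lift ξ) : ℝ) - inner ℝ p' (lift ξ) = inner ℝ (p - p') (lift ξ) :=
      (inner_sub_left _ _ _).symm
    rw [← mul_sub, e, abs_mul, abs_of_pos Real.two_pi_pos]
    have := mul_le_mul_of_nonneg_left (abs_real_inner_le_norm (p - p') (lift ξ)) Real.two_pi_pos.le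
    linarith
  have h1 : UniformContinuous fun p : SpaceTime => wave f p.ofLp := by
    have hL : 0 ≤ L := by positivity
    refine (LipschitzWith.of_dist_le_mul (K := ⟨L, hL⟩) fun p p' => ?_).uniformContinuous
    rw [dist_eq_norm, dist_eq_norm]
    exact hlip p p'
  have h2 : UniformContinuous fun q : ℝ × Plane => (WithLp.toLp 2 q : SpaceTime) :=
    WithLp.prod_uniformContinuous_toLp 2 ℝ Plane
  exact h1.comp h2

/-- The L⁶ bound with uniform continuity takes the place of a stationary phase estimate. -/
theorem tendsto_wave_cocompact {f : Plane → ℂ} (hf : Continuous f) (hfc : HasCompactSupport f) :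
    Tendsto (wave f) (cocompact (ℝ × Plane)) (𝓝 0) := by
  have hfi : Integrable f := hf.integrable_of_hasCompactSupport hfc
  obtain ⟨R, hR, hR'⟩ := exists_coord_le hfc
  refine tendsto_cocompact_of_uniformContinuous (uniformContinuous_wave hf hfc) ?_
  refine ne_top_of_le_ne_top ?_ (lintegral_wave_pow_six_le (A := Set.Icc (-R) R)
    (B := Set.Icc (-R) R) measurableSet_Icc measurableSet_Icc hR.le (fun a ha => abs_le.2 ha)
    hfi hR')
  refine ENNReal.mul_ne_top (ENNReal.mul_ne_top ENNReal.ofReal_ne_top ?_) (ENNReal.pow_ne_top ?_)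
  · exact measure_Icc_lt_top.ne
  · rw [lintegral_sq_eq]
    have h2 : MemLp f 2 := hf.memLp_of_hasCompactSupport hfc
    exact ENNReal.pow_ne_top h2.eLpNorm_ne_top

end Vanishing

/-! ### Reduction to continuous compactly supported functions -/

section Density

theorem exists_continuous_near (F : Freq) {δ : ℝ} (hδ : 0 < δ) :
    ∃ (f : Plane → ℂ) (hf : MemLp f 2 volume), Continuous f ∧ HasCompactSupport f ∧
      ‖F - hf.toLp f‖ ≤ δ := by
  obtain ⟨f, h1, h2, h3, h4⟩ := (Lp.memLp F).exists_hasCompactSupport_eLpNorm_sub_le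
    (by norm_num) (ε := ENNReal.ofReal δ) (by simpa using hδ)
  refine ⟨f, h4, h3, h1, ?_⟩
  have : F - h4.toLp f = ((Lp.memLp F).sub h4).toLp _ := by
    rw [MemLp.toLp_sub (Lp.memLp F) h4, Lp.toLp_coeFn]
  rw [this, Lp.norm_toLp]
  exact ENNReal.toReal_le_of_le_ofReal hδ.le h2

/-- Weak convergence of contractions may be tested on continuous functions of compact support. -/
theorem tendsto_inner_of_continuous {ι : Type*} {l : Filter ι} {U : ι → Freq →L[ℂ] Freq}
    {V : Freq →L[ℂ] Freq} (hU : ∀ i F, ‖U i F‖ ≤ ‖F‖) (hV : ∀ F, ‖V F‖ ≤ ‖F‖)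
    (h : ∀ (f g : Plane → ℂ) (hf : MemLp f 2) (hg : MemLp g 2), Continuous f →
      HasCompactSupport f → Continuous g → HasCompactSupport g →
      Tendsto (fun i => inner ℂ (hg.toLp g) (U i (hf.toLp f))) l
        (𝓝 (inner ℂ (hg.toLp g) (V (hf.toLp f))))) (F G : Freq) :
    Tendsto (fun i => inner ℂ G (U i F)) l (𝓝 (inner ℂ G (V F))) := by
  rw [Metric.tendsto_nhds]
  intro ε hε
  set δ := ε / (4 * (‖F‖ + ‖G‖ + ε + 1))
  have hδ : 0 < δ := by positivity
  have hδε : δ ≤ ε := by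
    rw [div_le_iff₀ (by positivity)]
    nlinarith [norm_nonneg F, norm_nonneg G]
  obtain ⟨f, hf, hfc, hfs, hFf⟩ := exists_continuous_near F hδ
  obtain ⟨g, hg, hgc, hgs, hGg⟩ := exists_continuous_near G hδ
  set F' := hf.toLp f
  set G' := hg.toLp g
  have key : ∀ W : Freq →L[ℂ] Freq, (∀ F, ‖W F‖ ≤ ‖F‖) →
      ‖inner ℂ G (W F) - inner ℂ G' (W F')‖ ≤ δ * (‖F‖ + ‖G‖ + ε) := by
    intro W hW
    have e : inner ℂ G (W F) - inner ℂ G' (W F')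
        = inner ℂ (G - G') (W F) + inner ℂ G' (W (F - F')) := by
      rw [inner_sub_left, map_sub, inner_sub_right]; ring
    have hG' : ‖G'‖ ≤ ‖G‖ + ε := by
      have := norm_sub_norm_le G' G
      rw [norm_sub_rev] at this
      linarith
    calc _ ≤ ‖G - G'‖ * ‖W F‖ + ‖G'‖ * ‖W (F - F')‖ := by
          rw [e]
          exact (norm_add_le _ _).trans (add_le_add (norm_inner_le_norm _ _) (norm_inner_le_norm _ _))
      _ ≤ δ * ‖F‖ + (‖G‖ + ε) * δ := by
          gcongr
          · exact hW F
          · exact (hW _).trans hFf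
      _ = _ := by ring
  have hδ4 : δ * (‖F‖ + ‖G‖ + ε) ≤ ε / 4 := by
    have : δ * (4 * (‖F‖ + ‖G‖ + ε + 1)) = ε := div_mul_cancel₀ _ (by positivity)
    linarith
  filter_upwards [(Metric.tendsto_nhds.1 (h f g hf hg hfc hfs hgc hgs)) (ε / 4) (by positivity)]
    with i hi
  rw [dist_eq_norm] at hi ⊢
  have h1 := key (U i) (hU i)
  have h2 := key V hV
  calc _ = ‖(inner ℂ G (U i F) - inner ℂ G' (U i F')) + (inner ℂ G' (U i F') - inner ℂ G' (V F'))
        - (inner ℂ G (V F) - inner ℂ G' (V F'))‖ := by congr 1; ring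
    _ ≤ _ := (norm_sub_le _ _).trans (add_le_add_left (norm_add_le _ _) _)
    _ < ε := by linarith

theorem inner_toLp_isom (p : Par) {f g : Plane → ℂ} (hf : MemLp f 2) (hg : MemLp g 2) :
    inner ℂ (hg.toLp g) (p.isom (hf.toLp f)) = ∫ ξ, p.fn f ξ * (starRingEnd ℂ) (g ξ) := by
  rw [L2.inner_def]
  refine integral_congr_ae ?_
  filter_upwards [hg.coeFn_toLp, p.coeFn_isom (hf.toLp f), p.fn_congr hf.coeFn_toLp]
    with ξ h1 h2 h3
  rw [h1, h2, h3, RCLike.inner_apply]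

end Density

/-! ### Diverging symmetries tend weakly to zero -/

section Asymptotics

/-- A matrix coefficient of a pure translation is itself a wave, with profile f times the conjugate
of g, so its vanishing is the decay of waves at infinity. -/
theorem inner_isom_translation (X Y S : ℝ) {f g : Plane → ℂ} (hf : MemLp f 2) (hg : MemLp g 2) :
    inner ℂ (hg.toLp g) ((⟨X, Y, S, 1, 1, one_pos, one_pos⟩ : Par).isom (hf.toLp f))
      = wave (fun ξ => f ξ * (starRingEnd ℂ) (g ξ)) (S, !₂[-X, -Y]) := by
  rw [inner_toLp_isom, wave]
  congr 1
  ext ξ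
  have h : 2 * Real.pi * inner ℝ (WithLp.toLp 2 (S, !₂[-X, -Y]) : SpaceTime) (lift ξ)
      = -(2 * Real.pi * (X * ξ 0 + Y * ξ 1) + 4 * Real.pi ^ 2 * S * (ξ 0 * ξ 1)) := by
    rw [lift, WithLp.prod_inner_apply]
    simp [PiLp.inner_apply, Fin.sum_univ_two]
    ring
  rw [h]
  simp only [Par.fn, Par.phase, mul_one, Real.sqrt_one, Complex.ofReal_one, one_mul, scale_one_one]
  ring

theorem tendsto_inner_translation {ι : Type*} {l : Filter ι} {X Y S : ι → ℝ}
    (h : Tendsto (fun i => |X i| + |Y i| + |S i|) l atTop) (F G : Freq) :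
    Tendsto (fun i => inner ℂ G
      ((⟨X i, Y i, S i, 1, 1, one_pos, one_pos⟩ : Par).isom F)) l (𝓝 0) := by
  have hq : Tendsto (fun i => ((S i, !₂[-X i, -Y i]) : ℝ × Plane)) l (cocompact (ℝ × Plane)) := by
    rw [← Metric.cobounded_eq_cocompact, ← comap_norm_atTop, tendsto_comap_iff]
    refine tendsto_atTop_mono (fun i => ?_) (h.atTop_div_const (r := 3) (by norm_num))
    have h0 : |S i| ≤ ‖((S i, !₂[-X i, -Y i]) : ℝ × Plane)‖ := norm_fst_le ((S i, !₂[-X i, -Y i]) : ℝ × Plane)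
    have h1 : ‖!₂[-X i, -Y i]‖ ≤ ‖((S i, !₂[-X i, -Y i]) : ℝ × Plane)‖ := norm_snd_le ((S i, !₂[-X i, -Y i]) : ℝ × Plane)
    have h2 := PiLp.norm_apply_le !₂[-X i, -Y i] 0
    have h3 := PiLp.norm_apply_le !₂[-X i, -Y i] 1
    simp only [Matrix.cons_val_zero, Matrix.cons_val_one, norm_neg, Real.norm_eq_abs] at h2 h3
    simp only [Function.comp_apply]
    linarith
  have := tendsto_inner_of_continuous (l := l)
    (U := fun i => (⟨X i, Y i, S i, 1, 1, one_pos, one_pos⟩ : Par).isom.toContinuousLinearMap)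
    (V := 0) (fun i F => (LinearIsometry.norm_map _ F).le) (fun F => by simp) ?_ F G
  · simpa using this
  · intro f g hf hg hfc hfs hgc hgs
    simp only [zero_apply, inner_zero_right]
    refine Tendsto.congr (fun i => (inner_isom_translation (X i) (Y i) (S i) hf hg).symm)
      (Tendsto.comp (g := wave fun ξ => f ξ * (starRingEnd ℂ) (g ξ))
        (tendsto_wave_cocompact ?_ ?_) hq)
    · exact hfc.mul (Complex.continuous_conj.comp hgc)
    · exact hfs.mul_right

theorem sqrt_mul_min_le {a : ℝ} (ha : 0 < a) :
    Real.sqrt a * min 1 a⁻¹ ≤ Real.exp (-(|Real.log a| / 2)) := by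
  have h1 : Real.sqrt a = Real.exp (Real.log a / 2) := by
    rw [← Real.log_sqrt ha.le, Real.exp_log (Real.sqrt_pos.2 ha)]
  rcases le_total 0 (Real.log a) with h | h
  · rw [abs_of_nonneg h]
    calc _ ≤ Real.sqrt a * a⁻¹ := by gcongr; exact min_le_right _ _
      _ = _ := by
        nth_rewrite 2 [← Real.exp_log ha]
        rw [h1, ← Real.exp_neg, ← Real.exp_add]
        congr 1; ring
  · rw [abs_of_nonpos h]
    calc _ ≤ Real.sqrt a * 1 := by gcongr; exact min_le_left _ _
      _ = _ := by rw [mul_one, h1]; congr 1; ring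

/-- The integrand is nonzero only where both ξ and its dilate lie in the square, that is in a
rectangle with half-sides R min(1, 1/a) and R min(1, 1/b). Against the normalisation √(ab) this area
loses exponentially in the logarithmic scales, by `sqrt_mul_min_le`. -/
theorem norm_integral_fn_mul_le (p : Par) {f g : Plane → ℂ} {M R : ℝ} (hR : 0 < R)
    (hfM : ∀ z, ‖f z‖ ≤ M) (hgM : ∀ z, ‖g z‖ ≤ M)
    (hf : ∀ z, ¬ (z 0 ∈ Set.Icc (-R) R ∧ z 1 ∈ Set.Icc (-R) R) → f z = 0)
    (hg : ∀ z, ¬ (z 0 ∈ Set.Icc (-R) R ∧ z 1 ∈ Set.Icc (-R) R) → g z = 0) :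
    ‖∫ ξ, p.fn f ξ * (starRingEnd ℂ) (g ξ)‖
      ≤ 4 * M ^ 2 * R ^ 2 * Real.exp (-((|Real.log p.a| + |Real.log p.b|) / 2)) := by
  have ha := p.a_pos
  have hb := p.b_pos
  have hM : 0 ≤ M := (norm_nonneg _).trans (hfM 0)
  set α := R * min 1 p.a⁻¹
  set β := R * min 1 p.b⁻¹
  have hα : 0 ≤ α := by positivity
  have hβ : 0 ≤ β := by positivity
  set A := Set.Icc (-α) α
  set B := Set.Icc (-β) β
  set Q := {z : Plane | z 0 ∈ A ∧ z (1 - 0) ∈ B}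
  have hQ : MeasurableSet Q := MeasurableSet.inter
    (measurableSet_Icc.preimage (f := fun z : Plane => z 0) (by fun_prop))
      (measurableSet_Icc.preimage (f := fun z : Plane => z (1 - 0)) (by fun_prop))
  have hvol : volume Q = ENNReal.ofReal (4 * (α * β)) := by
    have := setLIntegral_rect 0 (A := A) (B := B) measurableSet_Icc measurableSet_Icc
      (h := fun _ => 1) measurable_const
    simp only [setLIntegral_one] at this
    rw [this]
    simp only [A, B, setLIntegral_const, Real.volume_Icc, sub_neg_eq_add]
    rw [← ENNReal.ofReal_mul (by positivity)]
    congr 1; ring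
  have hscale : ∀ {c x : ℝ}, 0 < c → x ∈ Set.Icc (-R) R → c * x ∈ Set.Icc (-R) R →
      x ∈ Set.Icc (-(R * min 1 c⁻¹)) (R * min 1 c⁻¹) := by
    intro c x hc h1 h2
    rw [Set.mem_Icc, ← abs_le] at h1 h2 ⊢
    rw [mul_min_of_nonneg _ _ hR.le, mul_one, le_min_iff]
    refine ⟨h1, ?_⟩
    rw [abs_mul, abs_of_pos hc] at h2
    rw [← div_eq_mul_inv, le_div_iff₀ hc]
    linarith
  have hpt : ∀ ξ, ‖p.fn f ξ * (starRingEnd ℂ) (g ξ)‖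
      ≤ Q.indicator (fun _ => Real.sqrt (p.a * p.b) * M ^ 2) ξ := by
    intro ξ
    rw [norm_mul, p.norm_fn, RCLike.norm_conj]
    by_cases hξ : ξ ∈ Q
    · rw [Set.indicator_of_mem hξ, sq, ← mul_assoc]
      gcongr
      · exact hfM _
      · exact hgM _
    · rw [Set.indicator_of_notMem hξ]
      by_cases h1 : ξ 0 ∈ Set.Icc (-R) R ∧ ξ 1 ∈ Set.Icc (-R) R
      · by_cases h2 : scale p.a p.b ξ 0 ∈ Set.Icc (-R) R ∧ scale p.a p.b ξ 1 ∈ Set.Icc (-R) R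
        · exact absurd ⟨hscale ha h1.1 h2.1, hscale hb h1.2 h2.2⟩ hξ
        · rw [hf _ h2]; simp
      · rw [hg _ h1]; simp
  have hfin : volume Q ≠ ⊤ := by rw [hvol]; exact ENNReal.ofReal_ne_top
  calc _ ≤ ∫ ξ, Q.indicator (fun _ => Real.sqrt (p.a * p.b) * M ^ 2) ξ := by
        refine norm_integral_le_of_norm_le ?_ (Eventually.of_forall hpt)
        exact (integrable_indicator_iff hQ).2 (integrableOn_const hfin)
    _ = 4 * M ^ 2 * R ^ 2 * ((Real.sqrt p.a * min 1 p.a⁻¹) * (Real.sqrt p.b * min 1 p.b⁻¹)) := by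
        rw [integral_indicator_const _ hQ, measureReal_def, hvol,
          ENNReal.toReal_ofReal (by positivity), Real.sqrt_mul ha.le, smul_eq_mul]
        simp only [α, β]
        ring
    _ ≤ 4 * M ^ 2 * R ^ 2 * (Real.exp (-(|Real.log p.a| / 2)) * Real.exp (-(|Real.log p.b| / 2))) := by
        gcongr
        · exact sqrt_mul_min_le ha
        · exact sqrt_mul_min_le hb
    _ = _ := by
        rw [← Real.exp_add]
        congr 2; ring

theorem tendsto_inner_scaling {ι : Type*} {l : Filter ι} {p : ι → Par}
    (h : Tendsto (fun i => |Real.log (p i).a| + |Real.log (p i).b|) l atTop) (F G : Freq) :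
    Tendsto (fun i => inner ℂ G ((p i).isom F)) l (𝓝 0) := by
  have := tendsto_inner_of_continuous (l := l)
    (U := fun i => (p i).isom.toContinuousLinearMap)
    (V := 0) (fun i F => (LinearIsometry.norm_map _ F).le) (fun F => by simp) ?_ F G
  · simpa using this
  · intro f g hf hg hfc hfs hgc hgs
    simp only [zero_apply, inner_zero_right]
    obtain ⟨R₁, hR₁, hR₁'⟩ := exists_coord_le hfs
    obtain ⟨R₂, hR₂, hR₂'⟩ := exists_coord_le hgs
    obtain ⟨M₁, hM₁⟩ := hfc.bounded_above_of_compact_support hfs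
    obtain ⟨M₂, hM₂⟩ := hgc.bounded_above_of_compact_support hgs
    have hmono : ∀ {R x : ℝ}, R ≤ max R₁ R₂ → x ∈ Set.Icc (-R) R →
        x ∈ Set.Icc (-max R₁ R₂) (max R₁ R₂) := fun h hx =>
      ⟨(neg_le_neg h).trans hx.1, hx.2.trans h⟩
    have hb : ∀ i, ‖inner ℂ (hg.toLp g) ((p i).isom (hf.toLp f))‖ ≤
        4 * (max M₁ M₂) ^ 2 * (max R₁ R₂) ^ 2
          * Real.exp (-((|Real.log (p i).a| + |Real.log (p i).b|) / 2)) := by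
      intro i
      rw [inner_toLp_isom]
      refine norm_integral_fn_mul_le _ (lt_max_of_lt_left hR₁)
        (fun z => (hM₁ z).trans (le_max_left _ _)) (fun z => (hM₂ z).trans (le_max_right _ _))
        (fun z hz => hR₁' z fun hz' => hz ?_) (fun z hz => hR₂' z fun hz' => hz ?_)
      · exact ⟨hmono (le_max_left _ _) hz'.1, hmono (le_max_left _ _) hz'.2⟩
      · exact ⟨hmono (le_max_right _ _) hz'.1, hmono (le_max_right _ _) hz'.2⟩
    refine squeeze_zero_norm hb ?_
    have h2 := Real.tendsto_exp_neg_atTop_nhds_zero.comp (h.atTop_div_const (r := 2) (by norm_num))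
    simpa using h2.const_mul (4 * (max M₁ M₂) ^ 2 * (max R₁ R₂) ^ 2)

end Asymptotics

/-! ### Strong continuity of the group action -/

section StrongContinuity

/-- The symmetry with translation parameters `v.1`, `v.2.1`, `v.2.2.1` and logarithmic scales
`v.2.2.2.1`, `v.2.2.2.2`. -/
noncomputable def expPar (v : ℝ × ℝ × ℝ × ℝ × ℝ) : Par :=
  ⟨v.1, v.2.1, v.2.2.1, Real.exp v.2.2.2.1, Real.exp v.2.2.2.2, Real.exp_pos _, Real.exp_pos _⟩

/-- The logarithmic coordinates of a symmetry. -/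
noncomputable def Par.logCoords (p : Par) : ℝ × ℝ × ℝ × ℝ × ℝ :=
  (p.X, p.Y, p.S, Real.log p.a, Real.log p.b)

theorem expPar_logCoords (p : Par) : expPar p.logCoords = p := by
  ext <;> simp [expPar, Par.logCoords, Real.exp_log p.a_pos, Real.exp_log p.b_pos]

theorem continuous_inner_expPar (F G : Freq) :
    Continuous fun v => inner ℂ G ((expPar v).isom F) := by
  rw [continuous_iff_continuousAt]
  intro v₀
  refine tendsto_inner_of_continuous (U := fun v => (expPar v).isom.toContinuousLinearMap)
    (V := (expPar v₀).isom.toContinuousLinearMap) (fun i F => (LinearIsometry.norm_map _ F).le)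
    (fun F => (LinearIsometry.norm_map _ F).le) ?_ F G
  intro f g hf hg hfc hfs hgc hgs
  obtain ⟨M, hM⟩ := hfc.bounded_above_of_compact_support hfs
  have hgi : Integrable g := hgc.integrable_of_hasCompactSupport hgs
  have hsc : Continuous fun v : ℝ × ℝ × ℝ × ℝ × ℝ => Real.sqrt ((expPar v).a * (expPar v).b) := by
    simp only [expPar]
    fun_prop
  change ContinuousAt (fun v => inner ℂ (hg.toLp g) ((expPar v).isom (hf.toLp f))) v₀
  simp only [inner_toLp_isom]
  refine continuousAt_of_dominated
    (bound := fun ξ => (Real.sqrt ((expPar v₀).a * (expPar v₀).b) + 1) * M * ‖g ξ‖) ?_ ?_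
    (hgi.norm.const_mul _) (Eventually.of_forall fun ξ => Continuous.continuousAt ?_)
  · refine Eventually.of_forall fun v => ?_
    have h1 := (expPar v).memLp_fn hf
    exact h1.1.mul (Complex.continuous_conj.comp hgc).aestronglyMeasurable
  · filter_upwards [hsc.continuousAt.eventually_le_const (lt_add_one _)] with v hv
    refine Eventually.of_forall fun ξ => ?_
    rw [norm_mul, RCLike.norm_conj, Par.norm_fn]
    gcongr
    exact hM _
  · have h1 : Continuous fun v => scale (expPar v).a (expPar v).b ξ := by
      refine (PiLp.continuous_toLp 2 fun _ : Fin 2 => ℝ).comp (continuous_pi fun i => ?_)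
      fin_cases i
      · simp only [Fin.zero_eta, Matrix.cons_val_zero, expPar]; fun_prop
      · simp only [Fin.mk_one, Matrix.cons_val_one, expPar]; fun_prop
    have h2 : Continuous fun v => (expPar v).phase ξ := by
      simp only [Par.phase, expPar]
      fun_prop
    exact ((Complex.continuous_ofReal.comp hsc).mul h2).mul (hfc.comp h1) |>.mul continuous_const

/-- Weak continuity together with constant norm gives strong continuity. -/
theorem continuous_expPar_isom (F : Freq) : Continuous fun v => (expPar v).isom F := by
  rw [continuous_iff_continuousAt]
  intro v₀
  rw [ContinuousAt, tendsto_iff_norm_sub_tendsto_zero]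
  have h1 : ∀ v, ‖(expPar v).isom F - (expPar v₀).isom F‖ ^ 2
      = 2 * ‖F‖ ^ 2 - 2 * RCLike.re (inner ℂ ((expPar v₀).isom F) ((expPar v).isom F)) := by
    intro v
    rw [norm_sub_sq (𝕜 := ℂ), LinearIsometry.norm_map, LinearIsometry.norm_map, inner_re_symm]
    ring
  have h2 : Tendsto (fun v => ‖(expPar v).isom F - (expPar v₀).isom F‖ ^ 2) (𝓝 v₀) (𝓝 0) := by
    simp only [h1]
    have h3 := ((RCLike.continuous_re.comp
      (continuous_inner_expPar F ((expPar v₀).isom F))).tendsto v₀).const_mul 2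
    have h4 := h3.const_sub (2 * ‖F‖ ^ 2)
    refine h4.trans (le_of_eq ?_)
    congr 1
    simp only [Function.comp_apply]
    rw [inner_self_eq_norm_sq, LinearIsometry.norm_map, sub_self]
  have h5 := h2.sqrt
  simpa using h5

end StrongContinuity

/-! ### The symmetries as a family of dislocations -/

section DislocationGroup

/-- The distance of a symmetry from the identity. -/
noncomputable def Par.size (r : Par) : ℝ :=
  |Real.log r.a| + |Real.log r.b| + |r.X| / Real.sqrt r.a + |r.Y| / Real.sqrt r.b
    + |r.S| / Real.sqrt (r.a * r.b)

theorem sqrt_le_exp {a R : ℝ} (ha : 0 < a) (h : |Real.log a| ≤ R) :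
    Real.sqrt a ≤ Real.exp (R / 2) := by
  rw [← Real.exp_log (Real.sqrt_pos.2 ha), Real.log_sqrt ha.le]
  gcongr
  exact (le_abs_self _).trans h

theorem exp_le_sqrt {a R : ℝ} (ha : 0 < a) (h : |Real.log a| ≤ R) :
    Real.exp (-(R / 2)) ≤ Real.sqrt a := by
  rw [← Real.exp_log (Real.sqrt_pos.2 ha), Real.log_sqrt ha.le]
  gcongr
  have := (neg_le_of_abs_le h)
  linarith

theorem tendsto_ultrafilter_of_norm_le {E : Type*} [NormedAddCommGroup E] [ProperSpace E]
    (ω : Ultrafilter ℕ) {v : ℕ → E} {R : ℝ} (h : ∀ᶠ n in (ω : Filter ℕ), ‖v n‖ ≤ R) :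
    ∃ v₀, Tendsto v ω (𝓝 v₀) := by
  obtain ⟨v₀, -, hv⟩ := (isCompact_closedBall (0 : E) R).ultrafilter_le_nhds' (ω.map v)
    (by
      rw [Ultrafilter.mem_map]
      filter_upwards [h] with n hn
      simpa using hn)
  exact ⟨v₀, hv⟩

theorem eventually_le_of_not_tendsto (ω : Ultrafilter ℕ) {s : ℕ → ℝ}
    (h : ¬ Tendsto s ω atTop) : ∃ R, 0 < R ∧ ∀ᶠ n in (ω : Filter ℕ), s n ≤ R := by
  rw [tendsto_atTop] at h
  push Not at h
  obtain ⟨R, hR⟩ := h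
  refine ⟨max R 1, by positivity, ?_⟩
  filter_upwards [hR] with n hn
  exact hn.le.trans (le_max_left _ _)

/-- Bounded size confines the logarithmic coordinates to a compact subset of ℝ⁵, where they converge
along the ultrafilter; strong continuity does the rest. -/
theorem exists_tendsto_isom (ω : Ultrafilter ℕ) {r : ℕ → Par}
    (h : ¬ Tendsto (fun n => (r n).size) ω atTop) (ψ : Freq) :
    ∃ ψ', Tendsto (fun n => (r n).isom ψ) ω (𝓝 ψ') := by
  obtain ⟨R, hR, hev⟩ := eventually_le_of_not_tendsto ω h
  obtain ⟨v₀, hv₀⟩ := tendsto_ultrafilter_of_norm_le ω (v := fun n => (r n).logCoords)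
    -- R bounds the logarithms of the scales, and R · e^R the translations, whose normalising square
    -- roots are at most e^R.
    (R := R + R * Real.exp R) (by
      filter_upwards [hev] with n hn
      have ha := (r n).a_pos
      have hb := (r n).b_pos
      unfold Par.size at hn
      have p1 := abs_nonneg (Real.log (r n).a)
      have p2 := abs_nonneg (Real.log (r n).b)
      have p3 : 0 ≤ |(r n).X| / Real.sqrt (r n).a := by positivity
      have p4 : 0 ≤ |(r n).Y| / Real.sqrt (r n).b := by positivity
      have p5 : 0 ≤ |(r n).S| / Real.sqrt ((r n).a * (r n).b) := by positivity
      have p6 : 0 ≤ R * Real.exp R := by positivity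
      have hA : Real.sqrt (r n).a ≤ Real.exp (R / 2) := sqrt_le_exp ha (by linarith)
      have hB : Real.sqrt (r n).b ≤ Real.exp (R / 2) := sqrt_le_exp hb (by linarith)
      have hhalf : Real.exp (R / 2) ≤ Real.exp R := Real.exp_le_exp.2 (by linarith)
      have hAB : Real.sqrt ((r n).a * (r n).b) ≤ Real.exp R := by
        rw [Real.sqrt_mul ha.le]
        calc _ ≤ Real.exp (R / 2) * Real.exp (R / 2) := by gcongr
          _ = _ := by rw [← Real.exp_add]; congr 1; ring
      have key : ∀ {x c : ℝ}, 0 < c → |x| / c ≤ R → c ≤ Real.exp R → |x| ≤ R + R * Real.exp R := by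
        intro x c hc hx hc'
        rw [div_le_iff₀ hc] at hx
        have := mul_le_mul_of_nonneg_left hc' hR.le
        linarith
      simp only [Par.logCoords, norm_prod_le_iff, Real.norm_eq_abs]
      refine ⟨key (Real.sqrt_pos.2 ha) (by linarith) (hA.trans hhalf),
        key (Real.sqrt_pos.2 hb) (by linarith) (hB.trans hhalf),
        key (Real.sqrt_pos.2 (mul_pos ha hb)) (by linarith) hAB, by linarith, by linarith⟩)
  refine ⟨(expPar v₀).isom ψ, ?_⟩
  refine (((continuous_expPar_isom ψ).tendsto v₀).comp hv₀).congr fun n => ?_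
  rw [Function.comp_apply, expPar_logCoords]

/-- Either the scales diverge, and the overlap bound applies, or they stay bounded along the
ultrafilter. In the second case the dilation part converges strongly, the translations must diverge,
and r factors as the translation τ after the dilation d. -/
theorem tendsto_inner_of_size (ω : Ultrafilter ℕ) {r : ℕ → Par}
    (h : Tendsto (fun n => (r n).size) ω atTop) (φ ψ : Freq) :
    Tendsto (fun n => inner ℂ ψ ((r n).isom φ)) ω (𝓝 0) := by
  by_cases hs : Tendsto (fun n => |Real.log (r n).a| + |Real.log (r n).b|) ω atTop
  · exact tendsto_inner_scaling hs φ ψ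
  obtain ⟨R, hR, hev⟩ := eventually_le_of_not_tendsto ω hs
  set d : ℕ → Par := fun n => ⟨0, 0, 0, (r n).a, (r n).b, (r n).a_pos, (r n).b_pos⟩
  have hd : ∃ φ', Tendsto (fun n => (d n).isom φ) ω (𝓝 φ') := by
    refine exists_tendsto_isom ω (fun hc => hs ?_) φ
    simpa [Par.size, d] using hc
  obtain ⟨φ', hφ'⟩ := hd
  have hX : Tendsto (fun n => |(r n).X| + |(r n).Y| + |(r n).S|) ω atTop := by
    have h1 := (tendsto_atTop_add_const_right _ (-R) h).atTop_div_const (r := Real.exp R)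
      (Real.exp_pos _)
    refine tendsto_atTop_mono' _ ?_ h1
    filter_upwards [hev] with n hn
    have ha := (r n).a_pos
    have hb := (r n).b_pos
    have p1 := abs_nonneg (Real.log (r n).a)
    have p2 := abs_nonneg (Real.log (r n).b)
    have hA : Real.exp (-(R / 2)) ≤ Real.sqrt (r n).a := exp_le_sqrt ha (by linarith)
    have hB : Real.exp (-(R / 2)) ≤ Real.sqrt (r n).b := exp_le_sqrt hb (by linarith)
    have hhalf : Real.exp (-R) ≤ Real.exp (-(R / 2)) := Real.exp_le_exp.2 (by linarith)
    have hAB : Real.exp (-R) ≤ Real.sqrt ((r n).a * (r n).b) := by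
      rw [Real.sqrt_mul ha.le]
      calc _ = Real.exp (-(R / 2)) * Real.exp (-(R / 2)) := by rw [← Real.exp_add]; congr 1; ring
        _ ≤ _ := by gcongr
    have key : ∀ {x c : ℝ}, Real.exp (-R) ≤ c → |x| / c ≤ |x| * Real.exp R := by
      intro x c hc
      have hc0 : 0 < c := (Real.exp_pos _).trans_le hc
      rw [div_le_iff₀ hc0, mul_assoc]
      refine le_mul_of_one_le_right (abs_nonneg _) ?_
      calc 1 = Real.exp R * Real.exp (-R) := by rw [← Real.exp_add]; simp
        _ ≤ _ := by gcongr
    have k1 := key (x := (r n).X) (hhalf.trans hA)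
    have k2 := key (x := (r n).Y) (hhalf.trans hB)
    have k3 := key (x := (r n).S) hAB
    rw [div_le_iff₀ (Real.exp_pos _)]
    unfold Par.size
    linarith
  have h1 := tendsto_inner_translation hX φ' ψ
  set τ : ℕ → Par := fun n => ⟨(r n).X, (r n).Y, (r n).S, 1, 1, one_pos, one_pos⟩
  have hr : ∀ n, (r n).isom φ = (τ n).isom ((d n).isom φ) := by
    intro n
    have e : (τ n).mul (d n) = r n := by
      ext <;> simp [Par.mul, τ, d]
    rw [Par.isom_isom, e]
  have h2 : Tendsto (fun n => inner ℂ ψ ((τ n).isom ((d n).isom φ - φ'))) ω (𝓝 0) := by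
    have h3 := (tendsto_iff_norm_sub_tendsto_zero.1 hφ').const_mul ‖ψ‖
    rw [mul_zero] at h3
    refine squeeze_zero_norm (fun n => ?_) h3
    refine (norm_inner_le_norm _ _).trans (le_of_eq ?_)
    rw [LinearIsometry.norm_map]
  have h4 := h2.add h1
  rw [add_zero] at h4
  refine h4.congr fun n => ?_
  rw [← inner_add_right, ← map_add, sub_add_cancel, hr]

/-- The unitary group generated by translations in space and time and dilations. -/
noncomputable def symmetries : Dislocations Freq Par where
  D := Par.op
  sep p q := (q.inv.mul p).size
  tendsto_inner ω p q h φ ψ := by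
    have h1 := (Complex.continuous_conj.tendsto _).comp (tendsto_inner_of_size ω h φ ψ)
    rw [map_zero] at h1
    refine h1.congr fun n => ?_
    rw [Function.comp_apply, inner_conj_symm, ← Par.op_symm_op]
    exact (LinearIsometryEquiv.inner_map_eq_flip (q n).op.symm _ _)
  exists_tendsto ω p q h ψ := by
    simpa only [Par.op_symm_op] using exists_tendsto_isom ω h ψ
  exists_sep s R := by
    -- A far translation in x alone is separated from any finite list of parameters.
    have h : ∀ᶠ x : ℝ in atTop, ∀ q ∈ {q | q ∈ s},
        R ≤ (q.inv.mul ⟨x, 0, 0, 1, 1, one_pos, one_pos⟩).size := by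
      refine (eventually_all_finite s.finite_toSet).2 fun q _ => ?_
      have ha := q.a_pos
      filter_upwards [eventually_ge_atTop (q.X + |R| * (q.a * Real.sqrt q.a⁻¹))] with x hx
      have h1 : |R| ≤ |(q.inv.mul ⟨x, 0, 0, 1, 1, one_pos, one_pos⟩).X| /
          Real.sqrt (q.inv.mul ⟨x, 0, 0, 1, 1, one_pos, one_pos⟩).a := by
        simp only [Par.mul, Par.inv, one_mul]
        rw [le_div_iff₀ (Real.sqrt_pos.2 (inv_pos.2 ha))]
        refine le_trans ?_ (le_abs_self _)
        have h2 : -(q.X / q.a) + q.a⁻¹ * x = (x - q.X) / q.a := by field_simp; ring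
        rw [h2, le_div_iff₀ ha]
        linarith
      refine (le_abs_self R).trans (h1.trans ?_)
      unfold Par.size
      have p1 := abs_nonneg (Real.log (q.inv.mul ⟨x, 0, 0, 1, 1, one_pos, one_pos⟩).a)
      have p2 := abs_nonneg (Real.log (q.inv.mul ⟨x, 0, 0, 1, 1, one_pos, one_pos⟩).b)
      have p3 : 0 ≤ |(q.inv.mul ⟨x, 0, 0, 1, 1, one_pos, one_pos⟩).Y| /
        Real.sqrt (q.inv.mul ⟨x, 0, 0, 1, 1, one_pos, one_pos⟩).b := by positivity
      have p4 : 0 ≤ |(q.inv.mul ⟨x, 0, 0, 1, 1, one_pos, one_pos⟩).S| /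
        Real.sqrt ((q.inv.mul ⟨x, 0, 0, 1, 1, one_pos, one_pos⟩).a
          * (q.inv.mul ⟨x, 0, 0, 1, 1, one_pos, one_pos⟩).b) := by positivity
      linarith
    obtain ⟨x, hx⟩ := h.exists
    exact ⟨_, hx⟩

end DislocationGroup

/-! ### Integrability of the inverse symbol -/

section Weight

theorem lintegral_weight_ne_top :
    ∫⁻ x : ℝ, ENNReal.ofReal (((1 + |x|) ^ 2)⁻¹ * |x| ^ (-(1 / 2) : ℝ)) ≠ ⊤ := by
  have h1 : ∫⁻ x : ℝ, ENNReal.ofReal (((1 + |x|) ^ 2)⁻¹) ≠ ⊤ := by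
    have h := integrable_one_add_norm (E := ℝ) (μ := volume) (r := 2) (by simp)
    have h2 := h.lintegral_lt_top.ne
    refine ne_of_eq_of_ne (lintegral_congr fun x => ?_) h2
    rw [Real.rpow_neg (by positivity), Real.norm_eq_abs, Real.rpow_two]
  have h2 := lintegral_abs_rpow 1 zero_le_one
  refine ne_top_of_le_ne_top (b := ENNReal.ofReal (4 * 1 ^ (1 / 2 : ℝ))
    + ∫⁻ x : ℝ, ENNReal.ofReal (((1 + |x|) ^ 2)⁻¹)) (ENNReal.add_ne_top.2 ⟨by simp, h1⟩) ?_
  rw [← h2, ← lintegral_indicator measurableSet_Icc, ← lintegral_add_right]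
  · refine lintegral_mono fun x => ?_
    by_cases hx : x ∈ Set.Icc (-1 : ℝ) 1
    · rw [Set.indicator_of_mem hx]
      refine le_add_right (ENNReal.ofReal_le_ofReal ?_)
      refine mul_le_of_le_one_left (by positivity) (inv_le_one_of_one_le₀ ?_)
      nlinarith [abs_nonneg x]
    · rw [Set.indicator_of_notMem hx, zero_add]
      refine ENNReal.ofReal_le_ofReal (mul_le_of_le_one_right (by positivity) ?_)
      rw [Set.mem_Icc, ← abs_le, not_le] at hx
      exact Real.rpow_le_one_of_one_le_of_nonpos hx.le (by norm_num)
  · fun_prop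

/-- As (1 + ‖ξ‖)⁴ dominates (1 + |ξ₀|)²(1 + |ξ₁|)², the squared weight is at most a product of
one-variable weights, with singularity |x|^(-1/2) at 0 and quadratic decay. Hence F / `symbol` is
tempered for every F in L². -/
theorem memLp_weight :
    MemLp (fun ξ : Plane => (((1 + ‖ξ‖) ^ 2 * symbol ξ)⁻¹ : ℝ)) 2 volume := by
  have hs := measurable_symbol
  refine ⟨Measurable.aestronglyMeasurable (by fun_prop), ?_⟩
  rw [eLpNorm_lt_top_iff_lintegral_rpow_enorm_lt_top (by norm_num) (by norm_num)]
  set ρ : ℝ → ℝ≥0∞ := fun x => ENNReal.ofReal (((1 + |x|) ^ 2)⁻¹ * |x| ^ (-(1 / 2) : ℝ))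
  have hρ : Measurable ρ := by fun_prop
  have hle : ∀ ξ : Plane, ‖((1 + ‖ξ‖) ^ 2 * symbol ξ)⁻¹‖ₑ ^ ENNReal.toReal 2 ≤ ρ (ξ 0) * ρ (ξ 1) := by
    intro ξ
    have h0 : |ξ 0| ≤ ‖ξ‖ := PiLp.norm_apply_le ξ 0
    have h1 : |ξ 1| ≤ ‖ξ‖ := PiLp.norm_apply_le ξ 1
    have hr : ∀ x : ℝ, (|2 * Real.pi * x| ^ (1 / 2 : ℝ))⁻¹ ≤ |x| ^ (-(1 / 2) : ℝ) := by
      intro x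
      rw [abs_mul, abs_of_pos Real.two_pi_pos, Real.mul_rpow Real.two_pi_pos.le (abs_nonneg _),
        mul_inv, Real.rpow_neg (abs_nonneg _)]
      refine mul_le_of_le_one_left (by positivity) (inv_le_one_of_one_le₀ ?_)
      exact Real.one_le_rpow (by nlinarith [Real.pi_gt_three]) (by norm_num)
    rw [ENNReal.toReal_ofNat, ENNReal.rpow_ofNat, Real.enorm_of_nonneg (by
      have := symbol_nonneg ξ
      positivity), ← ENNReal.ofReal_pow (by
      have := symbol_nonneg ξ
      positivity), ← ENNReal.ofReal_mul (by positivity)]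
    refine ENNReal.ofReal_le_ofReal ?_
    rw [inv_pow, mul_pow, symbol_sq, mul_inv, mul_inv]
    have e : ((1 + ‖ξ‖) ^ 2) ^ 2 = (1 + ‖ξ‖) ^ 2 * (1 + ‖ξ‖) ^ 2 := sq _
    rw [e, mul_inv]
    calc _ ≤ (((1 + |ξ 0|) ^ 2)⁻¹ * ((1 + |ξ 1|) ^ 2)⁻¹)
          * (|ξ 0| ^ (-(1 / 2) : ℝ) * |ξ 1| ^ (-(1 / 2) : ℝ)) := by
          gcongr
          · exact hr _
          · exact hr _
      _ = _ := by ring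
  refine (lintegral_mono hle).trans_lt ?_
  have hm : Measurable fun ξ : Plane => ρ (ξ 0) * ρ (ξ 1) :=
    (hρ.comp (by fun_prop)).mul (hρ.comp (by fun_prop))
  rw [lintegral_plane hm]
  simp only [Matrix.cons_val_zero, Matrix.cons_val_one]
  simp_rw [lintegral_const_mul _ hρ]
  rw [lintegral_mul_const _ hρ]
  exact ENNReal.mul_lt_top lintegral_weight_ne_top.lt_top lintegral_weight_ne_top.lt_top

theorem ae_coord_ne_zero (i : Fin 2) : ∀ᵐ ξ : Plane, ξ i ≠ 0 := by
  have h : MeasurableSet {ξ : Plane | ξ i = 0} :=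
    (measurableSet_singleton (0 : ℝ)).preimage (f := fun ξ : Plane => ξ i) (by fun_prop)
  rw [ae_iff]
  simp only [not_not]
  rw [← lintegral_indicator_one h, lintegral_coordMk i (measurable_one.indicator h)]
  have : ∀ a : ℝ, ∫⁻ b, Set.indicator {ξ : Plane | ξ i = 0} 1 (coordMk i a b)
      = ({0} : Set ℝ).indicator (fun _ => ∫⁻ _ : ℝ, 1) a := by
    intro a
    by_cases ha : a = 0
    · rw [Set.indicator_of_mem (by simpa using ha)]
      refine lintegral_congr fun b => ?_
      rw [Set.indicator_of_mem]
      · rfl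
      · change coordMk i a b i = 0
        rw [coordMk_self, ha]
    · rw [Set.indicator_of_notMem (by simpa using ha), ← lintegral_zero (μ := (volume : Measure ℝ))]
      refine lintegral_congr fun b => Set.indicator_of_notMem (fun hc => ha ?_) _
      change coordMk i a b i = 0 at hc
      rwa [coordMk_self] at hc
  simp only [this]
  rw [lintegral_indicator (measurableSet_singleton _)]
  simp

theorem ae_symbol_ne_zero : ∀ᵐ ξ : Plane, symbol ξ ≠ 0 := by
  filter_upwards [ae_coord_ne_zero 0, ae_coord_ne_zero 1] with ξ h0 h1
  unfold symbol
  have : ∀ x : ℝ, x ≠ 0 → |2 * Real.pi * x| ^ (1 / 4 : ℝ) ≠ 0 := fun x hx =>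
    (Real.rpow_pos_of_pos (abs_pos.2 (mul_ne_zero Real.two_pi_pos.ne' hx)) _).ne'
  exact mul_ne_zero (this _ h0) (this _ h1)

end Weight

/-! ### Identification of the energy space with L² -/

section Distributions

theorem schwartz_smul_eq (φ : 𝓢(Plane, ℂ)) (F : Plane → ℂ) (ξ : Plane) :
    φ ξ • (F ξ / (symbol ξ : ℂ))
      = (((1 + ‖ξ‖ : ℝ) : ℂ) ^ 2 * φ ξ) * (F ξ * (((1 + ‖ξ‖) ^ 2 * symbol ξ)⁻¹ : ℝ)) := by
  have : ((1 + ‖ξ‖ : ℝ) : ℂ) ≠ 0 := by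
    have : (0 : ℝ) < 1 + ‖ξ‖ := by positivity
    exact_mod_cast this.ne'
  rw [Complex.ofReal_inv, Complex.ofReal_mul, Complex.ofReal_pow, mul_inv, smul_eq_mul,
    div_eq_mul_inv]
  field_simp

theorem schwartz_weight_le (φ : 𝓢(Plane, ℂ)) (ξ : Plane) :
    ‖((1 + ‖ξ‖ : ℝ) : ℂ) ^ 2 * φ ξ‖
      ≤ 2 ^ 2 * ((Finset.Iic (2, 0)).sup fun m => SchwartzMap.seminorm ℂ m.1 m.2) φ := by
  have := SchwartzMap.one_add_le_sup_seminorm_apply (𝕜 := ℂ) (m := (2, 0)) (k := 2) (n := 0)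
    le_rfl le_rfl φ ξ
  rw [norm_iteratedFDeriv_zero] at this
  rw [norm_mul, norm_pow, Complex.norm_real, Real.norm_of_nonneg (by positivity)]
  exact this

theorem integrable_mul_weight {F : Plane → ℂ} (hF : MemLp F 2) :
    Integrable fun ξ : Plane => F ξ * (((1 + ‖ξ‖) ^ 2 * symbol ξ)⁻¹ : ℝ) := by
  have h1 : MemLp (fun ξ : Plane => ((((1 + ‖ξ‖) ^ 2 * symbol ξ)⁻¹ : ℝ) : ℂ)) 2 volume :=
    memLp_weight.ofReal
  exact hF.integrable_mul h1

theorem integrable_schwartz_smul {F : Plane → ℂ} (hF : MemLp F 2) (φ : 𝓢(Plane, ℂ)) :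
    Integrable fun ξ => φ ξ • (F ξ / (symbol ξ : ℂ)) := by
  simp only [schwartz_smul_eq]
  have hφ := φ.continuous
  exact (integrable_mul_weight hF).bdd_mul (Continuous.aestronglyMeasurable (by fun_prop))
    (Eventually.of_forall (schwartz_weight_le φ))

/-- The distribution given by the function `F / symbol`. -/
noncomputable def weighted (F : Freq) : 𝓢'(Plane, ℂ) :=
  ContinuousLinearMap.toPointwiseConvergenceCLM _ _ _ _ <|
    SchwartzMap.mkCLMtoNormedSpace (𝕜 := ℂ) (σ := RingHom.id ℂ)
      (fun φ : 𝓢(Plane, ℂ) => ∫ ξ, φ ξ • (F ξ / (symbol ξ : ℂ)))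
      (fun φ ψ => by
        rw [← integral_add (integrable_schwartz_smul (Lp.memLp F) φ)
          (integrable_schwartz_smul (Lp.memLp F) ψ)]
        simp only [add_apply, add_smul])
      (fun a φ => by
        rw [RingHom.id_apply, ← integral_smul]
        simp only [smul_apply, smul_assoc])
      (by
        refine ⟨Finset.Iic (2, 0), 2 ^ 2 * ∫ ξ : Plane, ‖F ξ * (((1 + ‖ξ‖) ^ 2 * symbol ξ)⁻¹ : ℝ)‖,
          by positivity, fun φ => ?_⟩
        have : 2 ^ 2 * (∫ ξ : Plane, ‖F ξ * (((1 + ‖ξ‖) ^ 2 * symbol ξ)⁻¹ : ℝ)‖)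
            * ((Finset.Iic (2, 0)).sup fun m => SchwartzMap.seminorm ℂ m.1 m.2) φ
            = ∫ ξ : Plane, 2 ^ 2 * ((Finset.Iic (2, 0)).sup fun m => SchwartzMap.seminorm ℂ m.1 m.2) φ
              * ‖F ξ * (((1 + ‖ξ‖) ^ 2 * symbol ξ)⁻¹ : ℝ)‖ := by
          rw [integral_const_mul]; ring
        refine le_trans ?_ this.symm.le
        refine norm_integral_le_of_norm_le
          ((integrable_mul_weight (Lp.memLp F)).norm.const_mul _) (Eventually.of_forall fun ξ => ?_)
        rw [schwartz_smul_eq, norm_mul]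
        gcongr
        exact schwartz_weight_le φ ξ)

theorem weighted_apply (F : Freq) (φ : 𝓢(Plane, ℂ)) :
    weighted F φ = ∫ ξ, φ ξ • (F ξ / (symbol ξ : ℂ)) := rfl

theorem represents_weighted (F : Freq) :
    Represents (weighted F) fun ξ => F ξ / (symbol ξ : ℂ) :=
  fun φ => ⟨integrable_schwartz_smul (Lp.memLp F) φ, rfl⟩

/-- The element of `Ḣ^{1/2}_h` whose Fourier transform is `F / symbol`. -/
noncomputable def ofFreq (F : Freq) : 𝓢'(Plane, ℂ) := 𝓕⁻ (weighted F)

theorem fourier_ofFreq (F : Freq) : 𝓕 (ofFreq F) = weighted F := by simp [ofFreq]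

/-- Test against a smooth bump that equals 1 on the given compact set. -/
theorem Represents.locallyIntegrable {T : 𝓢'(Plane, ℂ)} {h : Plane → ℂ} (hT : Represents T h) :
    LocallyIntegrable h := by
  rw [locallyIntegrable_iff]
  intro K hK
  obtain ⟨R, hR, hR'⟩ := hK.isBounded.exists_pos_norm_le
  let χ : ContDiffBump (0 : Plane) := ⟨R, R + 1, hR, by linarith⟩
  have h1 : HasCompactSupport (fun z => ((χ z : ℝ) : ℂ)) :=
    χ.hasCompactSupport.comp_left (g := Complex.ofReal) Complex.ofReal_zero
  have h2 : ContDiff ℝ (⊤ : ℕ∞) (fun z => ((χ z : ℝ) : ℂ)) :=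
    Complex.ofRealCLM.contDiff.comp χ.contDiff
  have h3 := (hT (h1.toSchwartzMap h2)).1
  refine (h3.integrableOn (s := K)).congr_fun (fun z hz => ?_) hK.measurableSet
  have h4 : χ z = 1 := χ.one_of_mem_closedBall (by simpa using hR' z hz)
  simp [h4]

theorem Represents.ae_eq {T : 𝓢'(Plane, ℂ)} {h h' : Plane → ℂ} (hT : Represents T h)
    (hT' : Represents T h') : h =ᵐ[volume] h' := by
  have key := ae_eq_zero_of_integral_contDiff_smul_eq_zero
    (hT.locallyIntegrable.sub hT'.locallyIntegrable) (fun g hg hgs => ?_)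
  · filter_upwards [key] with z hz
    exact sub_eq_zero.1 hz
  · have h1 : HasCompactSupport (fun z => ((g z : ℝ) : ℂ)) :=
      hgs.comp_left (g := Complex.ofReal) Complex.ofReal_zero
    have h2 : ContDiff ℝ (⊤ : ℕ∞) (fun z => ((g z : ℝ) : ℂ)) := Complex.ofRealCLM.contDiff.comp hg
    obtain ⟨i1, e1⟩ := hT (h1.toSchwartzMap h2)
    obtain ⟨i2, e2⟩ := hT' (h1.toSchwartzMap h2)
    have h3 := integral_sub i1 i2
    rw [← e1, ← e2, sub_self] at h3
    rw [← h3]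
    congr 1
    ext z
    simp [mul_sub]

/-- Makes the choice in `fracDeriv` canonical: the function representing a distribution is unique
almost everywhere. -/
theorem IsFracDeriv.eq {f : 𝓢'(Plane, ℂ)} {v v' : Freq} (h : IsFracDeriv f v)
    (h' : IsFracDeriv f v') : v = v' := by
  obtain ⟨k, hk, hv⟩ := h
  obtain ⟨k', hk', hv'⟩ := h'
  have h1 : (𝓕 v : Freq) = 𝓕 v' := by
    refine Lp.ext ?_
    filter_upwards [hv, hv', hk.ae_eq hk'] with ξ e1 e2 e3
    rw [e1, e2, e3]
  rw [← fourierInv_fourier_eq (F := Freq) v, h1, fourierInv_fourier_eq]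

theorem isFracDeriv_ofFreq (F : Freq) : IsFracDeriv (ofFreq F) (𝓕⁻ F) := by
  refine ⟨fun ξ => F ξ / (symbol ξ : ℂ), ?_, ?_⟩
  · rw [fourier_ofFreq]
    exact represents_weighted F
  · rw [fourier_fourierInv_eq]
    filter_upwards [ae_symbol_ne_zero] with ξ hξ
    rw [mul_div_cancel₀]
    exact_mod_cast hξ

theorem memHh_ofFreq (F : Freq) : MemHh (ofFreq F) := ⟨_, isFracDeriv_ofFreq F⟩

theorem fracDeriv_ofFreq (F : Freq) : fracDeriv (ofFreq F) = 𝓕⁻ F := by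
  rw [fracDeriv, dif_pos (memHh_ofFreq F)]
  exact (memHh_ofFreq F).choose_spec.eq (isFracDeriv_ofFreq F)

theorem hhInner_ofFreq (F G : Freq) : hhInner (ofFreq F) (ofFreq G) = inner ℂ F G := by
  rw [hhInner, fracDeriv_ofFreq, fracDeriv_ofFreq, ← Lp.inner_fourier_eq, fourier_fourierInv_eq,
    fourier_fourierInv_eq]

theorem hhNorm_ofFreq (F : Freq) : hhNorm (ofFreq F) = ‖F‖ := by
  rw [hhNorm, fracDeriv_ofFreq, ← Lp.norm_fourier_eq, fourier_fourierInv_eq]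

/-- Surjectivity of the isometry: since the symbol vanishes only on a null set, 𝓕 f is recovered
from `symbol` · 𝓕 f by division. -/
theorem MemHh.exists_ofFreq {f : 𝓢'(Plane, ℂ)} (hf : MemHh f) : ∃ F : Freq, f = ofFreq F := by
  obtain ⟨v, h, hh, hv⟩ := hf
  refine ⟨𝓕 v, ?_⟩
  have : 𝓕 f = weighted (𝓕 v) := by
    ext φ
    rw [(hh φ).2, weighted_apply]
    refine integral_congr_ae ?_
    filter_upwards [hv, ae_symbol_ne_zero] with ξ h1 h2
    rw [h1, mul_div_cancel_left₀]
    exact_mod_cast h2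
  rw [ofFreq, ← this, fourierInv_fourier_eq]

theorem ofFreq_add (F G : Freq) : ofFreq (F + G) = ofFreq F + ofFreq G := by
  have : weighted (F + G) = weighted F + weighted G := by
    ext φ
    change weighted (F + G) φ = weighted F φ + weighted G φ
    rw [weighted_apply, weighted_apply, weighted_apply,
      ← integral_add (integrable_schwartz_smul (Lp.memLp F) φ)
        (integrable_schwartz_smul (Lp.memLp G) φ)]
    refine integral_congr_ae ?_
    filter_upwards [Lp.coeFn_add F G] with ξ h
    rw [h, Pi.add_apply, add_div, smul_add]
  rw [ofFreq, this, FourierTransform.fourierInv_add]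
  rfl

theorem ofFreq_zero : ofFreq 0 = 0 := by
  have := ofFreq_add 0 0
  rw [add_zero] at this
  exact left_eq_add.1 this

theorem ofFreq_sum {ι : Type*} (s : Finset ι) (F : ι → Freq) :
    ofFreq (∑ i ∈ s, F i) = ∑ i ∈ s, ofFreq (F i) := by
  classical
  induction s using Finset.induction_on with
  | empty => simp [ofFreq_zero]
  | insert i s hi ih => rw [Finset.sum_insert hi, Finset.sum_insert hi, ofFreq_add, ih]

end Distributions

/-! ### Symmetries of distributions on the Fourier side -/

section Symmetries

theorem propagator_ofFreq (t : ℝ) (F : Freq) :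
    propagator t (ofFreq F) = ofFreq ((⟨0, 0, t, 1, 1, one_pos, one_pos⟩ : Par).isom F) := by
  rw [propagator, TemperedDistribution.fourierMultiplierCLM_apply, fourier_ofFreq, ofFreq]
  congr 1
  ext φ
  rw [TemperedDistribution.smulLeftCLM_apply_apply, weighted_apply, weighted_apply]
  refine integral_congr_ae ?_
  filter_upwards [Par.coeFn_isom ⟨0, 0, t, 1, 1, one_pos, one_pos⟩ F] with ξ hξ
  rw [hξ, SchwartzMap.smulLeftCLM_apply_apply (propagator_symbol_hasTemperateGrowth t)]
  simp only [Par.fn, Par.phase, scale_one_one, mul_one, Real.sqrt_one, smul_eq_mul, zero_mul,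
    add_zero, mul_zero, zero_add, Complex.ofReal_one, one_mul]
  ring

theorem affineMap_eq (a b c d : ℝ) (z : Plane) :
    affineMap a b c d z = scale a b z + !₂[c, d] :=
  plane_ext (by simp [affineMap]) (by simp [affineMap])

theorem inner_plane (z w : Plane) : (inner ℝ z w : ℝ) = z 0 * w 0 + z 1 * w 1 := by
  simp [PiLp.inner_apply, Fin.sum_univ_two, mul_comm]

theorem fourierInv_compAffine {a b : ℝ} (ha : 0 < a) (hb : 0 < b) (c d : ℝ) (φ : 𝓢(Plane, ℂ))
    (η : Plane) :
    (𝓕⁻ (compAffine ha hb c d φ)) (scale a b η) = (((a * b)⁻¹ : ℝ) : ℂ)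
      * Complex.exp (((-(2 * Real.pi * (c * η 0 + d * η 1)) : ℝ) : ℂ) * Complex.I)
      * (𝓕⁻ φ) η := by
  rw [SchwartzMap.fourierInv_coe, SchwartzMap.fourierInv_coe, Real.fourierInv_eq',
    Real.fourierInv_eq']
  have h1 : ∀ z : Plane, Complex.exp (((2 * Real.pi * inner ℝ z (scale a b η) : ℝ) : ℂ) * Complex.I)
      • compAffine ha hb c d φ z = (fun w => Complex.exp (((2 * Real.pi
        * inner ℝ w η : ℝ) : ℂ) * Complex.I) • φ (w + !₂[c, d])) (scale a b z) := by
    intro z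
    have e : compAffine ha hb c d φ z = φ (affineMap a b c d z) := rfl
    rw [e, affineMap_eq]
    simp only [inner_plane, scale_zero, scale_one]
    congr 5
    ring
  refine ((integral_congr_ae (Eventually.of_forall h1)).trans (integral_scale ha hb
    fun w => Complex.exp (((2 * Real.pi * inner ℝ w η : ℝ) : ℂ) * Complex.I)
      • φ (w + !₂[c, d]))).trans ?_
  have h2 : ∫ w : Plane, Complex.exp (((2 * Real.pi * inner ℝ w η : ℝ) : ℂ) * Complex.I)
      • φ (w + !₂[c, d]) = ∫ w : Plane, Complex.exp (((2 * Real.pi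
        * inner ℝ (w - !₂[c, d]) η : ℝ) : ℂ) * Complex.I) • φ w := by
    rw [← integral_add_right_eq_self (fun w : Plane => Complex.exp (((2 * Real.pi
      * inner ℝ (w - !₂[c, d]) η : ℝ) : ℂ) * Complex.I) • φ w) (!₂[c, d] : Plane)]
    simp only [add_sub_cancel_right]
  rw [h2, mul_assoc, ← integral_const_mul (Complex.exp _)]
  congr 2
  ext w
  rw [smul_eq_mul, smul_eq_mul, ← mul_assoc, ← Complex.exp_add]
  congr 2
  simp only [inner_plane]
  simp
  ring

theorem symbol_scale {a b : ℝ} (ha : 0 < a) (hb : 0 < b) (ξ : Plane) :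
    symbol (scale a b ξ) = (a * b) ^ (1 / 4 : ℝ) * symbol ξ := by
  have h : ∀ {c : ℝ}, 0 < c → ∀ x : ℝ, |2 * Real.pi * (c * x)| ^ (1 / 4 : ℝ)
      = c ^ (1 / 4 : ℝ) * |2 * Real.pi * x| ^ (1 / 4 : ℝ) := by
    intro c hc x
    rw [← mul_assoc, mul_comm _ c, mul_assoc, abs_mul, abs_of_pos hc,
      Real.mul_rpow hc.le (abs_nonneg _)]
  rw [symbol, symbol, scale_zero, scale_one, h ha, h hb, Real.mul_rpow ha.le hb.le]
  ring

/-- The part of a symmetry that acts in space. -/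
def Sym.toPar (g : Sym) : Par := ⟨g.x₀, g.y₀, 0, g.lam₁, g.lam₂, g.lam₁_pos, g.lam₂_pos⟩

theorem act_apply (g : Sym) (f : 𝓢'(Plane, ℂ)) (φ : 𝓢(Plane, ℂ)) :
    g.act f φ = (((g.lam₁ * g.lam₂) ^ (-(1 / 4) : ℝ) * (g.lam₁ * g.lam₂) : ℝ) : ℂ)
      * f (compAffine g.lam₁_pos g.lam₂_pos g.x₀ g.y₀ φ) := rfl

theorem actInv_apply (g : Sym) (f : 𝓢'(Plane, ℂ)) (φ : 𝓢(Plane, ℂ)) :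
    g.actInv f φ = (((g.lam₁ * g.lam₂) ^ (1 / 4 : ℝ) * (g.lam₁ * g.lam₂)⁻¹ : ℝ) : ℂ)
      * f (compAffine (inv_pos.2 g.lam₁_pos) (inv_pos.2 g.lam₂_pos)
        (-(g.x₀ / g.lam₁)) (-(g.y₀ / g.lam₂)) φ) := rfl

theorem act_ofFreq (g : Sym) (F : Freq) : g.act (ofFreq F) = ofFreq (g.toPar.isom F) := by
  have ha := g.lam₁_pos
  have hb := g.lam₂_pos
  have hab : 0 < g.lam₁ * g.lam₂ := mul_pos ha hb
  ext φ
  rw [act_apply, ofFreq, ofFreq, TemperedDistribution.fourierInv_apply,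
    TemperedDistribution.fourierInv_apply, weighted_apply, weighted_apply]
  set ψ := 𝓕⁻ (compAffine g.lam₁_pos g.lam₂_pos g.x₀ g.y₀ φ)
  have h1 := integral_scale ha hb (fun ξ => ψ ξ • (F ξ / (symbol ξ : ℂ)))
  have h2 : ∫ ξ, ψ ξ • (F ξ / (symbol ξ : ℂ)) = ((g.lam₁ * g.lam₂ : ℝ) : ℂ)
      * ∫ ξ, ψ (scale g.lam₁ g.lam₂ ξ) • (F (scale g.lam₁ g.lam₂ ξ)
        / (symbol (scale g.lam₁ g.lam₂ ξ) : ℂ)) := by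
    rw [h1, ← mul_assoc, ← Complex.ofReal_mul, mul_inv_cancel₀ hab.ne', Complex.ofReal_one, one_mul]
  rw [h2, ← mul_assoc, ← integral_const_mul]
  refine integral_congr_ae ?_
  filter_upwards [g.toPar.coeFn_isom F] with ξ hξ
  rw [hξ]
  simp only [ψ]
  rw [fourierInv_compAffine, symbol_scale ha hb]
  simp only [Par.fn, Par.phase, Sym.toPar, smul_eq_mul, mul_zero, zero_mul, add_zero]
  -- With λ = λ₁λ₂: λ^(-1/4) · λ from the definition of g, λ from the substitution, λ⁻¹ from the
  -- Fourier transform of the dilated test function, λ^(-1/4) from homogeneity of the symbol. The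
  -- total is √λ, the L² normalisation.
  have h3 : ((g.lam₁ * g.lam₂) ^ (-(1 / 4) : ℝ) * (g.lam₁ * g.lam₂)) * (g.lam₁ * g.lam₂)
      * (g.lam₁ * g.lam₂)⁻¹ * ((g.lam₁ * g.lam₂) ^ (1 / 4 : ℝ))⁻¹ = Real.sqrt (g.lam₁ * g.lam₂) := by
    rw [mul_assoc _ _ (g.lam₁ * g.lam₂)⁻¹, mul_inv_cancel₀ hab.ne', mul_one,
      ← Real.rpow_neg hab.le, Real.sqrt_eq_rpow]
    nth_rewrite 2 [← Real.rpow_one (g.lam₁ * g.lam₂)]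
    rw [← Real.rpow_add hab, ← Real.rpow_add hab]
    norm_num
  rw [← h3]
  push_cast
  rw [div_eq_mul_inv, div_eq_mul_inv, mul_inv]
  ring

theorem compAffine_compAffine {a b : ℝ} (ha : 0 < a) (hb : 0 < b) (c d : ℝ)
    (φ : 𝓢(Plane, ℂ)) :
    compAffine ha hb c d (compAffine (inv_pos.2 ha) (inv_pos.2 hb) (-(c / a)) (-(d / b)) φ) = φ := by
  ext z
  change φ (affineMap a⁻¹ b⁻¹ (-(c / a)) (-(d / b)) (affineMap a b c d z)) = φ z
  congr 1
  refine plane_ext ?_ ?_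
  · simp only [affineMap, Matrix.cons_val_zero, Matrix.cons_val_one]
    field_simp
    ring
  · simp only [affineMap, Matrix.cons_val_zero, Matrix.cons_val_one]
    field_simp
    ring

theorem actInv_act (g : Sym) (f : 𝓢'(Plane, ℂ)) : g.actInv (g.act f) = f := by
  have hab : 0 < g.lam₁ * g.lam₂ := mul_pos g.lam₁_pos g.lam₂_pos
  ext φ
  rw [actInv_apply, act_apply, compAffine_compAffine, ← mul_assoc, ← Complex.ofReal_mul]
  have : (g.lam₁ * g.lam₂) ^ (1 / 4 : ℝ) * (g.lam₁ * g.lam₂)⁻¹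
      * ((g.lam₁ * g.lam₂) ^ (-(1 / 4) : ℝ) * (g.lam₁ * g.lam₂)) = 1 := by
    rw [Real.rpow_neg hab.le]
    have := (Real.rpow_pos_of_pos hab (1 / 4)).ne'
    have := hab.ne'
    field_simp
    exact div_self this
  rw [this, Complex.ofReal_one, one_mul]

theorem actInv_ofFreq (g : Sym) (F : Freq) :
    g.actInv (ofFreq F) = ofFreq (g.toPar.inv.isom F) := by
  have h : ofFreq F = g.act (ofFreq (g.toPar.inv.isom F)) := by
    rw [act_ofFreq, Par.isom_isom, Par.mul_inv, Par.isom_one]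
  rw [h, actInv_act]

/-- The symmetry in space-time with parameters `g` and `t`. -/
def Sym.withTime (g : Sym) (t : ℝ) : Par :=
  ⟨g.x₀, g.y₀, t * (g.lam₁ * g.lam₂), g.lam₁, g.lam₂, g.lam₁_pos, g.lam₂_pos⟩

/-- The dilation acts after the propagator and rescales its time by λ₁λ₂, hence the factor in
`Sym.withTime` and in the time term of `separation`. -/
theorem act_propagator_ofFreq (g : Sym) (t : ℝ) (F : Freq) :
    g.act (propagator t (ofFreq F)) = ofFreq ((g.withTime t).op F) := by
  rw [propagator_ofFreq, act_ofFreq, Par.isom_isom, Par.op_apply]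
  have h : g.toPar.mul ⟨0, 0, t, 1, 1, one_pos, one_pos⟩ = g.withTime t := by
    ext <;> simp [Par.mul, Sym.toPar, Sym.withTime, mul_comm]
  rw [h]

theorem propagator_actInv_ofFreq (g : Sym) (t : ℝ) (F : Freq) :
    propagator (-t) (g.actInv (ofFreq F)) = ofFreq ((g.withTime t).op.symm F) := by
  have ha := g.lam₁_pos.ne'
  have hb := g.lam₂_pos.ne'
  rw [actInv_ofFreq, propagator_ofFreq, Par.isom_isom, Par.op_symm_apply]
  have h : (⟨0, 0, -t, 1, 1, one_pos, one_pos⟩ : Par).mul g.toPar.inv = (g.withTime t).inv := by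
    ext <;> simp only [Par.mul, Par.inv, Sym.toPar, Sym.withTime] <;> field_simp <;> ring
  rw [h]

/-- Each translation term is |x - x'|/√(l l') = |(x - x')/l'| / √(l/l'), with l equal to λ₁, λ₂ and
λ₁λ₂ in turn. -/
theorem separation_eq (g g' : Sym) (t t' : ℝ) :
    separation g t g' t' = ((g'.withTime t').inv.mul (g.withTime t)).size := by
  have ha := g.lam₁_pos
  have hb := g.lam₂_pos
  have ha' := g'.lam₁_pos
  have hb' := g'.lam₂_pos
  have key : ∀ {x x' l l' : ℝ}, 0 < l → 0 < l' →
      |x - x'| / (l * l') ^ (1 / 2 : ℝ) = |-(x' / l') + l'⁻¹ * x| / Real.sqrt (l * l'⁻¹) := by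
    intro x x' l l' hl hl'
    have e : -(x' / l') + l'⁻¹ * x = (x - x') / l' := by field_simp; ring
    rw [e, abs_div, abs_of_pos hl', ← Real.sqrt_eq_rpow, div_div]
    congr 1
    rw [← Real.sqrt_sq hl'.le, ← Real.sqrt_mul (by positivity), Real.sqrt_sq hl'.le]
    congr 1
    field_simp
  unfold separation Par.size
  simp only [Par.mul, Par.inv, Sym.withTime, ← div_eq_mul_inv]
  rw [key ha ha', key hb hb']
  have k3 := key (x := t * (g.lam₁ * g.lam₂)) (x' := t' * (g'.lam₁ * g'.lam₂)) (mul_pos ha hb)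
    (mul_pos ha' hb')
  have e1 : g.lam₁ * g.lam₂ * g'.lam₁ * g'.lam₂ = g.lam₁ * g.lam₂ * (g'.lam₁ * g'.lam₂) := by ring
  rw [e1, k3]
  have e2 : g.lam₁ * g.lam₂ * (g'.lam₁ * g'.lam₂)⁻¹ = g.lam₁ / g'.lam₁ * (g.lam₂ / g'.lam₂) := by
    field_simp
  have e3 : (g'.lam₁ * g'.lam₂)⁻¹ = g'.lam₁⁻¹ * g'.lam₂⁻¹ := by field_simp
  rw [e2, e3]
  rfl

theorem separation_comm (g g' : Sym) (t t' : ℝ) :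
    separation g t g' t' = separation g' t' g t := by
  unfold separation
  have e1 : ∀ x y : ℝ, |Real.log (x / y)| = |Real.log (y / x)| := fun x y => by
    rw [← abs_neg, ← Real.log_inv, inv_div]
  rw [e1 g.lam₁, e1 g.lam₂, abs_sub_comm g.x₀, abs_sub_comm g.y₀, mul_comm g.lam₁ g'.lam₁,
    mul_comm g.lam₂ g'.lam₂, abs_sub_comm (t * _)]
  congr 3
  ring

end Symmetries

/-! ### The inverse Strichartz inequality -/

section Strichartz

theorem inner_lift (q : ℝ × Plane) (ξ : Plane) :
    2 * Real.pi * inner ℝ (WithLp.toLp 2 q : SpaceTime) (lift ξ)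
      = 2 * Real.pi * (q.2 0 * ξ 0 + q.2 1 * ξ 1) - 4 * Real.pi ^ 2 * q.1 * (ξ 0 * ξ 1) := by
  rw [lift, WithLp.prod_inner_apply]
  simp only [inner_plane]
  simp
  ring

theorem memLp_bump : MemLp (piece (fun _ => 1) (0, 0)) 2 volume := by
  refine ⟨aestronglyMeasurable_piece aestronglyMeasurable_const _, ?_⟩
  have h := lintegral_piece_sq_le (fun _ => 1) (0, 0)
  rw [lintegral_sq_eq] at h
  have h2 : eLpNorm (piece (fun _ => 1) (0, 0)) 2 volume ^ 2 < ⊤ := by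
    refine h.trans_lt (ENNReal.mul_lt_top ENNReal.ofReal_lt_top ?_)
    simp only [mass, enorm_one, one_pow, setLIntegral_one]
    exact (volume_box_le _).trans_lt ENNReal.ofReal_lt_top
  exact (ENNReal.pow_lt_top_iff.1 h2).resolve_right two_ne_zero

/-- The reference profile, concentrated in the dyadic box of scale one. -/
noncomputable def bump : Freq := memLp_bump.toLp _

/-- The symmetry that maps the reference profile to the box `K` and the space-time point `q`. -/
noncomputable def boxPar (K : ℤ × ℤ) (q : ℝ × Plane) : Par where
  X := q.2 0
  Y := q.2 1
  S := -q.1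
  a := 2 ^ (-K.1)
  b := 2 ^ (-K.2)
  a_pos := by positivity
  b_pos := by positivity

theorem mem_dyad_scale (k : ℤ) (x : ℝ) : 2 ^ (-k) * x ∈ dyad 0 ↔ x ∈ dyad k := by
  have hk : (0 : ℝ) < 2 ^ k := by positivity
  simp only [dyad, Set.mem_ofPred_eq, abs_mul, zpow_zero, zero_add, zpow_one]
  rw [abs_of_pos (by positivity : (0 : ℝ) < 2 ^ (-k)), zpow_neg, ← div_eq_inv_mul, le_div_iff₀ hk,
    div_lt_iff₀ hk, one_mul, zpow_add₀ two_ne_zero, zpow_one, mul_comm (2 : ℝ)]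

theorem boxPar_rpow (K : ℤ × ℤ) (q : ℝ × Plane) :
    ((boxPar K q).a * (boxPar K q).b) ^ (1 / 2 : ℝ) = (boxScale K)⁻¹ := by
  have h1 := boxScale_pos K
  have h2 : (boxPar K q).a * (boxPar K q).b = ((boxScale K)⁻¹) ^ 2 := by
    rw [inv_pow, boxScale_sq, mul_inv]
    simp only [boxPar, zpow_neg]
  rw [h2, ← Real.sqrt_eq_rpow, Real.sqrt_sq (by positivity)]

theorem fn_boxPar_bump (K : ℤ × ℤ) (q : ℝ × Plane) (ξ : Plane) :
    (boxPar K q).fn (piece (fun _ => 1) (0, 0)) ξ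
      = ((((boxPar K q).a * (boxPar K q).b) ^ (1 / 4 : ℝ) : ℝ) : ℂ)
        * ((boxPar K q).phase ξ * piece (fun _ => 1) K ξ) := by
  set p := boxPar K q
  have hab : 0 < p.a * p.b := mul_pos p.a_pos p.b_pos
  have hmem : scale p.a p.b ξ ∈ box (0, 0) ↔ ξ ∈ box K := by
    simp only [box, Set.mem_ofPred_eq, scale_zero, scale_one]
    exact and_congr (mem_dyad_scale _ _) (mem_dyad_scale _ _)
  rw [Par.fn]
  by_cases hξ : ξ ∈ box K
  · rw [piece, piece, Set.indicator_of_mem (hmem.2 hξ), Set.indicator_of_mem hξ,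
      symbol_scale p.a_pos p.b_pos]
    have h4 : Real.sqrt (p.a * p.b) = (p.a * p.b) ^ (1 / 4 : ℝ) * (p.a * p.b) ^ (1 / 4 : ℝ) := by
      rw [← Real.rpow_add hab, Real.sqrt_eq_rpow]
      norm_num
    have h5 : (((p.a * p.b) ^ (1 / 4 : ℝ) : ℝ) : ℂ) ≠ 0 := by
      exact_mod_cast (Real.rpow_pos_of_pos hab _).ne'
    rw [h4, Complex.ofReal_mul, Complex.ofReal_mul, one_div, one_div, mul_inv]
    field_simp
  · rw [piece_eq_zero hξ, piece_eq_zero fun h => hξ (hmem.1 h)]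
    ring

/-- The conjugated phase of the transported profile is the exponential of the wave at q, and its
factor 1/`symbol` turns F into the profile of the localised wave. Pointwise values of box waves are
therefore matrix coefficients. -/
theorem inner_boxPar_bump (F : Freq) (K : ℤ × ℤ) (q : ℝ × Plane) :
    inner ℂ ((boxPar K q).op bump) F
      = ((((boxPar K q).a * (boxPar K q).b) ^ (1 / 4 : ℝ) : ℝ) : ℂ) * wave (piece F K) q := by
  rw [L2.inner_def, wave, ← integral_const_mul]
  refine integral_congr_ae ?_
  filter_upwards [(boxPar K q).coeFn_isom bump, (boxPar K q).fn_congr memLp_bump.coeFn_toLp]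
    with ξ h1 h2
  rw [Par.op_apply, h1, bump, h2, fn_boxPar_bump, RCLike.inner_apply, map_mul, Complex.conj_ofReal,
    map_mul]
  have h3 : (starRingEnd ℂ) ((boxPar K q).phase ξ)
      = Complex.exp (((2 * Real.pi * inner ℝ (WithLp.toLp 2 q : SpaceTime) (lift ξ) : ℝ) : ℂ)
        * Complex.I) := by
    rw [Par.phase, ← Complex.exp_conj, map_mul, Complex.conj_ofReal, Complex.conj_I, inner_lift]
    congr 1
    simp only [boxPar]
    push_cast
    ring
  rw [h3]
  by_cases hξ : ξ ∈ box K
  · rw [piece, piece, Set.indicator_of_mem hξ, Set.indicator_of_mem hξ, map_div₀, map_one,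
      Complex.conj_ofReal]
    ring
  · rw [piece_eq_zero hξ, piece_eq_zero hξ]
    simp

theorem waveAbs_sq_eq (F : Freq) (K : ℤ × ℤ) (q : ℝ × Plane) :
    waveAbs F K q ^ 2
      = ENNReal.ofReal (boxScale K) * ‖inner ℂ ((boxPar K q).op bump) F‖ₑ ^ 2 := by
  have hs := boxScale_pos K
  set p := boxPar K q
  have hab : 0 < p.a * p.b := mul_pos p.a_pos p.b_pos
  have h1 : ((p.a * p.b) ^ (1 / 4 : ℝ)) ^ 2 = (boxScale K)⁻¹ := by
    rw [← boxPar_rpow K q, ← Real.rpow_natCast, ← Real.rpow_mul hab.le]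
    norm_num
    rfl
  have h2 : ‖(((p.a * p.b) ^ (1 / 4 : ℝ) : ℝ) : ℂ)‖ₑ = ENNReal.ofReal ((p.a * p.b) ^ (1 / 4 : ℝ)) := by
    rw [← ofReal_norm, Complex.norm_real, Real.norm_of_nonneg (by positivity)]
  rw [inner_boxPar_bump, enorm_mul, mul_pow, ← mul_assoc, h2, ← ENNReal.ofReal_pow (by positivity), h1,
    ← ENNReal.ofReal_mul hs.le, mul_inv_cancel₀ hs.ne', ENNReal.ofReal_one, one_mul]
  rfl

/-- The solution with initial data `ofFreq F`. -/
noncomputable def solution (F : Freq) (q : ℝ × Plane) : ℂ := ∑' K, wave (piece F K) q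

theorem tsum_piece (F : Plane → ℂ) {ξ : Plane} (h0 : ξ 0 ≠ 0) (h1 : ξ 1 ≠ 0) (c : ℂ) :
    ∑' K, c * piece F K ξ = c * (F ξ / (symbol ξ : ℂ)) := by
  obtain ⟨K, hK⟩ := exists_mem_box h0 h1
  rw [tsum_eq_single K]
  · rw [piece, Set.indicator_of_mem hK]
  · intro K' hne
    rw [piece_eq_zero fun h => hne (eq_of_mem_box h hK), mul_zero]

theorem tsum_enorm_piece (F : Plane → ℂ) {ξ : Plane} (h0 : ξ 0 ≠ 0) (h1 : ξ 1 ≠ 0) (c : ℂ) :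
    ∑' K, ‖c * piece F K ξ‖ₑ = ‖c * (F ξ / (symbol ξ : ℂ))‖ₑ := by
  obtain ⟨K, hK⟩ := exists_mem_box h0 h1
  rw [tsum_eq_single K]
  · rw [piece, Set.indicator_of_mem hK]
  · intro K' hne
    rw [piece_eq_zero fun h => hne (eq_of_mem_box h hK), mul_zero, enorm_zero]

theorem integral_fourierInv_mul_wave {f : Plane → ℂ} (hf : Integrable f) (φ : 𝓢(Plane, ℂ)) (t : ℝ) :
    ∫ ξ, (𝓕⁻ φ) ξ * (⟨0, 0, t, 1, 1, one_pos, one_pos⟩ : Par).phase ξ * f ξ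
      = ∫ z, φ z * wave f (t, z) := by
  set E : Plane → Plane → ℂ := fun z ξ =>
    Complex.exp (((2 * Real.pi * inner ℝ (WithLp.toLp 2 (t, z) : SpaceTime) (lift ξ) : ℝ) : ℂ)
      * Complex.I) with hE
  have hEn : ∀ z ξ, ‖E z ξ‖ = 1 := fun z ξ => Complex.norm_exp_ofReal_mul_I _
  have hEc : Continuous fun p : Plane × Plane => E p.1 p.2 := by
    simp only [hE, inner_lift]
    fun_prop
  have hInt : Integrable (Function.uncurry fun z ξ => E z ξ * (φ z * f ξ))
      ((volume : Measure Plane).prod (volume : Measure Plane)) :=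
    (φ.integrable.mul_prod hf).bdd_mul (c := 1) hEc.aestronglyMeasurable
      (Eventually.of_forall fun p => (hEn _ _).le)
  have h1 := integral_integral_swap hInt
  have h2 : ∀ z, ∫ ξ, E z ξ * (φ z * f ξ) = φ z * wave f (t, z) := by
    intro z
    rw [wave, ← integral_const_mul]
    congr 1
    ext ξ
    simp only [hE]
    ring
  have h3 : ∀ ξ, ∫ z, E z ξ * (φ z * f ξ)
      = (𝓕⁻ φ) ξ * (⟨0, 0, t, 1, 1, one_pos, one_pos⟩ : Par).phase ξ * f ξ := by
    intro ξ
    rw [SchwartzMap.fourierInv_coe, Real.fourierInv_eq', mul_assoc, ← integral_mul_const]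
    congr 1
    ext z
    have h4 : E z ξ = Complex.exp (((2 * Real.pi * inner ℝ z ξ : ℝ) : ℂ) * Complex.I)
        * (⟨0, 0, t, 1, 1, one_pos, one_pos⟩ : Par).phase ξ := by
      simp only [hE, Par.phase, inner_lift, inner_plane]
      rw [← Complex.exp_add]
      congr 1
      push_cast
      ring
    rw [h4, smul_eq_mul]
    ring
  simp only [h2, h3] at h1
  exact h1.symm

theorem propagator_ofFreq_apply (F : Freq) (t : ℝ) (φ : 𝓢(Plane, ℂ)) :
    propagator t (ofFreq F) φ = ∑' K, ∫ z, φ z * wave (piece F K) (t, z) := by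
  set p : Par := ⟨0, 0, t, 1, 1, one_pos, one_pos⟩ with hp
  have hF := Lp.memLp F
  rw [propagator_ofFreq, ofFreq, TemperedDistribution.fourierInv_apply, weighted_apply]
  have hφ := (𝓕⁻ φ).continuous
  have hph := p.measurable_phase
  have h1 : ∫ ξ, (𝓕⁻ φ) ξ • (p.isom F ξ / (symbol ξ : ℂ))
      = ∫ ξ, ∑' K, (𝓕⁻ φ) ξ * p.phase ξ * piece F K ξ := by
    refine integral_congr_ae ?_
    filter_upwards [p.coeFn_isom F, ae_coord_ne_zero 0, ae_coord_ne_zero 1] with ξ h1 h2 h3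
    rw [h1, tsum_piece _ h2 h3]
    simp only [Par.fn, hp, mul_one, Real.sqrt_one, Complex.ofReal_one, one_mul, scale_one_one,
      smul_eq_mul]
    ring
  have hm : ∀ K, AEStronglyMeasurable (fun ξ => (𝓕⁻ φ) ξ * p.phase ξ * piece F K ξ) volume :=
    fun K => (hφ.aestronglyMeasurable.mul hph.aestronglyMeasurable).mul
      (aestronglyMeasurable_piece hF.1 K)
  rw [h1, integral_tsum hm]
  · refine tsum_congr fun K => ?_
    exact integral_fourierInv_mul_wave (integrable_piece hF K) φ t
  · rw [← lintegral_tsum fun K => (hm K).enorm]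
    have h2 := (integrable_schwartz_smul hF (𝓕⁻ φ)).2
    rw [hasFiniteIntegral_iff_enorm] at h2
    refine ne_of_eq_of_ne (lintegral_congr_ae ?_) h2.ne
    filter_upwards [ae_coord_ne_zero 0, ae_coord_ne_zero 1] with ξ h2 h3
    rw [tsum_enorm_piece _ h2 h3, smul_eq_mul, enorm_mul, enorm_mul, enorm_mul,
      ← ofReal_norm (p.phase ξ), p.norm_phase, ENNReal.ofReal_one, mul_one]

theorem represents_solution {F : Freq} {t : ℝ}
    (ht : ∫⁻ z, (∑' K, waveAbs F K (t, z)) ^ 8 ≠ ⊤) :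
    Represents (propagator t (ofFreq F)) fun z => solution F (t, z) := by
  intro φ
  have hF := Lp.memLp F
  have hw : ∀ K, Continuous fun z => wave (piece F K) (t, z) := fun K =>
    (continuous_wave (integrable_piece hF K)).comp (by fun_prop)
  have hm : ∀ K, AEStronglyMeasurable (fun z => φ z * wave (piece F K) (t, z)) volume := fun K =>
    (φ.continuous.mul (hw K)).aestronglyMeasurable
  have hmA : Measurable fun z => ∑' K, waveAbs F K (t, z) :=
    Measurable.tsum fun K => (measurable_waveAbs hF K).comp (by fun_prop)
  obtain ⟨M, hM⟩ : ∃ M : ℝ, ∀ z, ‖φ z‖ ≤ M :=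
    ⟨_, fun z => SchwartzMap.norm_le_seminorm ℝ φ z⟩
  -- With s the sum of the moduli, s ≤ 1 or s ≤ s⁸, so |φ|s ≤ |φ| + M s⁸ and both terms are
  -- integrable.
  have hfin : ∫⁻ z, ∑' K, ‖φ z * wave (piece F K) (t, z)‖ₑ ≠ ⊤ := by
    have hle : ∀ z, ∑' K, ‖φ z * wave (piece F K) (t, z)‖ₑ
        ≤ ‖φ z‖ₑ + ENNReal.ofReal M * (∑' K, waveAbs F K (t, z)) ^ 8 := by
      intro z
      simp only [enorm_mul]
      rw [ENNReal.tsum_mul_left]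
      change ‖φ z‖ₑ * (∑' K, waveAbs F K (t, z)) ≤ _
      rcases le_total (∑' K, waveAbs F K (t, z)) 1 with h | h
      · refine le_add_right ?_
        calc _ ≤ ‖φ z‖ₑ * 1 := by gcongr
          _ = _ := mul_one _
      · refine le_add_left ?_
        gcongr
        · rw [← ofReal_norm]
          exact ENNReal.ofReal_le_ofReal (hM z)
        · exact le_self_pow h (by norm_num)
    refine ne_top_of_le_ne_top ?_ (lintegral_mono hle)
    rw [lintegral_add_right _ ((hmA.pow_const 8).const_mul _),
      lintegral_const_mul _ (hmA.pow_const 8)]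
    have h2 := φ.integrable (μ := volume) |>.2
    rw [hasFiniteIntegral_iff_enorm] at h2
    exact ENNReal.add_ne_top.2 ⟨h2.ne, ENNReal.mul_ne_top ENNReal.ofReal_ne_top ht⟩
  have hfin' : ∑' K, ∫⁻ z, ‖φ z * wave (piece F K) (t, z)‖ₑ ≠ ⊤ := by
    rwa [← lintegral_tsum fun K => (hm K).enorm]
  have heq : (fun z => φ z • solution F (t, z))
      = fun z => ∑' K, φ z * wave (piece F K) (t, z) := by
    ext z
    rw [solution, smul_eq_mul, tsum_mul_left]
  rw [heq]
  refine ⟨⟨?_, ?_⟩, ?_⟩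
  · refine aestronglyMeasurable_of_tendsto_ae (atTop : Filter (Finset (ℤ × ℤ)))
      (f := fun s z => ∑ K ∈ s, φ z * wave (piece F K) (t, z))
      (fun s => Finset.aestronglyMeasurable_fun_sum s fun K _ => hm K) ?_
    have hae := ae_lt_top' (AEMeasurable.tsum fun K => (hm K).enorm) hfin
    filter_upwards [hae] with z hz
    exact (Summable.of_enorm hz.ne).hasSum
  · rw [hasFiniteIntegral_iff_enorm]
    exact (lintegral_mono fun z => enorm_tsum_le_tsum_enorm).trans_lt hfin.lt_top
  · rw [propagator_ofFreq_apply, integral_tsum hm hfin']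

theorem aestronglyMeasurable_solution {F : Freq} (h : ∫⁻ q, (∑' K, waveAbs F K q) ^ 8 ≠ ⊤) :
    AEStronglyMeasurable (solution F) volume := by
  have hF := Lp.memLp F
  have hmA : Measurable fun q => ∑' K, waveAbs F K q :=
    Measurable.tsum fun K => measurable_waveAbs hF K
  refine aestronglyMeasurable_of_tendsto_ae (atTop : Filter (Finset (ℤ × ℤ)))
    (f := fun s q => ∑ K ∈ s, wave (piece F K) q)
    (fun s => Finset.aestronglyMeasurable_fun_sum s fun K _ =>
      (continuous_wave (integrable_piece hF K)).aestronglyMeasurable) ?_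
  filter_upwards [ae_lt_top (hmA.pow_const 8) h] with q hq
  have h2 : ∑' K, waveAbs F K q < ⊤ := (ENNReal.pow_lt_top_iff.1 hq).resolve_right (by norm_num)
  exact (Summable.of_enorm h2.ne).hasSum

/-- By Fubini almost every time slice is finite, so `solution F` is admissible in the infimum
defining the norm. -/
theorem strichartzNorm_pow_le {F : Freq} (h : ∫⁻ q, (∑' K, waveAbs F K q) ^ 8 ≠ ⊤) :
    strichartzNorm (ofFreq F) ^ 8 ≤ ∫⁻ q, (∑' K, waveAbs F K q) ^ 8 := by
  have hF := Lp.memLp F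
  have hmA : Measurable fun q => ∑' K, waveAbs F K q :=
    Measurable.tsum fun K => measurable_waveAbs hF K
  have hrep : ∀ᵐ t : ℝ, Represents (propagator t (ofFreq F)) fun z => solution F (t, z) := by
    rw [Measure.volume_eq_prod, lintegral_prod _ (hmA.pow_const 8).aemeasurable] at h
    filter_upwards [ae_lt_top (hmA.pow_const 8).lintegral_prod_right' h] with t ht
    exact represents_solution ht.ne
  have h1 : strichartzNorm (ofFreq F) ≤ eLpNorm (solution F) 8 volume :=
    iInf_le_of_le _ (iInf_le_of_le (aestronglyMeasurable_solution h) (iInf_le _ hrep))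
  have h2 : eLpNorm (solution F) 8 volume ^ 8 = ∫⁻ q, ‖solution F q‖ₑ ^ 8 := by
    have := eLpNorm_nnreal_pow_eq_lintegral (f := solution F) (μ := volume) (p := 8) (by norm_num)
    simpa using this
  refine (pow_le_pow_left₀ zero_le h1 8).trans (h2.le.trans (lintegral_mono fun q => ?_))
  gcongr
  exact enorm_tsum_le_tsum_enorm

theorem exists_strichartzNorm_le : ∃ C : ℝ≥0∞, C ≠ ⊤ ∧ ∀ (F : Freq) (μ : ℝ≥0∞),
    (∀ p : Par, ‖inner ℂ (p.op bump) F‖ₑ ^ 2 ≤ μ) →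
    strichartzNorm (ofFreq F) ^ 16 ≤ C * (μ * ‖F‖ₑ ^ 14) := by
  obtain ⟨C, hC, h⟩ := exists_refined_strichartz
  refine ⟨C, hC, fun F μ hμ => ?_⟩
  have hF2 : ∫⁻ ξ, ‖F ξ‖ₑ ^ 2 = ‖F‖ₑ ^ 2 := by rw [lintegral_sq_eq, Lp.enorm_def]
  have key : ∀ ν : ℝ≥0∞, (∀ p : Par, ‖inner ℂ (p.op bump) F‖ₑ ^ 2 ≤ ν) →
      (∫⁻ q, (∑' K, waveAbs F K q) ^ 8) ^ 2 ≤ C * (ν * ‖F‖ₑ ^ 14) := by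
    intro ν hν
    have h1 := h F (Lp.memLp F) ν fun K q => by
      rw [waveAbs_sq_eq]
      gcongr
      exact hν _
    rwa [hF2, ← pow_mul] at h1
  -- The given μ may be infinite; finiteness comes from the trivial Cauchy–Schwarz value instead.
  have hfin : ∫⁻ q, (∑' K, waveAbs F K q) ^ 8 ≠ ⊤ := by
    have h1 := key ((‖bump‖ₑ * ‖F‖ₑ) ^ 2) fun p => by
      gcongr
      rw [← ofReal_norm, ← ofReal_norm, ← ofReal_norm, ← ENNReal.ofReal_mul (norm_nonneg _)]
      refine ENNReal.ofReal_le_ofReal ((norm_inner_le_norm _ _).trans (le_of_eq ?_))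
      rw [LinearIsometryEquiv.norm_map]
    have h2 : (∫⁻ q, (∑' K, waveAbs F K q) ^ 8) ^ 2 < ⊤ := by
      refine h1.trans_lt (ENNReal.mul_lt_top hC.lt_top (ENNReal.mul_lt_top ?_ ?_))
      · exact ENNReal.pow_lt_top (ENNReal.mul_lt_top enorm_lt_top enorm_lt_top)
      · exact ENNReal.pow_lt_top enorm_lt_top
    exact ((ENNReal.pow_lt_top_iff.1 h2).resolve_right two_ne_zero).ne
  calc strichartzNorm (ofFreq F) ^ 16 = (strichartzNorm (ofFreq F) ^ 8) ^ 2 := by rw [← pow_mul]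
    _ ≤ (∫⁻ q, (∑' K, waveAbs F K q) ^ 8) ^ 2 := by
        gcongr
        exact strichartzNorm_pow_le hfin
    _ ≤ _ := key μ hμ

/-- Inverse Strichartz inequality: a function with large Strichartz norm correlates with a
transform of the reference profile. -/
theorem exists_le_inner_bump (A : ℝ) (ε : ℝ≥0∞) (hε : 0 < ε) :
    ∃ δ : ℝ, 0 < δ ∧ ∀ F : Freq, ‖F‖ ≤ A → ε < strichartzNorm (ofFreq F) →
      ∃ p : Par, δ ≤ ‖inner ℂ (p.op bump) F‖ := by
  obtain ⟨C, hC, h⟩ := exists_strichartzNorm_le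
  -- δ is any positive number with C δ² A¹⁴ < ε¹⁶.
  have hlim : Tendsto (fun δ : ℝ => C * (ENNReal.ofReal δ ^ 2 * ENNReal.ofReal A ^ 14)) (𝓝[>] 0)
      (𝓝 (C * (ENNReal.ofReal 0 ^ 2 * ENNReal.ofReal A ^ 14))) := by
    refine ENNReal.Tendsto.const_mul (ENNReal.Tendsto.mul_const ?_ (Or.inr ?_)) (Or.inr hC)
    · exact ((ENNReal.continuous_pow 2).tendsto _).comp
        (ENNReal.tendsto_ofReal (tendsto_id.mono_left nhdsWithin_le_nhds))
    · exact ENNReal.pow_ne_top ENNReal.ofReal_ne_top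
  have h0 : C * (ENNReal.ofReal 0 ^ 2 * ENNReal.ofReal A ^ 14) < ε ^ 16 := by
    simpa using ENNReal.pow_pos hε 16
  obtain ⟨δ, hδ, hδ0⟩ := ((hlim.eventually_lt_const h0).and self_mem_nhdsWithin).exists
  refine ⟨δ, hδ0, fun F hF hlt => ?_⟩
  by_contra! hcon
  have h1 := h F (ENNReal.ofReal δ ^ 2) fun p => by
    gcongr
    rw [← ofReal_norm]
    exact ENNReal.ofReal_le_ofReal (hcon p).le
  have h2 : ε ^ 16 ≤ strichartzNorm (ofFreq F) ^ 16 := by gcongr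
  refine (h2.trans (h1.trans ?_)).not_gt hδ
  gcongr
  rw [← ofReal_norm]
  exact ENNReal.ofReal_le_ofReal hF

end Strichartz

/-! ### Back to the original parameters -/

section Conclusion

/-- The spatial parameters of a symmetry in space-time. -/
def Par.toSym (p : Par) : Sym := ⟨p.X, p.Y, p.a, p.b, p.a_pos, p.b_pos⟩

/-- The time parameter of a symmetry in space-time. -/
noncomputable def Par.time (p : Par) : ℝ := p.S / (p.a * p.b)

theorem Par.withTime_toSym (p : Par) : p.toSym.withTime p.time = p := by
  have ha := p.a_pos.ne'
  have hb := p.b_pos.ne'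
  ext <;> simp [Par.toSym, Sym.withTime, Par.time]
  field_simp

theorem limsup_coe_eq_top {s : ℕ → ℝ} (h : Tendsto s atTop atTop) :
    limsup (fun n => (s n : EReal)) atTop = ⊤ :=
  (EReal.tendsto_coe_nhds_top_iff.2 h).limsup_eq

end Conclusion

end HypNLS

theorem mainTheorem4 (u : ℕ → 𝓢'(HypNLS.Plane, ℂ)) (A : ℝ)
    (hu : ∀ n, HypNLS.MemHh (u n)) (hA : ∀ n, HypNLS.hhNorm (u n) ≤ A) :
    ∃ σ : ℕ → ℕ, StrictMono σ ∧
    ∃ (φ : ℕ → 𝓢'(HypNLS.Plane, ℂ)) (t : ℕ → ℕ → ℝ) (g : ℕ → ℕ → HypNLS.Sym)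
      (w : ℕ → ℕ → 𝓢'(HypNLS.Plane, ℂ)),
      (∀ j, HypNLS.MemHh (φ j)) ∧
      (∀ J n, HypNLS.MemHh (w J n)) ∧
      (∀ J n, u (σ n) =
        (∑ j ∈ Finset.range J, (g j n).act (HypNLS.propagator (t j n) (φ j))) + w J n) ∧
      Tendsto (fun J => limsup (fun n => HypNLS.strichartzNorm (w J n)) atTop) atTop (𝓝 0) ∧
      (∀ J j, j < J →
        HypNLS.WeaklyNull (fun n => HypNLS.propagator (-t j n) ((g j n).actInv (w J n)))) ∧
      (∀ J, Tendsto (fun n => HypNLS.hhNorm (u (σ n)) ^ 2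
          - ∑ j ∈ Finset.range J, HypNLS.hhNorm (φ j) ^ 2 - HypNLS.hhNorm (w J n) ^ 2)
        atTop (𝓝 0)) ∧
      (∀ j k, j ≠ k →
        limsup (fun n => (HypNLS.separation (g j n) (t j n) (g k n) (t k n) : EReal)) atTop
          = ⊤) := by
  open HypNLS in
  choose U hU using fun n => (hu n).exists_ofFreq
  have hA' : ∀ n, ‖U n‖ ≤ A := fun n => by
    rw [← hhNorm_ofFreq, ← hU n]
    exact hA n
  have : Fact ((2 : ℝ≥0∞) ≠ ⊤) := ⟨by norm_num⟩
  have : TopologicalSpace.SeparableSpace Freq := inferInstance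
  obtain ⟨σ, hσ, φ, p, w, h1, h2, h3, h4, h5⟩ := symmetries.exists_profile_decomposition hA'
    (fun F => strichartzNorm (ofFreq F)) bump exists_le_inner_bump
  -- Every abstract parameter arises from a pair (g, t), with t = S/(λ₁λ₂).
  have hD : ∀ p : Par, symmetries.D p = (p.toSym.withTime p.time).op := fun p => by
    rw [p.withTime_toSym]; rfl
  have hsep : ∀ p q : Par, separation p.toSym p.time q.toSym q.time = symmetries.sep p q :=
    fun p q => by
      rw [separation_eq, p.withTime_toSym, q.withTime_toSym]; rfl
  refine ⟨σ, hσ, fun j => ofFreq (φ j), fun j n => (p j n).time, fun j n => (p j n).toSym,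
    fun J n => ofFreq (w J n), fun j => memHh_ofFreq _, fun J n => memHh_ofFreq _, fun J n => ?_, h2,
    fun J j hj => ?_, fun J => ?_, fun j k hjk => ?_⟩
  · rw [hU, h1 J n, ofFreq_add, ofFreq_sum]
    simp only [act_propagator_ofFreq, hD]
  · simp only [propagator_actInv_ofFreq]
    refine ⟨fun n => memHh_ofFreq _, fun ψ hψ => ?_⟩
    obtain ⟨G, rfl⟩ := hψ.exists_ofFreq
    simp only [hhInner_ofFreq, ← hD]
    simpa using h3 J j hj G
  · simp only [hU, hhNorm_ofFreq]
    exact h4 J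
  · refine limsup_coe_eq_top ?_
    -- The extraction separates each later frame from the earlier ones; symmetry of `separation`
    -- covers the other order. The separation has limit ∞, not only an infinite limsup.
    rcases lt_or_gt_of_ne hjk with h | h
    · simp only [separation_comm (p j _).toSym, hsep]
      exact h5 j k h
    · simp only [hsep]
      exact h5 k j h
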